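/- Let $T>0$, $Q=(0,\pi)\times(0,T)$. For data $\mathbf d=(u_0,u_1,f)$ let $u=u[\mathbf d]$ be the weak solution from the energy class ($u\in C([0,T];H^1_0(0,\pi))$, $\partial_tu\in C([0,T];L^2(0,\pi))$) of $$\partial_t^2u-\partial_x^2u=f\ \text{ in } Q,\qquad u|_{x=0,\pi}=0,\quad u|_{t=0}=u_0,\quad \partial_tu|_{t=0}=u_1 .$$ Let $h=\pi/N$, $\tau=T/M$, $x_i=ih$, $t_m=m\tau$ (with integers $N,M\ge1$), and $$\Lambda_xw_i=\tfrac{w_{i-1}-2w_i+w_{i+1}}{h^2},\quad s_N=I+\tfrac{h^2}{12}\Lambda_x,\quad \Lambda_ty^m=\tfrac{y^{m+1}-2y^m+y^{m-1}}{\tau^2},\quad \delta_ty^m=\tfrac{y^{m+1}-y^m}{\tau},\quad \bar\delta_xw_i=\tfrac{w_i-w_{i-1}}{h}.$$ Let $q_hw_i=\frac1h\int_{x_{i-1}}^{x_{i+1}}w(x)\,(1-|\tfrac xh-i|)\,dx$ for $1\le i\le N-1$, $q_\tau z^m=\frac1\tau\int_{t_{m-1}}^{t_{m+1}}z(t)\,(1-|\tfrac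 t\tau-m|)\,dt$ for $1\le m\le M-1$ and $q_\tau z^0=\frac2\tau\int_0^{\tau}z(t)(1-\tfrac t\tau)\,dt$. Let $v=v_{\mathbf h}[\mathbf d]$ be the solution of the compact scheme $$\big(s_N-\tfrac{\tau^2}{12}\Lambda_x\big)\Lambda_tv-\Lambda_xv=q_hq_\tau f\quad(1\le i\le N-1,\ 1\le m\le M-1),$$ $$\big(s_N-\tfrac{\tau^2}{12}\Lambda_x\big)\delta_tv^0-\tfrac\tau2\Lambda_xv^0=u_{1\mathbf h}+\tfrac\tau2(q_hq_\tau f)^0\quad(1\le i\le N-1),$$ $$v^0_i=u_0(x_i)\ (0\le i\le N),\qquad v^m_0=v^m_N=0\ (1\le m\le M),$$ where $u_{1\mathbf h}$ is any one of $s_Nu_1+\frac{\tau^2}{12}\Lambda_xu_1$, $\;q_hu_1+\frac{\tau^2}{12}\Lambda_xu_1$, $\;\big(I+\frac{\tau^2}{12}\Lambda_x\big)q_hu_1$ (with $q_hu_1:=0$ at $x=0,\pi$ in the last one). For a mesh function $w$ set $\|w\|_{L^1_{\mathbf h}(Q)}=\sum_{m=1}^M\frac\tau2\big(\|w^{m-1}\|+\|w^m\|\big)$,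 where $\|w^m\|=\sum_{i=1}^N\frac h2\big(|w^m_{i-1}|+|w^m_i|\big)$; for the difference quotient $\bar\delta_xw$ the inner norm is instead $\|\bar\delta_xw^m\|=\sum_{i=1}^N h\,|\bar\delta_xw^m_i|$. For real $s\ge0$ let $C^s$ denote the Hölder spaces on $[0,\pi]$ and on $\bar Q$ ($[s]$ times continuously differentiable functions with, for noninteger $s$, derivatives of order $[s]$ Hölder continuous of exponent $s-[s]$), normed by the sum of the maxima of all derivatives of order $\le[s]$ and, for noninteger $s$, of the Hölder seminorms of all derivatives of order $[s]$. Let $C^s_{(0)}$ be their subspaces, with the same norms, of functions satisfying for all $0\le 2r\le[s]$: $\partial_x^{2r}w|_{x=0,\pi}=0$ on $[0,\pi]$; respectively $\partial_x^{2r}f|_{x=0,\pi}=0$ and $\partial_t^{2r}f|_{t=0}=0$ on $\bar Q$. **Theorem.** Let $0<\varepsilon_0\le1$ and $l\in\{0,1\}$. There exist $h_0>0$ and $c_1>0$, depending only on $T$, $\varepsilon_0$ and $l$, such that for all meshes with $h\le h_0$ that satisfy the stability condition $\tau^2\le(1-\tfrac{\varepsilon_0^2}2)h^2$, for each of the three choices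 of $u_{1\mathbf h}$, the solutions $u$ and $v$ exist for all the data below, and for every real $\lambda$ with $l\le\lambda\le5+l$ (where $\lambda\ge1$ is required in addition if $l=0$ in (1) for $j=1$ and in (2)) one has $$\sup_{k\in\mathbb N,\ k\ge1}\ \frac{\|\bar\delta_x^{\,l}(u-v)[\mathbf d_k^{(j)}]\|_{L^1_{\mathbf h}(Q)}}{\|\sin kx\|_{C^{\lambda-j}_{(0)}([0,\pi])}}\ \ge\ c_1h^{4(\lambda-l)/5},\qquad j=0,1,\tag{1}$$ $$\sup_{k\in\mathbb N,\ k\ge2}\ \frac{\|\bar\delta_x^{\,l}(u-v)[\mathbf d_k^{(2)}]\|_{L^1_{\mathbf h}(Q)}}{\|\sin kx\,\sin(k-1)t\|_{C^{\lambda-1}_{(0)}(\bar Q)}}\ \ge\ c_1h^{4(\lambda-l)/5},\tag{2}$$ where $\mathbf d_k^{(0)}=(\sin kx,0,0)$, $\mathbf d_k^{(1)}=(0,\sin kx,0)$, $\mathbf d_k^{(2)}=(0,0,\sin kx\,\sin(k-1)t)$. -/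

import Mathlib

open Real Set MeasureTheory
open scoped ENNReal NNReal ContDiff

namespace CompactWave

noncomputable section

/-- Data `(u₀, u₁, f)` of the initial-boundary value problem
`∂ₜ²u - ∂ₓ²u = f` on `(0,π) × (0,T)`, `u|_{x=0,π} = 0`, `u|_{t=0} = u₀`, `∂ₜu|_{t=0} = u₁`. -/
structure WaveData where
  u0 : ℝ → ℝ
  u1 : ℝ → ℝ
  f : ℝ → ℝ → ℝ

/-- The harmonic data: `(sin kx, 0, 0)`, `(0, sin kx, 0)` and `(0, 0, sin kx · sin (k-1)t)`. -/
def harmonicData (j : Fin 3) (k : ℕ) : WaveData where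
  u0 := fun x => if j = 0 then sin (k * x) else 0
  u1 := fun x => if j = 1 then sin (k * x) else 0
  f := fun x t => if j = 2 then sin (k * x) * sin (((k : ℝ) - 1) * t) else 0

/-! ### The exact solution -/

/-- The space `L²(0,π)`. -/
abbrev L2I : Type := Lp ℝ 2 (volume.restrict (Ioo (0 : ℝ) π))

/-- `u` is a weak solution from the energy class: `u ∈ C([0,T]; H₀¹(0,π))`,
`∂ₜu ∈ C([0,T]; L²(0,π))`, `u|_{t=0} = u₀`, and the integral identity
`∫_Q (∂ₓu ∂ₓη - ∂ₜu ∂ₜη) = ∫_I u₁ η(·,0) + ∫_Q f η` holds for all smooth `η` that vanish at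
`x = 0, π` and at `t = T`.

An element of `H₀¹(0,π)` is the primitive, vanishing at `0` and `π`, of its weak derivative in
`L²(0,π)`; its norm is the `L²` norm of that derivative. The function `∂ₜu` is the derivative of
`t ↦ u(·,t)` as a map into `L²(0,π)`. -/
def IsWeakSolution (T : ℝ) (d : WaveData) (u : ℝ → ℝ → ℝ) : Prop :=
  ∃ U ux ut : ℝ → L2I,
    ContinuousOn ux (Icc 0 T) ∧
    (∀ t ∈ Icc 0 T, ∀ x ∈ Icc 0 π, u x t = ∫ y in (0 : ℝ)..x, ux t y) ∧
    (∀ t ∈ Icc 0 T, u π t = 0) ∧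
    (∀ t ∈ Icc 0 T, U t =ᵐ[volume.restrict (Ioo (0 : ℝ) π)] fun x => u x t) ∧
    (∀ t ∈ Icc 0 T, HasDerivWithinAt U (ut t) (Icc 0 T) t) ∧
    ContinuousOn ut (Icc 0 T) ∧
    (∀ x ∈ Icc 0 π, u x 0 = d.u0 x) ∧
    ∀ η : ℝ → ℝ → ℝ, ContDiff ℝ ∞ (fun z : ℝ × ℝ => η z.1 z.2) →
      (∀ t ∈ Icc 0 T, η 0 t = 0) → (∀ t ∈ Icc 0 T, η π t = 0) →
      (∀ x ∈ Icc 0 π, η x T = 0) →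
      (∫ t in (0 : ℝ)..T, ∫ x in (0 : ℝ)..π,
          (ux t x * deriv (fun y => η y t) x - ut t x * deriv (fun s => η x s) t)) =
        (∫ x in (0 : ℝ)..π, d.u1 x * η x 0) +
          ∫ t in (0 : ℝ)..T, ∫ x in (0 : ℝ)..π, d.f x t * η x t

/-! ### The compact scheme

Mesh functions are indexed by `i` (node `x = i h`) and `m` (node `t = m τ`); only the indices
`0 ≤ i ≤ N`, `0 ≤ m ≤ M` matter, and the operators below are used at inner nodes only. -/

/-- The Numerov average `s_N` in `x`. -/
def sN (w : ℕ → ℝ) (i : ℕ) : ℝ := (w (i - 1) + 10 * w i + w (i + 1)) / 12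

/-- The second difference quotient `Λₓ`. -/
def lapX (h : ℝ) (w : ℕ → ℝ) (i : ℕ) : ℝ := (w (i - 1) - 2 * w i + w (i + 1)) / h ^ 2

/-- The second difference quotient `Λₜ`. -/
def lapT (τ : ℝ) (y : ℕ → ℝ) (m : ℕ) : ℝ := (y (m + 1) - 2 * y m + y (m - 1)) / τ ^ 2

/-- The forward difference quotient `δₜ`. -/
def deltaT (τ : ℝ) (y : ℕ → ℝ) (m : ℕ) : ℝ := (y (m + 1) - y m) / τ

/-- The backward difference quotient `δ̄ₓ`, used for `1 ≤ i ≤ N`. -/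
def deltaBarX (h : ℝ) (w : ℕ → ℝ) (i : ℕ) : ℝ := (w i - w (i - 1)) / h

/-- The hat function of the node `i s` on the uniform mesh with step `s`. -/
def hat (s : ℝ) (i : ℕ) (x : ℝ) : ℝ := max (1 - |x / s - i|) 0

/-- The average `q_h`, used for `1 ≤ i ≤ N - 1`. -/
def qX (h : ℝ) (w : ℝ → ℝ) (i : ℕ) : ℝ :=
  1 / h * ∫ x in (((i : ℝ) - 1) * h)..(((i : ℝ) + 1) * h), w x * hat h i x

/-- The average `q_τ`, one-sided for `m = 0`. -/
def qT (τ : ℝ) (z : ℝ → ℝ) (m : ℕ) : ℝ :=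
  if m = 0 then 2 / τ * ∫ t in (0 : ℝ)..τ, z t * hat τ 0 t
  else 1 / τ * ∫ t in (((m : ℝ) - 1) * τ)..(((m : ℝ) + 1) * τ), z t * hat τ m t

/-- The free term `q_h q_τ f` of the scheme. -/
def fMesh (h τ : ℝ) (f : ℝ → ℝ → ℝ) (i m : ℕ) : ℝ :=
  qX h (fun x => qT τ (fun t => f x t) m) i

/-- The three approximations of the initial velocity:
`s_N u₁ + (τ²/12) Λₓ u₁`, `q_h u₁ + (τ²/12) Λₓ u₁` and `(I + (τ²/12) Λₓ) q_h u₁`, where in the last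
one `q_h u₁` is set to `0` at the end nodes. -/
def u1Mesh (ρ : Fin 3) (N : ℕ) (h τ : ℝ) (u1 : ℝ → ℝ) (i : ℕ) : ℝ :=
  let w : ℕ → ℝ := fun i => u1 (i * h)
  let q : ℕ → ℝ := fun i => if i = 0 ∨ i = N then 0 else qX h u1 i
  match ρ with
  | 0 => sN w i + τ ^ 2 / 12 * lapX h w i
  | 1 => qX h u1 i + τ ^ 2 / 12 * lapX h w i
  | 2 => q i + τ ^ 2 / 12 * lapX h q i

/-- The operator `s_N - (τ²/12) Λₓ`. -/
def schemeOp (h τ : ℝ) (w : ℕ → ℝ) (i : ℕ) : ℝ := sN w i - τ ^ 2 / 12 * lapX h w i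

/-- `v` solves the three-level compact scheme with `h = π/N`, `τ = T/M`. -/
structure IsSchemeSolution (ρ : Fin 3) (N M : ℕ) (h τ : ℝ) (d : WaveData) (v : ℕ → ℕ → ℝ) :
    Prop where
  eqn : ∀ i m, 1 ≤ i → i < N → 1 ≤ m → m < M →
    schemeOp h τ (fun i' => lapT τ (v i') m) i - lapX h (fun i' => v i' m) i = fMesh h τ d.f i m
  init_velocity : ∀ i, 1 ≤ i → i < N →
    schemeOp h τ (fun i' => deltaT τ (v i') 0) i - τ / 2 * lapX h (fun i' => v i' 0) i =
      u1Mesh ρ N h τ d.u1 i + τ / 2 * fMesh h τ d.f i 0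
  init_value : ∀ i, i ≤ N → v i 0 = d.u0 (i * h)
  left : ∀ m, 1 ≤ m → m ≤ M → v 0 m = 0
  right : ∀ m, 1 ≤ m → m ≤ M → v N m = 0

/-! ### Mesh `L¹` norms -/

/-- `∑_{i=1}^N ½ (|w_{i-1}| + |w_i|) h`. -/
def meshL1 (N : ℕ) (h : ℝ) (w : ℕ → ℝ) : ℝ :=
  ∑ i ∈ Finset.Icc 1 N, (|w (i - 1)| + |w i|) / 2 * h

/-- The mesh norm in `x` of `δ̄ₓˡ w`: `meshL1` of `w` for `l = 0`, and
`∑_{i=1}^N |δ̄ₓ w_i| h` for `l = 1`. -/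
def meshL1Diff (l : Fin 2) (N : ℕ) (h : ℝ) (w : ℕ → ℝ) : ℝ :=
  match l with
  | 0 => meshL1 N h w
  | 1 => ∑ i ∈ Finset.Icc 1 N, |deltaBarX h w i| * h

/-- The mesh `L¹(Q_T)` norm of `δ̄ₓˡ (u - v)`. -/
def errNorm (l : Fin 2) (N M : ℕ) (h τ : ℝ) (u : ℝ → ℝ → ℝ) (v : ℕ → ℕ → ℝ) : ℝ :=
  meshL1 M τ fun m => meshL1Diff l N h fun i => u (i * h) (m * τ) - v i m

/-! ### Hölder norms -/

/-- `w` is `[s]` times continuously differentiable on `[0,π]`, and its derivatives of even order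
up to `[s]` vanish at `0` and `π`. -/
def SmoothZeroI (s : ℝ) (w : ℝ → ℝ) : Prop :=
  ContDiffOn ℝ (⌊s⌋₊ : ℕ) w (Icc 0 π) ∧
    ∀ r : ℕ, 2 * r ≤ ⌊s⌋₊ → iteratedDerivWithin (2 * r) w (Icc 0 π) 0 = 0 ∧
      iteratedDerivWithin (2 * r) w (Icc 0 π) π = 0

open Classical in
/-- The norm of `C_{(0)}^s([0,π])`, `s ≥ 0`, equal to `∞` off this space: the sum of the maxima of
the derivatives of order up to `[s]` and, for noninteger `s`, of the Hölder seminorm of exponent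
`s - [s]` of the derivative of order `[s]`. -/
def holderNormI (s : ℝ) (w : ℝ → ℝ) : ℝ≥0∞ :=
  if SmoothZeroI s w then
    (∑ p ∈ Finset.range (⌊s⌋₊ + 1), ⨆ x ∈ Icc 0 π, ‖iteratedDerivWithin p w (Icc 0 π) x‖ₑ) +
      if s = ⌊s⌋₊ then 0
      else eHolderNorm (s - ⌊s⌋₊).toNNReal
        (fun x : Icc 0 π => iteratedDerivWithin ⌊s⌋₊ w (Icc 0 π) x)
  else ∞

/-- The partial derivative `∂ₓᵖ∂ₜ^q f` on `[0,π] × [0,T]`, one-sided at the boundary. -/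
def partialD (T : ℝ) (p q : ℕ) (f : ℝ → ℝ → ℝ) (x t : ℝ) : ℝ :=
  iteratedDerivWithin p (fun y => iteratedDerivWithin q (fun s => f y s) (Icc 0 T) t) (Icc 0 π) x

/-- `f` is `[s]` times continuously differentiable on `[0,π] × [0,T]`, and for even `2r ≤ [s]` the
derivatives `∂ₓ^{2r} f` vanish at `x = 0, π` and `∂ₜ^{2r} f` vanish at `t = 0`. -/
def SmoothZeroQ (T s : ℝ) (f : ℝ → ℝ → ℝ) : Prop :=
  ContDiffOn ℝ (⌊s⌋₊ : ℕ) (fun z : ℝ × ℝ => f z.1 z.2) (Icc 0 π ×ˢ Icc 0 T) ∧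
    ∀ r : ℕ, 2 * r ≤ ⌊s⌋₊ →
      (∀ t ∈ Icc 0 T, partialD T (2 * r) 0 f 0 t = 0 ∧ partialD T (2 * r) 0 f π t = 0) ∧
      ∀ x ∈ Icc 0 π, partialD T 0 (2 * r) f x 0 = 0

/-- The closed rectangle `[0,π] × [0,T]` with the Euclidean distance. -/
abbrev RectQ (T : ℝ) : Type :=
  {z : EuclideanSpace ℝ (Fin 2) // z 0 ∈ Icc 0 π ∧ z 1 ∈ Icc 0 T}

open Classical in
/-- The norm of `C_{(0)}^s([0,π] × [0,T])`, `s ≥ 0`, equal to `∞` off this space: the sum of the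
maxima of all partial derivatives of order up to `[s]` and, for noninteger `s`, of the Hölder
seminorms of exponent `s - [s]` of all partial derivatives of order `[s]`. -/
def holderNormQ (T s : ℝ) (f : ℝ → ℝ → ℝ) : ℝ≥0∞ :=
  if SmoothZeroQ T s f then
    (∑ p ∈ Finset.range (⌊s⌋₊ + 1), ∑ q ∈ Finset.range (⌊s⌋₊ + 1 - p),
        ⨆ x ∈ Icc 0 π, ⨆ t ∈ Icc 0 T, ‖partialD T p q f x t‖ₑ) +
      if s = ⌊s⌋₊ then 0
      else ∑ p ∈ Finset.range (⌊s⌋₊ + 1), eHolderNorm (s - ⌊s⌋₊).toNNReal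
        (fun z : RectQ T => partialD T p (⌊s⌋₊ - p) f (z.1 0) (z.1 1))
  else ∞

end

end CompactWave

/-! Everything reduces to one harmonic per mesh. For data proportional to sin kx, both the exact and
the discrete solution are sin kx times a function of time: the exact one oscillates with frequency
k, the discrete one with a frequency μ fixed by the dispersion relation of the scheme. A Taylor
expansion (`abs_dispersion_sub_le`) shows that the lag δ = k - μ is comparable to k⁵h⁴, from above
and from below (`exists_numerical_frequency`). The lower bound uses the gap in the stability
condition: the leading coefficient contains 1 - (τ/h)⁴, which vanishes at τ = h.

Choosing k of order h^(-4/5) (`resonant_wave_number`) keeps δ between two positive constants, while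
k → ∞ and kh → 0. The two solutions then drift out of phase by a fixed amount, so on [T/2, T] the
error is as large as the solution itself. To see this in L¹, the error is tested with -sin kt or cos
kt: the product is a slow term, sin δt or sin δt - δ sin t, which stays positive, plus oscillations
of frequency at least k, whose mesh sums are O(1/k) (`le_sum_abs_of_test`, `abs_sum_sin_le`). As kh
→ 0, the suitably scaled discrete amplitudes tend to limits, so they cause only a small perturbation
(`sum_abs_perturb`). In the forced problem the resonance defect enters as well: k² - (k-1)² = 2k - 1
becomes approximately (2k - 1)(1 - δ).

The mesh norm in x contributes a factor k^l, so the errors are at least c k^l for u₀ and c k^(l-1)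
for u₁ and f. The Hölder norms of order s of the data are at most 63 k^s. The quotient is thus at
least a multiple of k^(-(λ-l)), and k⁵h⁴ ≤ 1 turns this into h^(4(λ-l)/5) (`le_error_div_norm`). A
single k serves all λ and all three suprema.

The bounds concern arbitrary solutions u and v, while the computation is made for explicit ones;
uniqueness of weak solutions and of mesh solutions bridges this. -/

namespace CompactWave

/-! ### Symbols of the mesh operators and separation of variables in the scheme -/

/-- The eigenvalue of `-Λₓ` on `sin (k x)`. -/
noncomputable def symX (h : ℝ) (k : ℕ) : ℝ := 2 * (1 - cos (k * h)) / h ^ 2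

/-- The eigenvalue of `s_N - (τ²/12) Λₓ` on `sin (k x)`. -/
noncomputable def symOp (h τ : ℝ) (k : ℕ) : ℝ := 1 - (h ^ 2 - τ ^ 2) / 12 * symX h k

/-- The multiplier of the hat average on `sin (β x)`. -/
noncomputable def symQ (s β : ℝ) : ℝ := 1 / s * ∫ x in (-s)..s, cos (β * x) * hat s 0 x

/-- The multiplier of the initial velocity approximation on `sin (k x)`. -/
noncomputable def symU1 (ρ : Fin 3) (h τ : ℝ) (k : ℕ) : ℝ :=
  match ρ with
  | 0 => 1 - h ^ 2 / 12 * symX h k - τ ^ 2 / 12 * symX h k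
  | 1 => symQ h k - τ ^ 2 / 12 * symX h k
  | 2 => (1 - τ ^ 2 / 12 * symX h k) * symQ h k

theorem continuous_hat (s : ℝ) (i : ℕ) : Continuous (hat s i) := by
  unfold hat; fun_prop

theorem hat_nonneg (s : ℝ) (i : ℕ) (x : ℝ) : 0 ≤ hat s i x := le_max_right _ _

theorem hat_add_node {s : ℝ} (hs : s ≠ 0) (i : ℕ) (x : ℝ) : hat s i (x + i * s) = hat s 0 x := by
  unfold hat
  congr 3
  field_simp
  simp

/-- After the shift to the node 0 the addition formula splits the integrand; the sine part drops out
because the hat function is even. -/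
theorem integral_sin_mul_hat {s : ℝ} (hs : s ≠ 0) (β : ℝ) (i : ℕ) :
    ∫ x in (((i : ℝ) - 1) * s)..(((i : ℝ) + 1) * s), sin (β * x) * hat s i x =
      (∫ x in (-s)..s, cos (β * x) * hat s 0 x) * sin (β * (i * s)) := by
  have hc := continuous_hat s 0
  have hodd : ∫ x in (-s)..s, sin (β * x) * hat s 0 x = 0 := by
    have := intervalIntegral.integral_comp_neg (a := -s) (b := s)
      (fun x => sin (β * x) * hat s 0 x)
    have he : ∀ x, hat s 0 (-x) = hat s 0 x := by
      intro x; simp [hat, neg_div]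
    simp only [he, mul_neg, sin_neg, neg_mul, neg_neg, intervalIntegral.integral_neg] at this
    linarith
  have h1 : (((i : ℝ) - 1) * s) = -s + i * s := by ring
  have h2 : (((i : ℝ) + 1) * s) = s + i * s := by ring
  rw [h1, h2, ← intervalIntegral.integral_comp_add_right]
  simp only [hat_add_node hs]
  have : ∀ x, sin (β * (x + i * s)) * hat s 0 x =
      (sin (β * x) * hat s 0 x) * cos (β * (i * s)) +
        (cos (β * x) * hat s 0 x) * sin (β * (i * s)) := by
    intro x; rw [mul_add, sin_add]; ring
  simp only [this]
  rw [intervalIntegral.integral_add, intervalIntegral.integral_mul_const,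
    intervalIntegral.integral_mul_const, hodd]
  · ring
  · exact Continuous.intervalIntegrable (by fun_prop) _ _
  · exact Continuous.intervalIntegrable (by fun_prop) _ _

theorem qX_sin {h : ℝ} (hh : h ≠ 0) (β c : ℝ) (i : ℕ) :
    qX h (fun x => sin (β * x) * c) i = symQ h β * sin (β * (i * h)) * c := by
  unfold qX symQ
  have := integral_sin_mul_hat hh β i
  simp only [mul_right_comm _ c, intervalIntegral.integral_mul_const]
  rw [this]; ring

theorem qT_const_mul (τ : ℝ) (z : ℝ → ℝ) (c : ℝ) (m : ℕ) :
    qT τ (fun t => c * z t) m = c * qT τ z m := by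
  unfold qT
  simp only [mul_assoc c, intervalIntegral.integral_const_mul]
  split_ifs <;> ring

theorem qT_sin {τ : ℝ} (hτ : τ ≠ 0) (β : ℝ) {m : ℕ} (hm : 1 ≤ m) :
    qT τ (fun t => sin (β * t)) m = symQ τ β * sin (β * (m * τ)) := by
  have := qX_sin hτ β 1 m
  simp only [mul_one] at this
  rw [← this]
  simp [qT, qX, Nat.one_le_iff_ne_zero.mp hm]

theorem sin_node_pred_add_succ (β h : ℝ) {i : ℕ} (hi : 1 ≤ i) :
    sin (β * ((i - 1 : ℕ) * h)) + sin (β * ((i + 1 : ℕ) * h)) =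
      2 * cos (β * h) * sin (β * (i * h)) := by
  push_cast [Nat.cast_sub hi]
  rw [show β * (((i : ℝ) - 1) * h) = β * (i * h) - β * h by ring,
    show β * (((i : ℝ) + 1) * h) = β * (i * h) + β * h by ring, sin_sub, sin_add]
  ring

theorem lapX_sin {h : ℝ} (k : ℕ) (c : ℝ) {i : ℕ} (hi : 1 ≤ i) :
    lapX h (fun i => sin (k * (i * h)) * c) i = -symX h k * sin (k * (i * h)) * c := by
  have := sin_node_pred_add_succ k h hi
  unfold lapX symX
  linear_combination c / h ^ 2 * this

theorem sN_sin {h : ℝ} (hh : h ≠ 0) (k : ℕ) (c : ℝ) {i : ℕ} (hi : 1 ≤ i) :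
    sN (fun i => sin (k * (i * h)) * c) i =
      (1 - h ^ 2 / 12 * symX h k) * sin (k * (i * h)) * c := by
  have := sin_node_pred_add_succ k h hi
  have h2 : h ^ 2 * symX h k = 2 * (1 - cos (k * h)) := by unfold symX; field_simp
  unfold sN
  linear_combination c / 12 * this + sin (k * (i * h)) * c / 12 * h2

theorem schemeOp_sin {h : ℝ} (hh : h ≠ 0) (τ : ℝ) (k : ℕ) (c : ℝ) {i : ℕ} (hi : 1 ≤ i) :
    schemeOp h τ (fun i => sin (k * (i * h)) * c) i =
      symOp h τ k * sin (k * (i * h)) * c := by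
  unfold schemeOp symOp
  rw [lapX_sin k c hi, sN_sin hh k c hi]
  ring

theorem sin_node_last {N : ℕ} (hN : 0 < N) {h : ℝ} (hh : h = π / N) (k : ℕ) :
    sin (k * (N * h)) = 0 := by
  have : (N : ℝ) ≠ 0 := by positivity
  rw [hh, mul_div_cancel₀ _ this, sin_nat_mul_pi]

theorem u1Mesh_sin {N : ℕ} (hN : 0 < N) {h : ℝ} (hh : h = π / N) (ρ : Fin 3) (τ : ℝ) (k : ℕ)
    (c : ℝ) {i : ℕ} (hi : 1 ≤ i) :
    u1Mesh ρ N h τ (fun x => sin (k * x) * c) i = symU1 ρ h τ k * sin (k * (i * h)) * c := by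
  have hh0 : h ≠ 0 := by rw [hh]; positivity
  unfold u1Mesh symU1
  fin_cases ρ
  · dsimp only
    rw [sN_sin hh0 k c hi, lapX_sin k c hi]; ring
  · dsimp only
    rw [qX_sin hh0 k c i, lapX_sin k c hi]; ring
  · dsimp only
    -- The zeros prescribed at the end nodes are the values of sin kx there, so the averaged
    -- function is a multiple of the same harmonic at every node.
    have : (fun i : ℕ => if i = 0 ∨ i = N then 0 else qX h (fun x => sin (k * x) * c) i) =
        fun i : ℕ => sin (k * (i * h)) * (symQ h k * c) := by
      funext i
      split_ifs with hi
      · rcases hi with rfl | rfl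
        · simp
        · rw [sin_node_last hN hh, zero_mul]
      · rw [qX_sin hh0]; ring
    rw [this, lapX_sin k _ hi]
    have h3 := congrFun this i
    rw [h3]; ring

/-- Separation of variables for the scheme. -/
theorem IsSchemeSolution.of_sin {ρ : Fin 3} {N M : ℕ} {h τ : ℝ} (hN : 0 < N) (hh : h = π / N)
    {k : ℕ} {d : WaveData} {a b : ℝ} {z : ℝ → ℝ} (h0 : d.u0 = fun x => sin (k * x) * a)
    (h1 : d.u1 = fun x => sin (k * x) * b) (hf : d.f = fun x t => sin (k * x) * z t)
    {y : ℕ → ℝ} (hy0 : y 0 = a)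
    (hy1 : symOp h τ k * ((y 1 - y 0) / τ) + τ / 2 * symX h k * y 0 =
      symU1 ρ h τ k * b + τ / 2 * (symQ h k * qT τ z 0))
    (hy : ∀ m, 1 ≤ m → symOp h τ k * lapT τ y m + symX h k * y m = symQ h k * qT τ z m) :
    IsSchemeSolution ρ N M h τ d fun i m => sin (k * (i * h)) * y m := by
  have hh0 : h ≠ 0 := by rw [hh]; positivity
  have hF : ∀ i m, fMesh h τ d.f i m = symQ h k * sin (k * (i * h)) * qT τ z m := by
    intro i m
    unfold fMesh
    simp only [hf, qT_const_mul]
    exact qX_sin hh0 _ _ _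
  refine ⟨?_, ?_, ?_, ?_, ?_⟩
  · intro i m hi _ hm _
    have e : ∀ i' : ℕ, lapT τ (fun m => sin (k * (i' * h)) * y m) m =
        sin (k * (i' * h)) * lapT τ y m := by intro i'; unfold lapT; ring
    simp only [e]
    rw [schemeOp_sin hh0 τ k _ hi, lapX_sin k _ hi, hF]
    linear_combination sin (k * (i * h)) * hy m hm
  · intro i hi _
    have e : ∀ i' : ℕ, deltaT τ (fun m => sin (k * (i' * h)) * y m) 0 =
        sin (k * (i' * h)) * ((y 1 - y 0) / τ) := by intro i'; unfold deltaT; ring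
    simp only [e]
    rw [schemeOp_sin hh0 τ k _ hi, lapX_sin k _ hi, hF, h1, u1Mesh_sin hN hh ρ τ k b hi]
    linear_combination sin (k * (i * h)) * hy1
  · intro i _
    simp only [h0, hy0]
  · intro m _ _; simp
  · intro m _ _; simp only [sin_node_last hN hh, zero_mul]

/-! ### Existence and uniqueness for the scheme -/

theorem symX_nonneg (h : ℝ) (k : ℕ) : 0 ≤ symX h k := by
  unfold symX
  have := cos_le_one (k * h)
  have : 0 ≤ 1 - cos (k * h) := by linarith
  positivity

theorem symX_le {h : ℝ} (hh : 0 < h) (k : ℕ) : h ^ 2 * symX h k ≤ 4 := by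
  have h2 : h ^ 2 * symX h k = 2 * (1 - cos (k * h)) := by unfold symX; field_simp
  rw [h2]; linarith [neg_one_le_cos (k * h)]

theorem symOp_pos {h τ : ℝ} (hh : 0 < h) (k : ℕ) : 0 < symOp h τ k := by
  have h1 := symX_le hh k
  have h2 := mul_nonneg (sq_nonneg τ) (symX_nonneg h k)
  unfold symOp
  linarith

theorem exists_second_order_recursion (a b : ℝ) (F : ℕ → ℝ → ℝ → ℝ) :
    ∃ y : ℕ → ℝ, y 0 = a ∧ y 1 = b ∧ ∀ m, y (m + 2) = F m (y m) (y (m + 1)) := by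
  let Y : ℕ → ℝ × ℝ := fun m => Nat.rec (a, b) (fun m p => (p.2, F m p.1 p.2)) m
  exact ⟨fun m => (Y m).1, rfl, rfl, fun m => rfl⟩

theorem exists_isSchemeSolution (ρ : Fin 3) {N M : ℕ} {h τ : ℝ} (hN : 0 < N) (hh : h = π / N)
    (hτ : τ ≠ 0) (j : Fin 3) (k : ℕ) :
    ∃ v, IsSchemeSolution ρ N M h τ (harmonicData j k) v := by
  have hh0 : 0 < h := by rw [hh]; positivity
  have hs : symOp h τ k ≠ 0 := (symOp_pos hh0 k).ne'
  set a : ℝ := if j = 0 then 1 else 0 with ha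
  set b : ℝ := if j = 1 then 1 else 0 with hb
  set z : ℝ → ℝ := fun t => if j = 2 then sin (((k : ℝ) - 1) * t) else 0 with hz
  -- Existence is needed for every k ≥ 1, also where no real frequency μ has been produced, so the
  -- time factor is built level by level: the equations are solved for the newest value, which is
  -- possible as the symbol `symOp` is positive.
  obtain ⟨y, hy0, hy1, hy⟩ := exists_second_order_recursion a
    (a + τ / symOp h τ k * (symU1 ρ h τ k * b + τ / 2 * (symQ h k * qT τ z 0)
      - τ / 2 * symX h k * a))
    (fun m p q => 2 * q - p + τ ^ 2 / symOp h τ k * (symQ h k * qT τ z (m + 1) - symX h k * q))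
  refine ⟨_, IsSchemeSolution.of_sin hN hh (k := k) (a := a) (b := b) (z := z) ?_ ?_ ?_ hy0 ?_ ?_⟩
  · funext x; simp only [harmonicData, ha]; split_ifs <;> simp
  · funext x; simp only [harmonicData, hb]; split_ifs <;> simp
  · funext x t; simp only [harmonicData, hz]; split_ifs <;> simp
  · rw [hy0, hy1]; field_simp; ring
  · intro m hm
    obtain ⟨m, rfl⟩ : ∃ m', m = m' + 1 := ⟨m - 1, by omega⟩
    unfold lapT
    rw [show m + 1 + 1 = m + 2 from rfl, hy, Nat.add_sub_cancel]
    field_simp; ring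

/-- Maximum principle: with s = τ²/h² ≤ 1 the diagonal weight 10 + 2s exceeds 2(1 - s), the sum of
the two neighbouring weights, so a nonzero value of maximal modulus is impossible at an inner node.
-/
theorem eq_zero_of_schemeOp_eq_zero {N : ℕ} {h τ : ℝ} (hh : 0 < h) (hτ : τ ^ 2 ≤ h ^ 2)
    {w : ℕ → ℝ} (h0 : w 0 = 0) (hN : w N = 0)
    (hw : ∀ i, 1 ≤ i → i < N → schemeOp h τ w i = 0) : ∀ i ≤ N, w i = 0 := by
  obtain ⟨j, hj, hmax⟩ := Finset.exists_max_image (Finset.range (N + 1)) (fun i => |w i|)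
    ⟨0, by simp⟩
  have key : w j = 0 := by
    by_contra hne
    have hj0 : j ≠ 0 := fun e => hne (e ▸ h0)
    have hjN : j ≠ N := fun e => hne (e ▸ hN)
    have hj' : j < N + 1 := by simpa using hj
    have e := hw j (by omega) (by omega)
    have m1 := hmax (j - 1) (by simp; omega)
    have m2 := hmax (j + 1) (by simp; omega)
    set s := τ ^ 2 / h ^ 2 with hs
    have hs0 : 0 ≤ s := by positivity
    have hs1 : s ≤ 1 := by rw [hs, div_le_one (by positivity)]; exact hτ
    have e2 : (10 + 2 * s) * w j = -((1 - s) * (w (j - 1) + w (j + 1))) := by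
      have : τ ^ 2 / 12 * lapX h w j = s / 12 * (w (j - 1) - 2 * w j + w (j + 1)) := by
        unfold lapX; rw [hs]; ring
      unfold schemeOp sN at e
      rw [this] at e
      linarith
    have e3 : (10 + 2 * s) * |w j| = (1 - s) * |w (j - 1) + w (j + 1)| := by
      rw [← abs_of_nonneg (show 0 ≤ 10 + 2 * s by linarith), ← abs_mul, e2, abs_neg, abs_mul,
        abs_of_nonneg (show 0 ≤ 1 - s by linarith)]
    have e4 : |w (j - 1) + w (j + 1)| ≤ 2 * |w j| := by
      have := abs_add_le (w (j - 1)) (w (j + 1)); linarith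
    have hp : 0 < |w j| := abs_pos.mpr hne
    nlinarith
  intro i hi
  have := hmax i (by simp; omega)
  simp only [key, abs_zero] at this
  exact abs_eq_zero.mp (le_antisymm this (abs_nonneg _))

theorem schemeOp_sub_mul (h τ c : ℝ) (w w' : ℕ → ℝ) (i : ℕ) :
    schemeOp h τ (fun i => (w i - w' i) * c) i = (schemeOp h τ w i - schemeOp h τ w' i) * c := by
  unfold schemeOp sN lapX; ring

/-- On each new time level the difference of two solutions is annihilated by `schemeOp` and vanishes
at the ends. The induction carries two consecutive levels because the scheme has three. -/
theorem IsSchemeSolution.unique {ρ : Fin 3} {N M : ℕ} {h τ : ℝ} (hh : 0 < h) (hτ0 : τ ≠ 0)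
    (hτ : τ ^ 2 ≤ h ^ 2) {d : WaveData} {v v' : ℕ → ℕ → ℝ} (hM : 0 < M)
    (hv : IsSchemeSolution ρ N M h τ d v) (hv' : IsSchemeSolution ρ N M h τ d v') :
    ∀ m ≤ M, ∀ i ≤ N, v i m = v' i m := by
  have L0 : ∀ i ≤ N, v i 0 = v' i 0 := fun i hi => by rw [hv.init_value i hi, hv'.init_value i hi]
  have lx : ∀ m, (∀ i ≤ N, v i m = v' i m) → ∀ i, 1 ≤ i → i < N →
      lapX h (fun i' => v i' m) i = lapX h (fun i' => v' i' m) i := by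
    intro m hm i hi hiN
    unfold lapX
    simp only [hm (i - 1) (by omega), hm i hiN.le, hm (i + 1) hiN]
  have step : ∀ m, m + 1 ≤ M → (∀ i, 1 ≤ i → i < N →
      schemeOp h τ (fun i' => (v i' (m + 1) - v' i' (m + 1)) * 1) i = 0) →
      ∀ i ≤ N, v i (m + 1) = v' i (m + 1) := by
    intro m hm hi i hiN
    have := eq_zero_of_schemeOp_eq_zero hh hτ (w := fun i' => (v i' (m + 1) - v' i' (m + 1)) * 1)
      (by simp [hv.left (m + 1) (by omega) hm, hv'.left (m + 1) (by omega) hm])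
      (by simp [hv.right (m + 1) (by omega) hm, hv'.right (m + 1) (by omega) hm]) hi i hiN
    linarith
  have L1 : ∀ i ≤ N, v i 1 = v' i 1 := by
    refine step 0 hM fun i hi hiN => ?_
    have e := (hv.init_velocity i hi hiN).trans (hv'.init_velocity i hi hiN).symm
    rw [lx 0 L0 i hi hiN, sub_left_inj] at e
    -- Agreement on the previous level is known only for indices up to N, so the identity is
    -- restricted to the stencil of `schemeOp`.
    have e2 : ∀ i' ∈ ({i - 1, i, i + 1} : Set ℕ), (v i' 1 - v' i' 1) * 1 =
        (deltaT τ (v i') 0 - deltaT τ (v' i') 0) * τ := by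
      intro i' hi'
      have : v i' 0 = v' i' 0 := L0 i' (by simp at hi'; omega)
      unfold deltaT; rw [this]; field_simp; ring
    have e3 := schemeOp_sub_mul h τ τ (fun i' => deltaT τ (v i') 0) (fun i' => deltaT τ (v' i') 0) i
    rw [e, sub_self, zero_mul] at e3
    rw [← e3]
    simp only [schemeOp, sN, lapX, zero_add, e2 (i - 1) (by simp), e2 i (by simp),
      e2 (i + 1) (by simp)]
  have all : ∀ m, (m ≤ M → ∀ i ≤ N, v i m = v' i m) ∧
      (m + 1 ≤ M → ∀ i ≤ N, v i (m + 1) = v' i (m + 1)) := by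
    intro m
    induction m with
    | zero => exact ⟨fun _ => L0, fun _ => L1⟩
    | succ m ih =>
      refine ⟨ih.2, fun hm => step (m + 1) hm fun i hi hiN => ?_⟩
      have A0 := ih.1 (by omega)
      have A1 := ih.2 (by omega)
      have e := (hv.eqn i (m + 1) hi hiN (by omega) (by omega)).trans
        (hv'.eqn i (m + 1) hi hiN (by omega) (by omega)).symm
      rw [lx (m + 1) A1 i hi hiN, sub_left_inj] at e
      have e2 : ∀ i' ∈ ({i - 1, i, i + 1} : Set ℕ), (v i' (m + 1 + 1) - v' i' (m + 1 + 1)) * 1 =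
          (lapT τ (v i') (m + 1) - lapT τ (v' i') (m + 1)) * τ ^ 2 := by
        intro i' hi'
        have a0 : v i' m = v' i' m := A0 i' (by simp at hi'; omega)
        have a1 : v i' (m + 1) = v' i' (m + 1) := A1 i' (by simp at hi'; omega)
        unfold lapT; rw [Nat.add_sub_cancel, a0, a1]; field_simp; ring
      have e3 := schemeOp_sub_mul h τ (τ ^ 2) (fun i' => lapT τ (v i') (m + 1))
        (fun i' => lapT τ (v' i') (m + 1)) i
      rw [e, sub_self, zero_mul] at e3
      rw [← e3]
      simp only [schemeOp, sN, lapX, e2 (i - 1) (by simp), e2 i (by simp), e2 (i + 1) (by simp)]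
  exact fun m => (all m).1

/-! ### Separated weak solutions of the wave equation -/

theorem integral_congr_of_ae_Ioo {a b : ℝ} {f g : ℝ → ℝ}
    (hfg : f =ᵐ[volume.restrict (Ioo a b)] g) {x : ℝ} (hx : x ∈ Icc a b) :
    ∫ y in a..x, f y = ∫ y in a..x, g y := by
  rw [intervalIntegral.integral_of_le hx.1, intervalIntegral.integral_of_le hx.1,
    integral_Ioc_eq_integral_Ioo, integral_Ioc_eq_integral_Ioo]
  exact integral_congr_ae (ae_mono (Measure.restrict_mono (Ioo_subset_Ioo_right hx.2) le_rfl) hfg)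

theorem memLp_of_continuous {a b : ℝ} {f : ℝ → ℝ} (hf : Continuous f) :
    MemLp f 2 (volume.restrict (Ioo a b)) := by
  obtain ⟨C, hC⟩ := isCompact_Icc (a := a) (b := b) |>.exists_bound_of_continuousOn hf.continuousOn
  refine MemLp.of_bound hf.aestronglyMeasurable C ?_
  exact ae_restrict_of_forall_mem measurableSet_Ioo fun x hx => hC x (Ioo_subset_Icc_self hx)

theorem hasDerivAt_partial_fst {η : ℝ → ℝ → ℝ}
    (hη : ContDiff ℝ ∞ fun z : ℝ × ℝ => η z.1 z.2) (x t : ℝ) :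
    HasDerivAt (fun y => η y t) (fderiv ℝ (fun z : ℝ × ℝ => η z.1 z.2) (x, t) (1, 0)) x := by
  have h1 := (hη.differentiable (by simp) (x, t)).hasFDerivAt
  exact h1.comp_hasDerivAt x ((hasDerivAt_id x).prodMk (hasDerivAt_const x t))

theorem hasDerivAt_partial_snd {η : ℝ → ℝ → ℝ}
    (hη : ContDiff ℝ ∞ fun z : ℝ × ℝ => η z.1 z.2) (x t : ℝ) :
    HasDerivAt (fun s => η x s) (fderiv ℝ (fun z : ℝ × ℝ => η z.1 z.2) (x, t) (0, 1)) t := by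
  have h1 := (hη.differentiable (by simp) (x, t)).hasFDerivAt
  exact h1.comp_hasDerivAt t ((hasDerivAt_const t x).prodMk (hasDerivAt_id t))

theorem continuous_partial_fst {η : ℝ → ℝ → ℝ}
    (hη : ContDiff ℝ ∞ fun z : ℝ × ℝ => η z.1 z.2) :
    Continuous fun z : ℝ × ℝ => deriv (fun y => η y z.2) z.1 := by
  simp only [(hasDerivAt_partial_fst hη _ _).deriv]
  exact (hη.continuous_fderiv (by simp)).clm_apply continuous_const

theorem continuous_partial_snd {η : ℝ → ℝ → ℝ}
    (hη : ContDiff ℝ ∞ fun z : ℝ × ℝ => η z.1 z.2) :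
    Continuous fun z : ℝ × ℝ => deriv (fun s => η z.1 s) z.2 := by
  simp only [(hasDerivAt_partial_snd hη _ _).deriv]
  exact (hη.continuous_fderiv (by simp)).clm_apply continuous_const

theorem interval_swap_of_continuous {F : ℝ → ℝ → ℝ} (hF : Continuous fun z : ℝ × ℝ => F z.1 z.2)
    (a b c d : ℝ) :
    ∫ x in a..b, ∫ y in c..d, F x y = ∫ y in c..d, ∫ x in a..b, F x y := by
  apply intervalIntegral_intervalIntegral_swap
  have : IntegrableOn (fun z : ℝ × ℝ => F z.1 z.2) (uIcc a b ×ˢ uIcc c d) :=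
    hF.continuousOn.integrableOn_compact (isCompact_uIcc.prod isCompact_uIcc)
  exact this.mono_set (prod_mono uIoc_subset_uIcc uIoc_subset_uIcc)

theorem hasDerivAt_sin_mul (c x : ℝ) : HasDerivAt (fun x => sin (c * x)) (c * cos (c * x)) x := by
  simpa [mul_comm] using ((hasDerivAt_id x).const_mul c).sin

theorem hasDerivAt_cos_mul (c x : ℝ) :
    HasDerivAt (fun x => cos (c * x)) (-(c * sin (c * x))) x := by
  simpa [mul_comm] using ((hasDerivAt_id x).const_mul c).cos

/-- The integral identity for a separated solution. -/
theorem weak_identity_sin {T : ℝ} (hT : 0 ≤ T) {k : ℕ} {y y' z : ℝ → ℝ} (hz : Continuous z)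
    (hy : ∀ t, HasDerivAt y (y' t) t) (hy' : ∀ t, HasDerivAt y' (z t - k ^ 2 * y t) t)
    {η : ℝ → ℝ → ℝ} (hη : ContDiff ℝ ∞ fun z : ℝ × ℝ => η z.1 z.2)
    (h0 : ∀ t ∈ Icc 0 T, η 0 t = 0) (hπ : ∀ t ∈ Icc 0 T, η π t = 0)
    (hηT : ∀ x ∈ Icc 0 π, η x T = 0) :
    ∫ t in (0 : ℝ)..T, ∫ x in (0 : ℝ)..π, (y t * (k * cos (k * x)) * deriv (fun y => η y t) x -
        y' t * sin (k * x) * deriv (fun s => η x s) t) =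
      (∫ x in (0 : ℝ)..π, sin (k * x) * y' 0 * η x 0) +
        ∫ t in (0 : ℝ)..T, ∫ x in (0 : ℝ)..π, sin (k * x) * z t * η x t := by
  have cx := continuous_partial_fst hη
  have ct := continuous_partial_snd hη
  have cη := hη.continuous
  have cy : Continuous y := continuous_iff_continuousAt.2 fun t => (hy t).continuousAt
  have cy' : Continuous y' := continuous_iff_continuousAt.2 fun t => (hy' t).continuousAt
  have cx1 : ∀ t, Continuous fun x => deriv (fun y => η y t) x := fun t =>
    cx.comp (by fun_prop : Continuous fun x : ℝ => (x, t))
  have ct1 : ∀ t, Continuous fun x => deriv (fun s => η x s) t := fun t =>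
    ct.comp (by fun_prop : Continuous fun x : ℝ => (x, t))
  have ct2 : ∀ x, Continuous fun t => deriv (fun s => η x s) t := fun x =>
    ct.comp (by fun_prop : Continuous fun t : ℝ => (x, t))
  have cη1 : ∀ t, Continuous fun x => η x t := fun t =>
    cη.comp (by fun_prop : Continuous fun x : ℝ => (x, t))
  have cη2 : ∀ x, Continuous fun t => η x t := fun x =>
    cη.comp (by fun_prop : Continuous fun t : ℝ => (x, t))
  -- integration by parts in `x`
  have I1 : ∀ t ∈ uIcc 0 T, ∫ x in (0 : ℝ)..π, (y t * (k * cos (k * x)) * deriv (fun y => η y t) x -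
        y' t * sin (k * x) * deriv (fun s => η x s) t) =
      ∫ x in (0 : ℝ)..π, (y t * k ^ 2 * sin (k * x) * η x t -
        y' t * sin (k * x) * deriv (fun s => η x s) t) := by
    intro t ht
    rw [uIcc_of_le hT] at ht
    have e := intervalIntegral.integral_mul_deriv_eq_deriv_mul (a := 0) (b := π)
      (u := fun x => y t * (k * cos (k * x))) (u' := fun x => y t * (k * -(k * sin (k * x))))
      (v := fun x => η x t) (v' := fun x => deriv (fun y => η y t) x)
      (fun x _ => ((hasDerivAt_cos_mul k x).const_mul _).const_mul _)
      (fun x _ => (hasDerivAt_partial_fst hη x t).differentiableAt.hasDerivAt)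
      (Continuous.intervalIntegrable (by fun_prop) _ _) ((cx1 t).intervalIntegrable _ _)
    rw [h0 t ht, hπ t ht] at e
    have := cx1 t
    have := ct1 t
    have := cη1 t
    rw [intervalIntegral.integral_sub (Continuous.intervalIntegrable (by fun_prop) _ _)
      (Continuous.intervalIntegrable (by fun_prop) _ _), e,
      intervalIntegral.integral_sub (Continuous.intervalIntegrable (by fun_prop) _ _)
      (Continuous.intervalIntegrable (by fun_prop) _ _)]
    have : ∀ x, y t * (k * -(k * sin (k * x))) * η x t =
      -(y t * k ^ 2 * sin (k * x) * η x t) := by intro x; ring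
    simp only [this, intervalIntegral.integral_neg]
    ring
  rw [intervalIntegral.integral_congr I1]
  -- integration by parts in `t`
  have I2 : ∀ x ∈ uIcc 0 π, ∫ t in (0 : ℝ)..T, (y t * k ^ 2 * sin (k * x) * η x t -
        y' t * sin (k * x) * deriv (fun s => η x s) t) =
      sin (k * x) * y' 0 * η x 0 + ∫ t in (0 : ℝ)..T, sin (k * x) * z t * η x t := by
    intro x hx
    rw [uIcc_of_le pi_pos.le] at hx
    have e := intervalIntegral.integral_mul_deriv_eq_deriv_mul (a := 0) (b := T)
      (u := fun t => y' t * sin (k * x)) (u' := fun t => (z t - k ^ 2 * y t) * sin (k * x))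
      (v := fun t => η x t) (v' := fun t => deriv (fun s => η x s) t)
      (fun t _ => (hy' t).mul_const _)
      (fun t _ => (hasDerivAt_partial_snd hη x t).differentiableAt.hasDerivAt)
      (Continuous.intervalIntegrable (by fun_prop) _ _) ((ct2 x).intervalIntegrable _ _)
    rw [hηT x hx] at e
    have := ct2 x
    have := cη2 x
    rw [intervalIntegral.integral_sub (Continuous.intervalIntegrable (by fun_prop) _ _)
      (Continuous.intervalIntegrable (by fun_prop) _ _), e]
    have : ∀ t, sin (k * x) * z t * η x t =
      (y t * k ^ 2 * sin (k * x) * η x t) + (z t - k ^ 2 * y t) * sin (k * x) * η x t := by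
      intro t; ring
    simp only [this]
    rw [intervalIntegral.integral_add (Continuous.intervalIntegrable (by fun_prop) _ _)
      (Continuous.intervalIntegrable (by fun_prop) _ _)]
    ring
  have cη' : Continuous fun p : ℝ × ℝ => η p.2 p.1 :=
    cη.comp (by fun_prop : Continuous fun p : ℝ × ℝ => (p.2, p.1))
  have ct' : Continuous fun p : ℝ × ℝ => deriv (fun s => η p.2 s) p.1 :=
    ct.comp (by fun_prop : Continuous fun p : ℝ × ℝ => (p.2, p.1))
  -- Integration by parts in t needs the t integral inside; the order is exchanged for that and
  -- restored for the source term.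
  rw [interval_swap_of_continuous (by fun_prop), intervalIntegral.integral_congr I2,
    intervalIntegral.integral_add, interval_swap_of_continuous (by fun_prop)]
  · have := cη1 0
    exact Continuous.intervalIntegrable (by fun_prop) _ _
  · refine Continuous.intervalIntegrable ?_ _ _
    exact intervalIntegral.continuous_parametric_intervalIntegral_of_continuous'
      (f := fun x t => sin (k * x) * z t * η x t)
      (by unfold Function.uncurry; fun_prop) _ _

/-- Separation of variables for the wave equation. -/
theorem isWeakSolution_sin {T : ℝ} (hT : 0 ≤ T) {k : ℕ} {d : WaveData} {y y' z : ℝ → ℝ}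
    (hz : Continuous z) (hy : ∀ t, HasDerivAt y (y' t) t)
    (hy' : ∀ t, HasDerivAt y' (z t - k ^ 2 * y t) t)
    (h0 : d.u0 = fun x => sin (k * x) * y 0) (h1 : d.u1 = fun x => sin (k * x) * y' 0)
    (hf : d.f = fun x t => sin (k * x) * z t) :
    IsWeakSolution T d fun x t => sin (k * x) * y t := by
  have cS : Continuous fun x : ℝ => sin (k * x) := by fun_prop
  have cC : Continuous fun x : ℝ => k * cos (k * x) := by fun_prop
  have cy : Continuous y := continuous_iff_continuousAt.2 fun t => (hy t).continuousAt
  have cy' : Continuous y' := continuous_iff_continuousAt.2 fun t => (hy' t).continuousAt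
  set S : L2I := (memLp_of_continuous cS).toLp with hS
  set C : L2I := (memLp_of_continuous cC).toLp with hC
  have eS : ∀ c : ℝ, (c • S : L2I) =ᵐ[volume.restrict (Ioo 0 π)] fun x => c * sin (k * x) := by
    intro c
    filter_upwards [Lp.coeFn_smul c S, (memLp_of_continuous cS (a := 0) (b := π)).coeFn_toLp]
      with x h1 h2
    rw [h1, Pi.smul_apply, h2, smul_eq_mul]
  have eC : ∀ c : ℝ, (c • C : L2I) =ᵐ[volume.restrict (Ioo 0 π)]
      fun x => c * (k * cos (k * x)) := by
    intro c
    filter_upwards [Lp.coeFn_smul c C, (memLp_of_continuous cC (a := 0) (b := π)).coeFn_toLp]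
      with x h1 h2
    rw [h1, Pi.smul_apply, h2, smul_eq_mul]
  -- In L² the solution, its x derivative and its t derivative are scalar functions of t times the
  -- fixed vectors `S` and `C`, so continuity and differentiability in t are those of y and y'.
  refine ⟨fun t => y t • S, fun t => y t • C, fun t => y' t • S, ?_, ?_, ?_, ?_, ?_, ?_, ?_, ?_⟩
  · exact (cy.smul continuous_const).continuousOn
  · intro t _ x hx
    rw [integral_congr_of_ae_Ioo (eC (y t)) hx, intervalIntegral.integral_const_mul,
      intervalIntegral.integral_eq_sub_of_hasDerivAt (fun x _ => hasDerivAt_sin_mul k x)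
        (cC.intervalIntegrable _ _)]
    simp [mul_comm]
  · intro t _; simp only [sin_nat_mul_pi, zero_mul]
  · intro t _
    filter_upwards [eS (y t)] with x hx
    rw [hx, mul_comm]
  · intro t _
    exact ((hy t).smul_const S).hasDerivWithinAt
  · exact (cy'.smul continuous_const).continuousOn
  · intro x _; rw [h0]
  · intro η hη a1 a2 a3
    rw [h1, hf]
    rw [← weak_identity_sin hT hz hy hy' hη a1 a2 a3]
    refine intervalIntegral.integral_congr fun t _ => ?_
    refine integral_congr_of_ae_Ioo ?_ ⟨pi_pos.le, le_rfl⟩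
    filter_upwards [eS (y' t), eC (y t)] with x e1 e2
    rw [e1, e2]

/-! ### Uniqueness of weak solutions -/

/-- Completeness of the sine system on `[0,π]`. -/
theorem eqOn_zero_of_sine_coeff_eq_zero {w : ℝ → ℝ} (hw : ContinuousOn w (Icc 0 π))
    (h0 : w 0 = 0) (hπ : w π = 0)
    (hc : ∀ n : ℕ, 1 ≤ n → ∫ x in (0 : ℝ)..π, sin (n * x) * w x = 0) :
    ∀ x ∈ Icc 0 π, w x = 0 := by
  have : Fact (0 < 2 * π) := ⟨by positivity⟩
  set W : ℝ → ℝ := IccExtend pi_pos.le (domRestrict (Icc 0 π) w) with hWdef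
  have hWc : Continuous W := (continuousOn_iff_continuous_domRestrict.1 hw).Icc_extend'
  have hWin : ∀ x ∈ Icc 0 π, W x = w x := fun x hx => by
    rw [hWdef, IccExtend_of_mem _ _ hx]; rfl
  have hWneg : ∀ x ≤ 0, W x = 0 := fun x hx => by
    rw [hWdef, IccExtend_of_le_left _ _ hx]; exact h0
  set g : ℝ → ℂ := fun x => ((W x - W (-x) : ℝ) : ℂ) with hg
  have hgc : Continuous g := by fun_prop
  have hsin : ∀ n : ℤ, ∫ x in (-π)..π, sin (n * x) * W x = 0 := by
    have key : ∀ n : ℕ, ∫ x in (-π)..π, sin (n * x) * W x = 0 := by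
      intro n
      rcases Nat.eq_zero_or_pos n with rfl | hn
      · simp
      rw [← intervalIntegral.integral_add_adjacent_intervals (b := 0)
        (Continuous.intervalIntegrable (by fun_prop) _ _)
        (Continuous.intervalIntegrable (by fun_prop) _ _)]
      have a1 : ∫ x in (-π)..0, sin (n * x) * W x = ∫ x in (-π)..0, (0 : ℝ) :=
        intervalIntegral.integral_congr fun x hx => by
          rw [uIcc_of_le (by linarith [pi_pos])] at hx
          simp only [hWneg x hx.2, mul_zero]
      have a2 : ∫ x in (0 : ℝ)..π, sin (n * x) * W x = ∫ x in (0 : ℝ)..π, sin (n * x) * w x :=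
        intervalIntegral.integral_congr fun x hx => by
          rw [uIcc_of_le pi_pos.le] at hx
          simp only [hWin x hx]
      rw [a1, a2, hc n hn]; simp
    intro n
    rcases Int.eq_nat_or_neg n with ⟨m, rfl | rfl⟩
    · simpa using key m
    · have := key m
      simp only [Int.cast_neg, Int.cast_natCast, neg_mul, sin_neg, intervalIntegral.integral_neg,
        this, neg_zero]
  have hgend : g (-π) = g (-π + 2 * π) := by
    have e : -π + 2 * π = π := by ring
    rw [e]
    simp only [hg, neg_neg, hWin π ⟨pi_pos.le, le_rfl⟩, hπ, hWneg (-π) (by linarith [pi_pos])]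
  set f : C(AddCircle (2 * π), ℂ) :=
    ⟨AddCircle.liftIco (2 * π) (-π) g, AddCircle.liftIco_continuous hgend hgc.continuousOn⟩ with hf
  have hcoef : ∀ n : ℤ, fourierCoeff f n = 0 := by
    intro n
    have e1 : fourierCoeff f n = fourierCoeffOn (lt_add_of_pos_right (-π) two_pi_pos) g n :=
      fourierCoeff_liftIco_eq g n
    rw [e1, fourierCoeffOn_eq_integral]
    have e : -π + 2 * π = π := by ring
    have e2 : ∀ x : ℝ, (fourier (-n) : AddCircle (-π + 2 * π - -π) → ℂ) (x : AddCircle _) =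
        ((cos (n * x) : ℝ) : ℂ) - ((sin (n * x) : ℝ) : ℂ) * Complex.I := by
      intro x
      rw [fourier_coe_apply]
      have : 2 * (π : ℂ) * Complex.I * ((-n : ℤ) : ℂ) * x / ((-π + 2 * π - -π : ℝ) : ℂ) =
          ((-(n * x) : ℝ) : ℂ) * Complex.I := by
        have hp : (π : ℂ) ≠ 0 := by exact_mod_cast pi_ne_zero
        have : ((-π + 2 * π - -π : ℝ) : ℂ) = 2 * π := by push_cast; ring
        rw [this]; push_cast; field_simp
      rw [this, Complex.exp_mul_I, ← Complex.ofReal_cos, ← Complex.ofReal_sin, cos_neg, sin_neg]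
      push_cast; ring
    have e3 : ∫ x in (-π)..(-π + 2 * π),
        (fourier (-n) : AddCircle (-π + 2 * π - -π) → ℂ) (x : AddCircle _) • g x = 0 := by
      simp only [e2, e, hg, smul_eq_mul]
      have e4 : ∀ x : ℝ, (((cos (n * x) : ℝ) : ℂ) - ((sin (n * x) : ℝ) : ℂ) * Complex.I) *
          ((W x - W (-x) : ℝ) : ℂ) = ((cos (n * x) * W x - cos (n * -x) * W (-x) : ℝ) : ℂ) -
          ((sin (n * x) * W x + sin (n * -x) * W (-x) : ℝ) : ℂ) * Complex.I := by
        intro x; rw [mul_neg, cos_neg, sin_neg]; push_cast; ring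
      simp only [e4]
      rw [intervalIntegral.integral_sub (Continuous.intervalIntegrable (by fun_prop) _ _)
        (Continuous.intervalIntegrable (by fun_prop) _ _), intervalIntegral.integral_mul_const,
        intervalIntegral.integral_ofReal, intervalIntegral.integral_ofReal,
        intervalIntegral.integral_sub (Continuous.intervalIntegrable (by fun_prop) _ _)
        (Continuous.intervalIntegrable (by fun_prop) _ _),
        intervalIntegral.integral_add (Continuous.intervalIntegrable (by fun_prop) _ _)
        (Continuous.intervalIntegrable (by fun_prop) _ _),
        intervalIntegral.integral_comp_neg (fun x => cos (n * x) * W x),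
        intervalIntegral.integral_comp_neg (fun x => sin (n * x) * W x), neg_neg, hsin n]
      simp
    rw [e3, smul_zero]
  -- Zero coefficients are trivially summable, so the Fourier series converges to f itself.
  have hfz : f = 0 := by
    have hs : Summable (fourierCoeff f) := by
      rw [funext hcoef]; exact summable_zero
    have := hasSum_fourier_series_of_summable hs
    simp only [hcoef, zero_smul] at this
    exact this.unique hasSum_zero
  intro x hx
  rcases hx.2.eq_or_lt with rfl | hlt
  · exact hπ
  have e1 : f (x : AddCircle (2 * π)) = g x := by
    have : x ∈ Ico (-π) (-π + 2 * π) := ⟨by linarith [hx.1, pi_pos], by linarith⟩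
    exact AddCircle.liftIco_coe_apply (f := g) this
  rw [hfz] at e1
  have e2 : g x = (w x : ℂ) := by
    simp only [hg, hWin x hx, hWneg (-x) (by linarith [hx.1]), sub_zero]
  rw [e2] at e1
  change (0 : ℂ) = _ at e1
  exact_mod_cast e1.symm

theorem inner_toLp_eq_integral {g : ℝ → ℝ} (hg : Continuous g) (f : L2I) :
    IntervalIntegrable (fun x => f x * g x) volume 0 π ∧
    inner ℝ ((memLp_of_continuous hg).toLp : L2I) f = ∫ x in (0 : ℝ)..π, f x * g x := by
  have e : (fun x => inner ℝ (((memLp_of_continuous hg).toLp : L2I) x) (f x))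
      =ᵐ[volume.restrict (Ioo 0 π)] fun x => f x * g x := by
    filter_upwards [(memLp_of_continuous hg (a := 0) (b := π)).coeFn_toLp] with x hx
    rw [hx]; simp
  constructor
  · rw [intervalIntegrable_iff_integrableOn_Ioo_of_le pi_pos.le]
    exact (integrable_congr e).1 (L2.integrable_inner _ _)
  · rw [L2.inner_def, integral_congr_ae e, intervalIntegral.integral_of_le pi_pos.le,
      integral_Ioc_eq_integral_Ioo]

theorem intervalIntegrable_coe_L2I (f : L2I) : IntervalIntegrable (fun x => f x) volume 0 π := by
  simpa using (inner_toLp_eq_integral (g := fun _ => 1) continuous_const f).1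

theorem exists_smooth_primitive {g : ℝ → ℝ} (hg : ContDiff ℝ ∞ g) (T : ℝ) :
    ContDiff ℝ ∞ (fun t => ∫ s in T..t, g s) ∧
      ∀ t, HasDerivAt (fun t => ∫ s in T..t, g s) (g t) t := by
  have hd : ∀ t, HasDerivAt (fun t => ∫ s in T..t, g s) (g t) t := fun t =>
    intervalIntegral.integral_hasDerivAt_right (hg.continuous.intervalIntegrable _ _)
      (hg.continuous.stronglyMeasurableAtFilter _ _) hg.continuous.continuousAt
  refine ⟨contDiff_infty_iff_deriv.2 ⟨fun t => (hd t).differentiableAt, ?_⟩, hd⟩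
  rwa [funext fun t => (hd t).deriv]

/-- The backward Cauchy problem for `φ'' + c² φ = g`. -/
theorem exists_oscillator_solution {c : ℝ} (hc : c ≠ 0) (T : ℝ) {g : ℝ → ℝ}
    (hg : ContDiff ℝ ∞ g) :
    ∃ φ φ' : ℝ → ℝ, ContDiff ℝ ∞ φ ∧ (∀ t, HasDerivAt φ (φ' t) t) ∧
      (∀ t, HasDerivAt φ' (g t - c ^ 2 * φ t) t) ∧ φ T = 0 ∧ φ' T = 0 := by
  have cc : ContDiff ℝ ∞ fun t => cos (c * t) := by fun_prop
  have cs : ContDiff ℝ ∞ fun t => sin (c * t) := by fun_prop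
  obtain ⟨hP, hP'⟩ := exists_smooth_primitive (cc.mul hg) T
  obtain ⟨hQ, hQ'⟩ := exists_smooth_primitive (cs.mul hg) T
  set P := fun t => ∫ s in T..t, cos (c * s) * g s with hPd
  set Q := fun t => ∫ s in T..t, sin (c * s) * g s with hQd
  -- Variation of parameters: this is c⁻¹ ∫ sin(c(t - s)) g(s) ds from T to t. Splitting the kernel
  -- by the addition formula leaves primitives with a fixed integrand.
  refine ⟨fun t => (sin (c * t) * P t - cos (c * t) * Q t) / c,
    fun t => cos (c * t) * P t + sin (c * t) * Q t, ?_, ?_, ?_, ?_, ?_⟩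
  · exact ((cs.mul hP).sub (cc.mul hQ)).div_const c
  · intro t
    have := ((((hasDerivAt_sin_mul c t).mul (hP' t)).sub
      ((hasDerivAt_cos_mul c t).mul (hQ' t))).div_const c)
    convert! this using 1
    field_simp; ring
  · intro t
    have := (((hasDerivAt_cos_mul c t).mul (hP' t)).add
      ((hasDerivAt_sin_mul c t).mul (hQ' t)))
    convert! this using 1
    have := sin_sq_add_cos_sq (c * t)
    field_simp
    linear_combination -g t * this
  · simp [hPd, hQd]
  · simp [hPd, hQd]

/-- Fundamental lemma of the calculus of variations on the open interval, followed by continuity up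
to the ends. -/
theorem eqOn_zero_of_integral_smooth_mul_eq_zero {T : ℝ} (hT : 0 < T) {D : ℝ → ℝ}
    (hD : ContinuousOn D (Icc 0 T))
    (h : ∀ g : ℝ → ℝ, ContDiff ℝ ∞ g → ∫ t in (0 : ℝ)..T, g t * D t = 0) :
    ∀ t ∈ Icc 0 T, D t = 0 := by
  have hae : ∀ᵐ x ∂volume, x ∈ Ioo 0 T → D x = 0 := by
    refine isOpen_Ioo.ae_eq_zero_of_integral_contDiff_smul_eq_zero
      ((hD.mono Ioo_subset_Icc_self).locallyIntegrableOn measurableSet_Ioo) ?_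
    intro g hg _ hs
    have e := h g hg
    rw [intervalIntegral.integral_of_le hT.le, integral_Ioc_eq_integral_Ioo,
      setIntegral_eq_integral_of_forall_compl_eq_zero] at e
    · exact e
    · intro x hx
      rw [image_eq_zero_of_notMem_tsupport (fun hx' => hx (hs hx')), zero_mul]
  have hae' : D =ᵐ[volume.restrict (Icc 0 T)] fun _ => 0 := by
    rw [← restrict_Ioo_eq_restrict_Icc]
    exact (ae_restrict_iff' measurableSet_Ioo).2 hae
  exact Measure.eqOn_Icc_of_ae_eq volume hT.ne hae' hD continuousOn_const

/-- The sine coefficients of a weak solution satisfy the oscillator equation in the weak sense. -/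
theorem IsWeakSolution.sine_coeff {T : ℝ} (hT : 0 < T) {d : WaveData} {u : ℝ → ℝ → ℝ}
    (hu : IsWeakSolution T d u) (n : ℕ) :
    ContinuousOn (fun t => ∫ x in (0 : ℝ)..π, sin (n * x) * u x t) (Icc 0 T) ∧
    ∀ φ φ' φ'' : ℝ → ℝ, ContDiff ℝ ∞ φ → (∀ t, HasDerivAt φ (φ' t) t) →
      (∀ t, HasDerivAt φ' (φ'' t) t) → Continuous φ'' → φ T = 0 → φ' T = 0 →
      ∫ t in (0 : ℝ)..T, (n ^ 2 * φ t + φ'' t) * ∫ x in (0 : ℝ)..π, sin (n * x) * u x t =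
        (∫ x in (0 : ℝ)..π, d.u1 x * (sin (n * x) * φ 0)) +
          (∫ t in (0 : ℝ)..T, ∫ x in (0 : ℝ)..π, d.f x t * (sin (n * x) * φ t)) -
          φ' 0 * ∫ x in (0 : ℝ)..π, sin (n * x) * d.u0 x := by
  obtain ⟨U, ux, ut, cux, hux, huπ, hU, hUt, cut, hu0, hid⟩ := hu
  have cS : Continuous fun x : ℝ => sin (n * x) := by fun_prop
  have cC : Continuous fun x : ℝ => cos (n * x) := by fun_prop
  set S : L2I := (memLp_of_continuous cS).toLp with hS
  set C : L2I := (memLp_of_continuous cC).toLp with hC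
  set b : ℝ → ℝ := fun t => ∫ x in (0 : ℝ)..π, sin (n * x) * u x t with hb
  have hbS : ∀ t ∈ Icc 0 T, b t = inner ℝ S (U t) := by
    intro t ht
    rw [(inner_toLp_eq_integral cS (U t)).2]
    refine integral_congr_of_ae_Ioo ?_ ⟨pi_pos.le, le_rfl⟩
    filter_upwards [hU t ht] with x hx
    rw [hx, mul_comm]
  have hbd : ∀ t ∈ Icc 0 T, HasDerivWithinAt b (inner ℝ S (ut t)) (Icc 0 T) t := by
    intro t ht
    have := (innerSL ℝ S).hasFDerivAt.comp_hasDerivWithinAt t (hUt t ht)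
    exact HasDerivWithinAt.congr this (fun s hs => hbS s hs) (hbS t ht)
  have cb : ContinuousOn b (Icc 0 T) := fun t ht => (hbd t ht).continuousWithinAt
  have cb' : ContinuousOn (fun t => inner ℝ S (ut t)) (Icc 0 T) := continuousOn_const.inner cut
  -- Integration by parts in x, in its absolutely continuous form: u(·,t) is only the primitive of
  -- an L² function. The boundary terms vanish as u is zero at both ends.
  have hCb : ∀ t ∈ Icc 0 T, inner ℝ C (ux t) = n * b t := by
    intro t ht
    rw [(inner_toLp_eq_integral cC (ux t)).2]
    have hi := intervalIntegrable_coe_L2I (ux t)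
    have ac := hi.absolutelyContinuousOnInterval_intervalIntegral (c := 0) (by simp)
    have acC : AbsolutelyContinuousOnInterval (fun x => cos (n * x)) 0 π :=
      ContDiffOn.absolutelyContinuousOnInterval
        (by fun_prop : ContDiff ℝ 1 fun x : ℝ => cos (n * x)).contDiffOn
    have e := acC.integral_mul_deriv_eq_deriv_mul ac
    have hzero : ∫ v in (0 : ℝ)..π, ux t v = 0 := by
      rw [← hux t ht π ⟨pi_pos.le, le_rfl⟩, huπ t ht]
    rw [hzero, intervalIntegral.integral_same, mul_zero, mul_zero, sub_zero, zero_sub] at e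
    have e1 : ∫ x in (0 : ℝ)..π, cos (n * x) * deriv (fun x => ∫ v in (0 : ℝ)..x, ux t v) x =
        ∫ x in (0 : ℝ)..π, ux t x * cos (n * x) := by
      refine intervalIntegral.integral_congr_ae ?_
      filter_upwards [hi.ae_hasDerivAt_integral] with x hx hx'
      rw [(hx (uIoc_subset_uIcc hx') 0 (by simp)).deriv, mul_comm]
    rw [← e1, e, hb, ← intervalIntegral.integral_neg, ← intervalIntegral.integral_const_mul]
    refine intervalIntegral.integral_congr fun x hx => ?_
    rw [uIcc_of_le pi_pos.le] at hx
    simp only [(hasDerivAt_cos_mul (n : ℝ) x).deriv]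
    rw [← hux t ht x hx]; ring
  refine ⟨cb, fun φ φ' φ'' hφ hφ1 hφ2 hφc hφT hφT' => ?_⟩
  have cφ : Continuous φ := hφ.continuous
  have cφ' : Continuous φ' := continuous_iff_continuousAt.2 fun t => (hφ2 t).continuousAt
  -- Admissible because φ(T) = 0. The condition φ'(T) = 0 is used later, where the term φ' b' is
  -- integrated by parts in t.
  have key := hid (fun x t => sin (n * x) * φ t) (by fun_prop) (by simp) (by simp)
    (by simp [hφT])
  have e1 : ∀ t ∈ uIcc 0 T, ∫ x in (0 : ℝ)..π,
      (ux t x * deriv (fun y => sin (n * y) * φ t) x -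
        ut t x * deriv (fun s => sin (n * x) * φ s) t) =
      n ^ 2 * φ t * b t - φ' t * inner ℝ S (ut t) := by
    intro t ht
    rw [uIcc_of_le hT.le] at ht
    obtain ⟨i1, j1⟩ := inner_toLp_eq_integral cC (ux t)
    obtain ⟨i2, j2⟩ := inner_toLp_eq_integral cS (ut t)
    have e : ∀ x, (ux t x * deriv (fun y => sin (n * y) * φ t) x -
        ut t x * deriv (fun s => sin (n * x) * φ s) t) =
        (n * φ t) * (ux t x * cos (n * x)) - φ' t * (ut t x * sin (n * x)) := by
      intro x
      rw [((hasDerivAt_sin_mul (n : ℝ) x).mul_const (φ t)).deriv,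
        ((hφ1 t).const_mul (sin (n * x))).deriv]
      ring
    simp only [e]
    rw [intervalIntegral.integral_sub (i1.const_mul _) (i2.const_mul _),
      intervalIntegral.integral_const_mul, intervalIntegral.integral_const_mul, ← j1, ← j2,
      hCb t ht]
    ring
  rw [intervalIntegral.integral_congr e1] at key
  have cb1 : ContinuousOn b (uIcc 0 T) := by rwa [uIcc_of_le hT.le]
  have cb2 : ContinuousOn (fun t => inner ℝ S (ut t)) (uIcc 0 T) := by rwa [uIcc_of_le hT.le]
  have e2 := intervalIntegral.integral_mul_deriv_eq_deriv_mul_of_hasDerivWithinAt (a := 0) (b := T)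
    (u := φ') (u' := φ'') (v := b) (v' := fun t => inner ℝ S (ut t))
    (fun t _ => (hφ2 t).hasDerivWithinAt)
    (fun t ht => by rw [uIcc_of_le hT.le] at ht ⊢; exact hbd t ht)
    (hφc.intervalIntegrable _ _) cb2.intervalIntegrable
  have hb0 : b 0 = ∫ x in (0 : ℝ)..π, sin (n * x) * d.u0 x := by
    refine intervalIntegral.integral_congr fun x hx => ?_
    rw [uIcc_of_le pi_pos.le] at hx
    simp only [hu0 x hx]
  rw [hφT', hb0] at e2
  have i1 : IntervalIntegrable (fun t => n ^ 2 * φ t * b t) volume 0 T :=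
    (ContinuousOn.mul (by fun_prop) cb1).intervalIntegrable
  have i2 : IntervalIntegrable (fun t => φ'' t * b t) volume 0 T :=
    (ContinuousOn.mul (by fun_prop) cb1).intervalIntegrable
  have i3 : IntervalIntegrable (fun t => φ' t * inner ℝ S (ut t)) volume 0 T :=
    (cφ'.continuousOn.mul cb2).intervalIntegrable
  rw [intervalIntegral.integral_sub i1 i3, e2] at key
  rw [← key]
  simp only [add_mul]
  rw [intervalIntegral.integral_add i1 i2]
  ring

theorem IsWeakSolution.continuousOn {T : ℝ} {d : WaveData} {u : ℝ → ℝ → ℝ}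
    (hu : IsWeakSolution T d u) {t : ℝ} (ht : t ∈ Icc 0 T) :
    ContinuousOn (fun x => u x t) (Icc 0 π) ∧ u 0 t = 0 ∧ u π t = 0 := by
  obtain ⟨U, ux, ut, -, hux, huπ, -⟩ := hu
  refine ⟨?_, ?_, huπ t ht⟩
  · have := intervalIntegral.continuousOn_primitive_interval'
      (intervalIntegrable_coe_L2I (ux t)) (a := 0) (by simp)
    rw [uIcc_of_le pi_pos.le] at this
    exact this.congr fun x hx => hux t ht x hx
  · rw [hux t ht 0 ⟨le_rfl, pi_pos.le⟩, intervalIntegral.integral_same]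

/-- Duality: choosing φ as the backward oscillator with an arbitrary smooth right-hand side g makes
∫ g bₙ depend on the data alone, bₙ being the n-th sine coefficient. Hence all sine coefficients of
the two solutions agree, and completeness finishes. -/
theorem IsWeakSolution.unique {T : ℝ} (hT : 0 < T) {d : WaveData} {u v : ℝ → ℝ → ℝ}
    (hu : IsWeakSolution T d u) (hv : IsWeakSolution T d v) :
    ∀ x ∈ Icc 0 π, ∀ t ∈ Icc 0 T, u x t = v x t := by
  intro x hx t ht
  obtain ⟨cu, u0, uπ⟩ := hu.continuousOn ht
  obtain ⟨cv, v0, vπ⟩ := hv.continuousOn ht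
  rw [← sub_eq_zero]
  refine eqOn_zero_of_sine_coeff_eq_zero (w := fun x => u x t - v x t) (cu.sub cv)
    (by simp [u0, v0]) (by simp [uπ, vπ]) (fun n hn => ?_) x hx
  obtain ⟨cbu, hbu⟩ := hu.sine_coeff hT n
  obtain ⟨cbv, hbv⟩ := hv.sine_coeff hT n
  have e := eqOn_zero_of_integral_smooth_mul_eq_zero hT (cbu.sub cbv) (fun g hg => ?_) t ht
  · have ci : ∀ w : ℝ → ℝ → ℝ, ContinuousOn (fun x => w x t) (Icc 0 π) →
        IntervalIntegrable (fun x => sin (n * x) * w x t) volume 0 π := fun w hw => by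
      refine ContinuousOn.intervalIntegrable ?_
      rw [uIcc_of_le pi_pos.le]
      exact ContinuousOn.mul (by fun_prop) hw
    simp only [mul_sub]
    rw [intervalIntegral.integral_sub (ci u cu) (ci v cv)]
    exact e
  · have hn0 : (n : ℝ) ≠ 0 := by positivity
    obtain ⟨φ, φ', h1, h2, h3, h4, h5⟩ := exists_oscillator_solution hn0 T hg
    have c3 : Continuous fun t => g t - n ^ 2 * φ t :=
      hg.continuous.sub (continuous_const.mul h1.continuous)
    have eu := hbu φ φ' _ h1 h2 h3 c3 h4 h5
    have ev := hbv φ φ' _ h1 h2 h3 c3 h4 h5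
    simp only [add_sub_cancel] at eu ev
    simp only [Pi.sub_apply, mul_sub]
    rw [intervalIntegral.integral_sub, eu, ev, sub_self]
    · refine ContinuousOn.intervalIntegrable ?_
      rw [uIcc_of_le hT.le]
      exact hg.continuous.continuousOn.mul cbu
    · refine ContinuousOn.intervalIntegrable ?_
      rw [uIcc_of_le hT.le]
      exact hg.continuous.continuousOn.mul cbv

/-! ### Hölder norms of the harmonics -/

theorem iteratedDeriv_sin_mul (c : ℝ) (p : ℕ) :
    iteratedDeriv p (fun x => sin (c * x)) = fun x => c ^ p * sin (c * x + p * (π / 2)) := by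
  induction p with
  | zero => simp
  | succ p ih =>
    rw [iteratedDeriv_succ, ih]
    funext x
    have h : HasDerivAt (fun x => c ^ p * sin (c * x + p * (π / 2)))
        (c ^ p * (cos (c * x + p * (π / 2)) * c)) x := by
      simpa using ((((hasDerivAt_id x).const_mul c).add_const (p * (π / 2))).sin).const_mul (c ^ p)
    rw [h.deriv]
    push_cast
    rw [add_mul, one_mul, ← add_assoc, sin_add_pi_div_two]
    ring

theorem iteratedDerivWithin_sin_mul (c : ℝ) (p : ℕ) {a b x : ℝ} (hab : a < b)
    (hx : x ∈ Icc a b) :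
    iteratedDerivWithin p (fun x => sin (c * x)) (Icc a b) x =
      c ^ p * sin (c * x + p * (π / 2)) := by
  rw [iteratedDerivWithin_eq_iteratedDeriv (uniqueDiffOn_Icc hab)
    (by fun_prop : ContDiff ℝ p fun x : ℝ => sin (c * x)).contDiffAt hx, iteratedDeriv_sin_mul]

theorem eHolderNorm_le_ofReal {X : Type*} [MetricSpace X] {f : X → ℝ} {α K : ℝ} (hα : 0 ≤ α)
    (hK : 0 ≤ K) (h : ∀ x y, |f x - f y| ≤ K * dist x y ^ α) :
    eHolderNorm α.toNNReal f ≤ ENNReal.ofReal K := by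
  have : HolderWith K.toNNReal α.toNNReal f := by
    intro x y
    rw [edist_dist, edist_dist, Real.coe_toNNReal _ hα,
      ENNReal.ofReal_rpow_of_nonneg dist_nonneg hα, ← ENNReal.ofReal,
      ← ENNReal.ofReal_mul hK]
    exact ENNReal.ofReal_le_ofReal (h x y)
  exact this.eHolderNorm_le

/-- Interpolation between the trivial bound and the Lipschitz bound; applied with y = k·dist it
yields the factor k^α of a Hölder seminorm. -/
theorem le_two_mul_rpow {A y α : ℝ} (hy : 0 ≤ y) (hα : 0 < α) (hα1 : α ≤ 1) (h1 : A ≤ 2)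
    (h2 : A ≤ 2 * y) : A ≤ 2 * y ^ α := by
  rcases le_total y 1 with hy1 | hy1
  · have : y ≤ y ^ α := by
      rcases hy.eq_or_lt with rfl | hpos
      · rw [zero_rpow hα.ne']
      · simpa using rpow_le_rpow_of_exponent_ge hpos hy1 hα1
    linarith
  · have : 1 ≤ y ^ α := one_le_rpow hy1 hα.le
    linarith

theorem abs_sin_sub_sin_le (a b : ℝ) : |sin a - sin b| ≤ |a - b| := by
  rw [sin_sub_sin, abs_mul, abs_mul]
  have h1 : |sin ((a - b) / 2)| ≤ |(a - b) / 2| := abs_sin_le_abs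
  have h2 := abs_cos_le_one ((a + b) / 2)
  rw [abs_div, abs_two] at h1
  rw [abs_two]
  nlinarith [abs_nonneg (sin ((a - b) / 2)), abs_nonneg (cos ((a + b) / 2))]

theorem pow_mul_rpow_le {k : ℝ} (hk : 1 ≤ k) {p : ℕ} {α s : ℝ} (h : p + α ≤ s) :
    k ^ p * k ^ α ≤ k ^ s := by
  rw [← rpow_natCast, ← rpow_add (by linarith)]
  exact rpow_le_rpow_of_exponent_le hk h

theorem pow_le_rpow {k : ℝ} (hk : 1 ≤ k) {p : ℕ} {s : ℝ} (h : (p : ℝ) ≤ s) :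
    k ^ p ≤ k ^ s := by
  simpa using pow_mul_rpow_le hk (p := p) (α := 0) (by simpa using h)

theorem sin_add_nat_mul_pi_eq_zero {x : ℝ} (hx : sin x = 0) (r : ℕ) :
    sin (x + (2 * r : ℕ) * (π / 2)) = 0 := by
  have : ((2 * r : ℕ) : ℝ) * (π / 2) = r * π := by push_cast; ring
  rw [this, sin_add, hx, sin_nat_mul_pi]; simp

/-- Each derivative of order at most [s] costs at most k^s and there are at most 7 of them; the
Hölder seminorm costs 2k^s. The bound s ≤ 6 covers λ ≤ 5 + l. -/
theorem holderNormI_sin_le {k : ℕ} (hk : 1 ≤ k) {s : ℝ} (hs : 0 ≤ s) (hs6 : s ≤ 6) :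
    holderNormI s (fun x => sin (k * x)) ≤ ENNReal.ofReal (9 * (k : ℝ) ^ s) := by
  have hk1 : (1 : ℝ) ≤ k := by exact_mod_cast hk
  set n := ⌊s⌋₊ with hn
  have hns : (n : ℝ) ≤ s := Nat.floor_le hs
  have hsn : s < n + 1 := Nat.lt_floor_add_one s
  have hn6 : n ≤ 6 := Nat.floor_le_of_le (by exact_mod_cast hs6)
  have hks : 0 ≤ (k : ℝ) ^ s := by positivity
  have hsm : SmoothZeroI s fun x => sin (k * x) := by
    refine ⟨(by fun_prop : ContDiff ℝ n fun x : ℝ => sin (k * x)).contDiffOn, fun r _ => ?_⟩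
    rw [iteratedDerivWithin_sin_mul _ _ pi_pos ⟨le_rfl, pi_pos.le⟩,
      iteratedDerivWithin_sin_mul _ _ pi_pos ⟨pi_pos.le, le_rfl⟩,
      sin_add_nat_mul_pi_eq_zero (by simp), sin_add_nat_mul_pi_eq_zero (sin_nat_mul_pi k)]
    simp
  unfold holderNormI
  rw [if_pos hsm]
  have hsum : (∑ p ∈ Finset.range (n + 1), ⨆ x ∈ Icc 0 π,
      ‖iteratedDerivWithin p (fun x => sin (k * x)) (Icc 0 π) x‖ₑ) ≤
      ENNReal.ofReal (7 * (k : ℝ) ^ s) := by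
    calc _ ≤ ∑ p ∈ Finset.range (n + 1), ENNReal.ofReal ((k : ℝ) ^ s) := by
          refine Finset.sum_le_sum fun p hp => iSup₂_le fun x hx => ?_
          rw [iteratedDerivWithin_sin_mul _ _ pi_pos hx, Real.enorm_eq_ofReal_abs]
          refine ENNReal.ofReal_le_ofReal ?_
          rw [abs_mul, abs_of_nonneg (by positivity)]
          have hp' : (p : ℝ) ≤ s :=
            le_trans (by exact_mod_cast Nat.lt_succ_iff.1 (Finset.mem_range.1 hp)) hns
          have := pow_le_rpow hk1 hp'
          have := abs_sin_le_one (k * x + p * (π / 2))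
          have : 0 ≤ (k : ℝ) ^ p := by positivity
          nlinarith
      _ = ENNReal.ofReal ((n + 1) * (k : ℝ) ^ s) := by
          rw [Finset.sum_const, Finset.card_range, nsmul_eq_mul, ENNReal.ofReal_mul (by positivity)]
          congr 1
          rw [show ((n : ℝ) + 1) = ((n + 1 : ℕ) : ℝ) by push_cast; ring, ENNReal.ofReal_natCast]
      _ ≤ _ := by
          refine ENNReal.ofReal_le_ofReal (mul_le_mul_of_nonneg_right ?_ hks)
          have : (n : ℝ) ≤ 6 := by exact_mod_cast hn6
          linarith
  have hhol : (if s = n then 0 else eHolderNorm (s - n).toNNReal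
      fun x : Icc 0 π => iteratedDerivWithin n (fun x => sin (k * x)) (Icc 0 π) x) ≤
      ENNReal.ofReal (2 * (k : ℝ) ^ s) := by
    split_ifs with h
    · exact zero_le
    have hα : 0 < s - n := by
      rcases hns.lt_or_eq with h' | h'
      · linarith
      · exact absurd h'.symm h
    refine eHolderNorm_le_ofReal hα.le (by positivity) fun x y => ?_
    rw [iteratedDerivWithin_sin_mul _ _ pi_pos x.2, iteratedDerivWithin_sin_mul _ _ pi_pos y.2,
      ← mul_sub, abs_mul, abs_of_nonneg (by positivity)]
    have hy : 0 ≤ k * dist x y := by positivity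
    have a1 : |sin (k * (x : ℝ) + n * (π / 2)) - sin (k * (y : ℝ) + n * (π / 2))| ≤
        k * dist x y := by
      refine (abs_sin_sub_sin_le _ _).trans_eq ?_
      rw [Subtype.dist_eq, Real.dist_eq, add_sub_add_right_eq_sub, ← mul_sub, abs_mul,
        abs_of_nonneg (by positivity : (0 : ℝ) ≤ k)]
    have a2 : |sin (k * (x : ℝ) + n * (π / 2)) - sin (k * (y : ℝ) + n * (π / 2))| ≤ 2 := by
      refine (abs_sub _ _).trans ?_
      linarith [abs_sin_le_one (k * (x : ℝ) + n * (π / 2)),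
        abs_sin_le_one (k * (y : ℝ) + n * (π / 2))]
    have a3 := le_two_mul_rpow hy hα (by linarith) a2 (by linarith)
    rw [mul_rpow (by positivity) dist_nonneg] at a3
    have a4 := pow_mul_rpow_le hk1 (p := n) (α := s - n) (s := s) (by linarith)
    have a5 : 0 ≤ dist x y ^ (s - n) := rpow_nonneg dist_nonneg _
    calc _ ≤ (k : ℝ) ^ n * (2 * ((k : ℝ) ^ (s - n) * dist x y ^ (s - n))) := by gcongr
      _ = 2 * ((k : ℝ) ^ n * (k : ℝ) ^ (s - n)) * dist x y ^ (s - n) := by ring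
      _ ≤ _ := by gcongr
  refine (add_le_add hsum hhol).trans_eq ?_
  rw [← ENNReal.ofReal_add (by positivity) (by positivity)]
  congr 1; ring

theorem partialD_sin_mul_sin {T : ℝ} (hT : 0 < T) (a b : ℝ) (p q : ℕ) {x t : ℝ}
    (hx : x ∈ Icc 0 π) (ht : t ∈ Icc 0 T) :
    partialD T p q (fun x t => sin (a * x) * sin (b * t)) x t =
      a ^ p * sin (a * x + p * (π / 2)) * (b ^ q * sin (b * t + q * (π / 2))) := by
  unfold partialD
  have h1 : ∀ y, iteratedDerivWithin q (fun s => sin (a * y) * sin (b * s)) (Icc 0 T) t =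
      (b ^ q * sin (b * t + q * (π / 2))) * sin (a * y) := by
    intro y
    rw [iteratedDerivWithin_const_mul_field, iteratedDerivWithin_sin_mul _ _ hT ht, mul_comm]
  simp only [h1]
  rw [iteratedDerivWithin_const_mul_field, iteratedDerivWithin_sin_mul _ _ pi_pos hx, mul_comm]

theorem abs_sin_mul_sin_sub_le (a b a' b' : ℝ) :
    |sin a * sin b - sin a' * sin b'| ≤ |a - a'| + |b - b'| := by
  have e : sin a * sin b - sin a' * sin b' =
    (sin a - sin a') * sin b + sin a' * (sin b - sin b') := by ring
  rw [e]
  refine (abs_add_le _ _).trans ?_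
  rw [abs_mul, abs_mul]
  have h1 := abs_sin_sub_sin_le a a'
  have h2 := abs_sin_sub_sin_le b b'
  have h3 := abs_sin_le_one b
  have h4 := abs_sin_le_one a'
  nlinarith [abs_nonneg (sin a - sin a'), abs_nonneg (sin b - sin b'), abs_nonneg (sin b),
    abs_nonneg (sin a')]

/-- Here 63 = 49 + 14: at most 7·7 mixed derivatives of size k^s and at most 7 Hölder seminorms of
size 2k^s. -/
theorem holderNormQ_sin_le {T : ℝ} (hT : 0 < T) {k : ℕ} (hk : 2 ≤ k) {s : ℝ} (hs : 0 ≤ s)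
    (hs6 : s ≤ 6) :
    holderNormQ T s (fun x t => sin (k * x) * sin (((k : ℝ) - 1) * t)) ≤
      ENNReal.ofReal (63 * (k : ℝ) ^ s) := by
  have hk2 : (2 : ℝ) ≤ k := by exact_mod_cast hk
  have hk1 : (1 : ℝ) ≤ k := by linarith
  set n := ⌊s⌋₊ with hn
  have hns : (n : ℝ) ≤ s := Nat.floor_le hs
  have hsn : s < n + 1 := Nat.lt_floor_add_one s
  have hn6 : n ≤ 6 := Nat.floor_le_of_le (by exact_mod_cast hs6)
  have hn6' : (n : ℝ) ≤ 6 := by exact_mod_cast hn6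
  have hks : 0 ≤ (k : ℝ) ^ s := by positivity
  have hq : ∀ q : ℕ, ((k : ℝ) - 1) ^ q ≤ (k : ℝ) ^ q := fun q =>
    pow_le_pow_left₀ (by linarith) (by linarith) q
  have hq0 : ∀ q : ℕ, 0 ≤ ((k : ℝ) - 1) ^ q := fun q => pow_nonneg (by linarith) q
  have hpq : ∀ p q : ℕ, p + q ≤ n → (k : ℝ) ^ p * ((k : ℝ) - 1) ^ q ≤ (k : ℝ) ^ (p + q) := by
    intro p q _
    rw [pow_add]
    exact mul_le_mul_of_nonneg_left (hq q) (by positivity)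
  have hsm : SmoothZeroQ T s fun x t => sin (k * x) * sin (((k : ℝ) - 1) * t) := by
    refine ⟨(by fun_prop : ContDiff ℝ n fun z : ℝ × ℝ =>
      sin (k * z.1) * sin (((k : ℝ) - 1) * z.2)).contDiffOn, fun r _ => ⟨fun t ht => ?_,
      fun x hx => ?_⟩⟩
    · rw [partialD_sin_mul_sin hT _ _ _ _ ⟨le_rfl, pi_pos.le⟩ ht,
        partialD_sin_mul_sin hT _ _ _ _ ⟨pi_pos.le, le_rfl⟩ ht,
        sin_add_nat_mul_pi_eq_zero (by simp), sin_add_nat_mul_pi_eq_zero (sin_nat_mul_pi k)]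
      simp
    · rw [partialD_sin_mul_sin hT _ _ _ _ hx ⟨le_rfl, hT.le⟩,
        sin_add_nat_mul_pi_eq_zero (x := ((k : ℝ) - 1) * 0) (by simp)]
      simp
  unfold holderNormQ
  rw [if_pos hsm]
  have hterm : ∀ p q : ℕ, p + q ≤ n → (⨆ x ∈ Icc 0 π, ⨆ t ∈ Icc 0 T,
      ‖partialD T p q (fun x t => sin (k * x) * sin (((k : ℝ) - 1) * t)) x t‖ₑ) ≤
      ENNReal.ofReal ((k : ℝ) ^ s) := by
    intro p q h
    refine iSup₂_le fun x hx => iSup₂_le fun t ht => ?_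
    rw [partialD_sin_mul_sin hT _ _ _ _ hx ht, Real.enorm_eq_ofReal_abs]
    refine ENNReal.ofReal_le_ofReal ?_
    have e1 := pow_le_rpow hk1 (p := p + q) (s := s) (le_trans (by exact_mod_cast h) hns)
    rw [abs_mul, abs_mul, abs_mul, abs_of_nonneg (by positivity : 0 ≤ (k : ℝ) ^ p),
      abs_of_nonneg (hq0 q)]
    calc _ ≤ ((k : ℝ) ^ p * 1) * (((k : ℝ) - 1) ^ q * 1) := by
          have := hq0 q
          gcongr <;> exact abs_sin_le_one _
      _ ≤ _ := by
          rw [mul_one, mul_one]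
          exact (hpq p q h).trans e1
  have hsum : (∑ p ∈ Finset.range (n + 1), ∑ q ∈ Finset.range (n + 1 - p),
      ⨆ x ∈ Icc 0 π, ⨆ t ∈ Icc 0 T,
      ‖partialD T p q (fun x t => sin (k * x) * sin (((k : ℝ) - 1) * t)) x t‖ₑ) ≤
      ENNReal.ofReal (49 * (k : ℝ) ^ s) := by
    calc _ ≤ ∑ p ∈ Finset.range (n + 1), ∑ q ∈ Finset.range (n + 1),
          ENNReal.ofReal ((k : ℝ) ^ s) := by
          refine Finset.sum_le_sum fun p hp => ?_
          refine (Finset.sum_le_sum fun q hq => hterm p q ?_).trans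
            (Finset.sum_le_sum_of_subset (Finset.range_mono (by omega)))
          rw [Finset.mem_range] at hp hq
          omega
      _ = ENNReal.ofReal ((n + 1) * ((n + 1) * (k : ℝ) ^ s)) := by
          simp only [Finset.sum_const, Finset.card_range, nsmul_eq_mul]
          rw [ENNReal.ofReal_mul (by positivity), ENNReal.ofReal_mul (by positivity),
            show ((n : ℝ) + 1) = ((n + 1 : ℕ) : ℝ) by push_cast; ring, ENNReal.ofReal_natCast]
      _ ≤ _ := by
          refine ENNReal.ofReal_le_ofReal ?_
          rw [← mul_assoc]
          refine mul_le_mul_of_nonneg_right ?_ hks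
          have : (0 : ℝ) ≤ n := by positivity
          nlinarith
  have hhol : (if s = n then 0 else ∑ p ∈ Finset.range (n + 1), eHolderNorm (s - n).toNNReal
      fun z : RectQ T => partialD T p (n - p)
        (fun x t => sin (k * x) * sin (((k : ℝ) - 1) * t)) (z.1 0) (z.1 1)) ≤
      ENNReal.ofReal (14 * (k : ℝ) ^ s) := by
    split_ifs with h
    · exact zero_le
    have hα : 0 < s - n := by
      rcases hns.lt_or_eq with h' | h'
      · linarith
      · exact absurd h'.symm h
    calc _ ≤ ∑ p ∈ Finset.range (n + 1), ENNReal.ofReal (2 * (k : ℝ) ^ s) := by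
          refine Finset.sum_le_sum fun p hp => ?_
          refine eHolderNorm_le_ofReal hα.le (by positivity) fun z w => ?_
          rw [partialD_sin_mul_sin hT _ _ _ _ z.2.1 z.2.2,
            partialD_sin_mul_sin hT _ _ _ _ w.2.1 w.2.2]
          set q := n - p with hqdef
          have hpn : p + q = n := by rw [Finset.mem_range] at hp; omega
          have d0 : |z.1 0 - w.1 0| ≤ dist z w := by
            rw [Subtype.dist_eq, ← Real.dist_eq]; exact PiLp.dist_apply_le _ _ 0
          have d1 : |z.1 1 - w.1 1| ≤ dist z w := by
            rw [Subtype.dist_eq, ← Real.dist_eq]; exact PiLp.dist_apply_le _ _ 1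
          have hy : 0 ≤ k * dist z w := by positivity
          set A := |sin (k * z.1 0 + p * (π / 2)) * sin (((k : ℝ) - 1) * z.1 1 + q * (π / 2)) -
            sin (k * w.1 0 + p * (π / 2)) * sin (((k : ℝ) - 1) * w.1 1 + q * (π / 2))| with hA
          have a1 : A ≤ 2 * (k * dist z w) := by
            refine (abs_sin_mul_sin_sub_le _ _ _ _).trans ?_
            rw [add_sub_add_right_eq_sub, add_sub_add_right_eq_sub, ← mul_sub, ← mul_sub,
              abs_mul, abs_mul, abs_of_nonneg (by positivity : (0 : ℝ) ≤ k),
              abs_of_nonneg (by linarith : (0 : ℝ) ≤ (k : ℝ) - 1)]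
            nlinarith [abs_nonneg (z.1 0 - w.1 0), abs_nonneg (z.1 1 - w.1 1)]
          have a2 : A ≤ 2 := by
            refine (abs_sub _ _).trans ?_
            rw [abs_mul, abs_mul]
            have b1 := mul_le_one₀ (abs_sin_le_one (k * z.1 0 + p * (π / 2))) (abs_nonneg _)
              (abs_sin_le_one (((k : ℝ) - 1) * z.1 1 + q * (π / 2)))
            have b2 := mul_le_one₀ (abs_sin_le_one (k * w.1 0 + p * (π / 2))) (abs_nonneg _)
              (abs_sin_le_one (((k : ℝ) - 1) * w.1 1 + q * (π / 2)))
            linarith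
          have a3 := le_two_mul_rpow hy hα (by linarith) a2 a1
          rw [mul_rpow (by positivity) dist_nonneg] at a3
          have a4 := pow_mul_rpow_le hk1 (p := p + q) (α := s - n) (s := s) (by rw [hpn]; linarith)
          have a5 : 0 ≤ dist z w ^ (s - n) := rpow_nonneg dist_nonneg _
          have a6 : 0 ≤ A := abs_nonneg _
          calc _ = ((k : ℝ) ^ p * ((k : ℝ) - 1) ^ q) * A := by
                rw [hA, ← abs_of_nonneg (mul_nonneg (by positivity : 0 ≤ (k : ℝ) ^ p) (hq0 q)),
                  ← abs_mul]
                congr 1; ring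
            _ ≤ (k : ℝ) ^ (p + q) * (2 * ((k : ℝ) ^ (s - n) * dist z w ^ (s - n))) := by
                have := hpq p q hpn.le
                gcongr
            _ = 2 * ((k : ℝ) ^ (p + q) * (k : ℝ) ^ (s - n)) * dist z w ^ (s - n) := by ring
            _ ≤ _ := by gcongr
      _ = ENNReal.ofReal ((n + 1) * (2 * (k : ℝ) ^ s)) := by
          rw [Finset.sum_const, Finset.card_range, nsmul_eq_mul,
            ENNReal.ofReal_mul (by positivity : (0 : ℝ) ≤ n + 1),
            show ((n : ℝ) + 1) = ((n + 1 : ℕ) : ℝ) by push_cast; ring, ENNReal.ofReal_natCast]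
      _ ≤ _ := by
          refine ENNReal.ofReal_le_ofReal ?_
          nlinarith
  refine (add_le_add hsum hhol).trans_eq ?_
  rw [← ENNReal.ofReal_add (by positivity) (by positivity)]
  congr 1; ring

/-! ### Dispersion of the scheme -/

/-- The real part of the exponential remainder at ix. A remainder of order 8 is required because the
dispersion error of the fourth-order scheme first appears at order 6. -/
theorem abs_cos_sub_taylor_le {x : ℝ} (hx : |x| ≤ 1) :
    |cos x - (1 - x ^ 2 / 2 + x ^ 4 / 24 - x ^ 6 / 720)| ≤ x ^ 8 := by
  have hn : ‖(x : ℂ) * Complex.I‖ = |x| := by simp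
  have h := Complex.exp_bound (x := (x : ℂ) * Complex.I) (by rw [hn]; exact hx) (n := 8)
    (by norm_num)
  rw [hn] at h
  have e : Complex.exp ((x : ℂ) * Complex.I) -
      ∑ m ∈ Finset.range 8, ((x : ℂ) * Complex.I) ^ m / m.factorial =
      ((cos x - (1 - x ^ 2 / 2 + x ^ 4 / 24 - x ^ 6 / 720) : ℝ) : ℂ) +
      ((sin x - (x - x ^ 3 / 6 + x ^ 5 / 120 - x ^ 7 / 5040) : ℝ) : ℂ) * Complex.I := by
    have i3 : Complex.I ^ 3 = -Complex.I := Complex.I_pow_three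
    have i4 : Complex.I ^ 4 = 1 := Complex.I_pow_four
    have i5 : Complex.I ^ 5 = Complex.I := by rw [pow_succ, i4, one_mul]
    have i6 : Complex.I ^ 6 = -1 := by rw [pow_succ, i5, Complex.I_mul_I]
    have i7 : Complex.I ^ 7 = -Complex.I := by rw [pow_succ, i6, neg_one_mul]
    rw [Complex.exp_mul_I]
    simp only [Finset.sum_range_succ, Finset.sum_range_zero, mul_pow, Complex.I_sq, i3, i4, i5, i6,
      i7, Nat.factorial]
    push_cast
    ring
  have h2 := (Complex.abs_re_le_norm _).trans h
  rw [e] at h2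
  simp only [Complex.add_re, Complex.ofReal_re, Complex.mul_re, Complex.I_re, mul_zero,
    Complex.ofReal_im, Complex.I_im, zero_mul, sub_zero, add_zero] at h2
  refine h2.trans ?_
  rw [Even.pow_abs (by decide)]
  have : 0 ≤ x ^ 8 := by positivity
  norm_num [Nat.factorial]
  linarith

/-- The leading term of the dispersion error of the compact scheme. -/
theorem abs_dispersion_sub_le {x y s : ℝ} (hx : |x| ≤ 1) (hs0 : 0 ≤ s) (hs1 : s ≤ 1)
    (hy : y ^ 2 = s * x ^ 2) :
    |(1 - cos y) * (1 - (1 - s) * (1 - cos x) / 6) - s * (1 - cos x) -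
      s * (1 - s ^ 2) * x ^ 6 / 480| ≤ 4 * s * x ^ 8 := by
  have hw1 : x ^ 2 ≤ 1 := by rw [← sq_abs]; exact pow_le_one₀ (abs_nonneg x) hx
  have hy1 : |y| ≤ 1 := by
    rw [← sq_le_one_iff₀ (abs_nonneg y), sq_abs, hy]
    exact mul_le_one₀ hs1 (sq_nonneg x) hw1
  set R1 := cos x - (1 - x ^ 2 / 2 + x ^ 4 / 24 - x ^ 6 / 720) with hR1
  set R2 := cos y - (1 - y ^ 2 / 2 + y ^ 4 / 24 - y ^ 6 / 720) with hR2
  have b1 : |R1| ≤ x ^ 8 := abs_cos_sub_taylor_le hx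
  have b2 : |R2| ≤ y ^ 8 := abs_cos_sub_taylor_le hy1
  have ha0 : 0 ≤ 1 - cos x := by linarith [cos_le_one x]
  have ha2 : 1 - cos x ≤ 2 := by linarith [neg_one_le_cos x]
  have c1 : cos x = R1 + (1 - x ^ 2 / 2 + x ^ 4 / 24 - x ^ 6 / 720) := by rw [hR1]; ring
  have c2 : cos y = R2 + (1 - s * x ^ 2 / 2 + s ^ 2 * x ^ 4 / 24 - s ^ 3 * x ^ 6 / 720) := by
    have e4 : y ^ 4 = s ^ 2 * x ^ 4 := by
      rw [show y ^ 4 = (y ^ 2) ^ 2 by ring, hy]; ring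
    have e6 : y ^ 6 = s ^ 3 * x ^ 6 := by
      rw [show y ^ 6 = (y ^ 2) ^ 3 by ring, hy]; ring
    rw [hR2, e4, e6, hy]; ring
  have e8 : y ^ 8 = s ^ 4 * x ^ 8 := by
    rw [show y ^ 8 = (y ^ 2) ^ 4 by ring, hy]; ring
  set A := 1 - (1 - s) * (1 - cos x) / 6 with hA
  have c1s : 0 ≤ (1 - s) * (1 - cos x) := mul_nonneg (by linarith) ha0
  have c2s : (1 - s) * (1 - cos x) ≤ 1 * 2 := mul_le_mul (by linarith) ha2 ha0 zero_le_one
  have hA0 : 0 ≤ A := by rw [hA]; linarith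
  have hA1 : A ≤ 1 := by rw [hA]; linarith
  set w := x ^ 2 with hw
  have hw0 : 0 ≤ w := sq_nonneg x
  -- s·g is the Taylor part of 1 - cos y, and s·w⁴·Q collects the terms of order at least 8 in the
  -- product of the two Taylor polynomials. Lower orders cancel except for the sixth, 1/288 - 1/720
  -- = 1/480. All remainders must keep the factor s, since s = τ²/h² may be arbitrarily small.
  set g := w / 2 - s * w ^ 2 / 24 + s ^ 2 * w ^ 3 / 720 with hg
  set Q := -((1 - s) / 6 * ((1 + s ^ 2) / 1440 + s / 576 - (s + s ^ 2) * w / 17280 +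
    s ^ 2 * w ^ 2 / 518400)) with hQ
  have hs2 : s ^ 2 ≤ 1 := pow_le_one₀ hs0 hs1
  have hs20 : 0 ≤ s ^ 2 := sq_nonneg s
  have hw2 : w ^ 2 ≤ 1 := pow_le_one₀ hw0 hw1
  have hw3 : w ^ 3 ≤ 1 := pow_le_one₀ hw0 hw1
  have hgb : |g| ≤ 1 := by
    have t1 : s * w ^ 2 ≤ 1 := mul_le_one₀ hs1 (by positivity) hw2
    have t2 : s ^ 2 * w ^ 3 ≤ 1 := mul_le_one₀ hs2 (by positivity) hw3
    have t3 : 0 ≤ s * w ^ 2 := by positivity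
    have t4 : 0 ≤ s ^ 2 * w ^ 3 := by positivity
    rw [abs_le]; constructor <;> linarith
  have hQb : |Q| ≤ 1 := by
    rw [hQ, abs_neg, abs_mul, abs_of_nonneg (by linarith : 0 ≤ (1 - s) / 6)]
    refine mul_le_one₀ (by linarith) (abs_nonneg _) ?_
    have t1 : (s + s ^ 2) * w ≤ 2 * 1 := mul_le_mul (by linarith) hw1 hw0 zero_le_two
    have t2 : s ^ 2 * w ^ 2 ≤ 1 := mul_le_one₀ hs2 (by positivity) hw2
    have t3 : 0 ≤ (s + s ^ 2) * w := by positivity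
    have t4 : 0 ≤ s ^ 2 * w ^ 2 := by positivity
    rw [abs_le]; constructor <;> linarith
  have key : (1 - cos y) * A - s * (1 - cos x) - s * (1 - s ^ 2) * x ^ 6 / 480 =
      -(R2 * A) + s * (g * ((1 - s) / 6) * R1) + s * R1 + s * w ^ 4 * Q := by
    rw [hA, c1, c2, hg, hQ, hw]; ring
  have x8 : x ^ 8 = w ^ 4 := by rw [hw]; ring
  have hw4 : 0 ≤ w ^ 4 := by positivity
  rw [e8, x8] at b2
  rw [x8] at b1
  rw [key, x8]
  have k1 : |R2 * A| ≤ s * w ^ 4 := by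
    rw [abs_mul, abs_of_nonneg hA0]
    have : s ^ 4 ≤ s := by
      calc s ^ 4 = s * s ^ 3 := by ring
        _ ≤ s * 1 := by gcongr; exact pow_le_one₀ hs0 hs1
        _ = s := mul_one s
    calc |R2| * A ≤ |R2| * 1 := by gcongr
      _ ≤ s ^ 4 * w ^ 4 := by linarith
      _ ≤ s * w ^ 4 := by gcongr
  have k2 : |s * (g * ((1 - s) / 6) * R1)| ≤ s * w ^ 4 := by
    rw [abs_mul, abs_mul, abs_mul, abs_of_nonneg hs0,
      abs_of_nonneg (by linarith : 0 ≤ (1 - s) / 6)]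
    have : |g| * ((1 - s) / 6) ≤ 1 := mul_le_one₀ hgb (by linarith) (by linarith)
    have : |g| * ((1 - s) / 6) * |R1| ≤ 1 * w ^ 4 := by gcongr
    rw [one_mul] at this
    gcongr
  have k3 : |s * R1| ≤ s * w ^ 4 := by
    rw [abs_mul, abs_of_nonneg hs0]; gcongr
  have k4 : |s * w ^ 4 * Q| ≤ s * w ^ 4 := by
    rw [abs_mul, abs_of_nonneg (by positivity)]
    exact mul_le_of_le_one_right (by positivity) hQb
  rw [abs_le] at k1 k2 k3 k4 ⊢
  constructor <;> linarith [k1.1, k1.2, k2.1, k2.2, k3.1, k3.2, k4.1, k4.2]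

/-- Product formula for the difference, each sine lying between half its argument and its argument.
It converts the defect in the dispersion relation into a difference of frequencies. -/
theorem cos_sub_cos_bounds {κ μ τ : ℝ} (hτ : 0 < τ) (hμ0 : 0 ≤ μ) (hμk : μ < κ)
    (hkτ1 : κ * τ ≤ 1) :
    cos (μ * τ) - cos (κ * τ) ≤ (κ - μ) * (κ * τ ^ 2) ∧
      (κ - μ) * (κ * τ ^ 2) / 8 ≤ cos (μ * τ) - cos (κ * τ) := by
  have hkτ0 : 0 < κ * τ := mul_pos (by linarith) hτ
  set D := cos (μ * τ) - cos (κ * τ) with hD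
  have hDs : D = 2 * sin ((κ + μ) * τ / 2) * sin ((κ - μ) * τ / 2) := by
    rw [hD, cos_sub_cos, show (μ * τ - κ * τ) / 2 = -((κ - μ) * τ / 2) by ring, sin_neg,
      show (μ * τ + κ * τ) / 2 = (κ + μ) * τ / 2 by ring]
    ring
  set A1 := (κ + μ) * τ / 2 with hA1
  set A2 := (κ - μ) * τ / 2 with hA2
  have hA1p : 0 < A1 := by
    have : 0 < κ + μ := by linarith
    positivity
  have hA2p : 0 < A2 := by
    have : 0 < κ - μ := by linarith
    positivity
  have hA1k : A1 ≤ κ * τ := by rw [hA1]; nlinarith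
  have hA1k' : κ * τ / 2 ≤ A1 := by rw [hA1]; nlinarith
  have hA2k : A2 ≤ κ * τ := by rw [hA2]; nlinarith
  have hs1' : sin A1 ≤ A1 := sin_le hA1p.le
  have hs2' : sin A2 ≤ A2 := sin_le hA2p.le
  have h12 : (1 : ℝ) / 2 ≤ 2 / π := by
    rw [div_le_div_iff₀ two_pos pi_pos]; linarith [pi_le_four]
  have hp3 : A1 / 2 ≤ sin A1 := by
    have := mul_le_sin hA1p.le (by linarith [pi_gt_three])
    have := mul_le_mul_of_nonneg_right h12 hA1p.le
    linarith
  have hp4 : A2 / 2 ≤ sin A2 := by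
    have := mul_le_sin hA2p.le (by linarith [pi_gt_three])
    have := mul_le_mul_of_nonneg_right h12 hA2p.le
    linarith
  constructor
  · calc D = 2 * (sin A1 * sin A2) := by rw [hDs]; ring
        _ ≤ 2 * (κ * τ * A2) := by
          have : 0 ≤ sin A2 := by linarith
          gcongr
          linarith
        _ = _ := by rw [hA2]; ring
  · calc (κ - μ) * (κ * τ ^ 2) / 8 = 2 * ((κ * τ / 2 / 2) * (A2 / 2)) := by rw [hA2]; ring
        _ ≤ 2 * (sin A1 * sin A2) := by
          have : κ * τ / 2 / 2 ≤ sin A1 := by linarith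
          have : 0 ≤ sin A1 := by linarith
          gcongr
        _ = D := by rw [hDs]; ring

/-- The numerical frequency `μ` of the harmonic `sin kx` and its distance to `k`. -/
theorem exists_numerical_frequency {h τ ε : ℝ} {k : ℕ} (hk : 1 ≤ k) (hh : 0 < h) (hτ : 0 < τ)
    (hε : 0 < ε) (hε1 : ε ≤ 1) (hst : τ ^ 2 ≤ (1 - ε ^ 2 / 2) * h ^ 2)
    (hkh : (k * h) ^ 2 ≤ ε ^ 2 / 8000) :
    ∃ μ : ℝ, 0 ≤ μ ∧ symOp h τ k * (1 - cos (μ * τ)) = τ ^ 2 / 2 * symX h k ∧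
      k ^ 5 * h ^ 4 * (ε ^ 2 / 2000) ≤ k - μ ∧ k - μ ≤ 8 * (k ^ 5 * h ^ 4) := by
  have hk0 : (0 : ℝ) < k := by exact_mod_cast hk
  set s := τ ^ 2 / h ^ 2 with hs
  have hs0 : 0 < s := by positivity
  have hsε : s ≤ 1 - ε ^ 2 / 2 := by rw [hs, div_le_iff₀ (by positivity)]; exact hst
  have hε2 : 0 < ε ^ 2 := by positivity
  have hε21 : ε ^ 2 ≤ 1 := pow_le_one₀ hε.le hε1
  have hs1 : s ≤ 1 := by linarith
  set x := k * h with hx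
  have hx0 : 0 < x := by positivity
  have hw1 : x ^ 2 ≤ 1 / 8000 := by linarith
  have hx1 : |x| ≤ 1 := by
    rw [← sq_le_one_iff₀ (abs_nonneg x), sq_abs]; linarith
  have hsτ : τ ^ 2 = s * h ^ 2 := by rw [hs]; field_simp
  have hy : (k * τ) ^ 2 = s * x ^ 2 := by rw [hx, mul_pow, mul_pow, hsτ]; ring
  have hE := abs_dispersion_sub_le hx1 hs0.le hs1 hy
  have ha : symOp h τ k = 1 - (1 - s) * (1 - cos x) / 6 := by
    unfold symOp symX; rw [hsτ, hx]; field_simp; ring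
  have hX : τ ^ 2 / 2 * symX h k = s * (1 - cos x) := by
    unfold symX; rw [hsτ, hx]; field_simp
  rw [← ha] at hE
  set a := symOp h τ k with hadef
  have c0 : 0 ≤ 1 - cos x := by linarith [cos_le_one x]
  have c2 : 1 - cos x ≤ 1 := by linarith [one_sub_sq_div_two_le_cos (x := x)]
  have c1s : 0 ≤ (1 - s) * (1 - cos x) := mul_nonneg (by linarith) c0
  have c2s : (1 - s) * (1 - cos x) ≤ 1 := mul_le_one₀ (by linarith) c0 c2
  have ha1 : a ≤ 1 := by rw [ha]; linarith
  have ha0 : 2 / 3 ≤ a := by rw [ha]; linarith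
  have hapos : 0 < a := by linarith
  set q := s * (1 - cos x) / a with hq
  have hq0 : 0 ≤ q := by positivity
  have hq2 : q ≤ 2 := by
    rw [hq, div_le_iff₀ hapos]
    have := mul_le_one₀ hs1 c0 c2
    linarith
  -- The dispersion relation solved for μ; q ≤ 2 keeps 1 - q in the range of the cosine.
  set μ := arccos (1 - q) / τ with hμ
  have hμτ : μ * τ = arccos (1 - q) := by rw [hμ]; field_simp
  have hcos : cos (μ * τ) = 1 - q := by
    rw [hμτ, cos_arccos (by linarith) (by linarith)]
  have hμ0 : 0 ≤ μ := div_nonneg (arccos_nonneg _) hτ.le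
  have hμπ : μ * τ ≤ π := by rw [hμτ]; exact arccos_le_pi _
  have hkτ1 : k * τ ≤ 1 := by
    have : (k * τ) ^ 2 ≤ 1 := by
      rw [hy]; exact mul_le_one₀ hs1 (sq_nonneg x) (by linarith)
    exact (sq_le_one_iff₀ (by positivity)).1 this
  have hkτ0 : 0 < k * τ := by positivity
  have hfirst : a * (1 - cos (μ * τ)) = s * (1 - cos x) := by
    rw [hcos, hq]; field_simp; ring
  refine ⟨μ, hμ0, by rw [hfirst, hX], ?_⟩
  set D := cos (μ * τ) - cos (k * τ) with hD
  have hDa : (1 - cos (k * τ)) * a - s * (1 - cos x) = D * a := by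
    rw [← hfirst, hD]; ring
  rw [hDa, abs_le] at hE
  have hx6 : 0 < x ^ 6 := by positivity
  have hx8 : x ^ 8 = x ^ 6 * x ^ 2 := by ring
  have hsx : 0 < s * x ^ 6 := by positivity
  -- The gap in the stability condition keeps the leading dispersion coefficient away from zero.
  have hs2 : ε ^ 2 / 2 ≤ 1 - s ^ 2 := by
    have : 0 ≤ s * (1 - s) := mul_nonneg hs0.le (by linarith)
    linarith [sq s]
  -- The leading term is at least ε²/960 times s x⁶; since x² ≤ ε²/8000, the remainder takes away at
  -- most ε²/2000 times s x⁶, and 1/960 - 1/2000 ≥ 1/2000.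
  have hlow : s * x ^ 6 * (ε ^ 2 / 2000) ≤ D * a := by
    have t1 : s * x ^ 6 * (ε ^ 2 / 2) ≤ s * x ^ 6 * (1 - s ^ 2) := by gcongr
    have t2 : s * x ^ 6 * x ^ 2 ≤ s * x ^ 6 * (ε ^ 2 / 8000) := by gcongr
    have := hE.1
    rw [hx8] at this
    have t3 : 0 ≤ s * x ^ 6 * ε ^ 2 := by positivity
    linarith
  have hup : D * a ≤ s * x ^ 6 / 2 := by
    have t2 : s * x ^ 6 * x ^ 2 ≤ s * x ^ 6 * (1 / 8000) := by gcongr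
    have t3 : 0 ≤ s * x ^ 6 * s ^ 2 := by positivity
    have := hE.2
    rw [hx8] at this
    linarith
  have hDpos : 0 < D := by
    have : 0 < D * a := lt_of_lt_of_le (by positivity) hlow
    exact pos_of_mul_pos_left this hapos.le
  have hD1 : D * a ≤ D := mul_le_of_le_one_right hDpos.le ha1
  have hD2 : D ≤ s * x ^ 6 := by
    have : D * (2 / 3) ≤ D * a := by gcongr
    linarith
  have hlt : μ * τ < k * τ := by
    by_contra hcon
    push Not at hcon
    have := cos_le_cos_of_nonneg_of_le_pi hkτ0.le hμπ hcon
    linarith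
  have hμk : μ < k := lt_of_mul_lt_mul_right hlt hτ.le
  obtain ⟨hDl, hDu⟩ := cos_sub_cos_bounds hτ hμ0 hμk hkτ1
  -- The factor kτ² is common to the cosine difference and to the dispersion error; cancelling it
  -- leaves k⁵h⁴, independent of τ.
  have hx6' : s * x ^ 6 = (k ^ 5 * h ^ 4) * (k * τ ^ 2) := by
    rw [hsτ, hx]; ring
  have hkτ2 : 0 < k * τ ^ 2 := by positivity
  constructor
  · have h3 : (k ^ 5 * h ^ 4 * (ε ^ 2 / 2000)) * (k * τ ^ 2) ≤ (k - μ) * (k * τ ^ 2) := by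
      calc _ = s * x ^ 6 * (ε ^ 2 / 2000) := by rw [hx6']; ring
        _ ≤ _ := by linarith
    exact le_of_mul_le_mul_right h3 hkτ2
  · have h3 : (k - μ) * (k * τ ^ 2) ≤ 8 * (k ^ 5 * h ^ 4) * (k * τ ^ 2) := by
      rw [hx6'] at hD2
      linarith
    exact le_of_mul_le_mul_right h3 hkτ2

/-! ### Oscillating sums and lower bounds for mesh norms -/

/-- Multiplication by 2 sin(ατ/2) makes the sum telescope into cosines at half-integer nodes;
Jordan's inequality bounds this factor below as long as ατ ≤ π. -/
theorem abs_sum_sin_le {α τ : ℝ} (φ : ℝ) (hα : 0 < α) (hτ : 0 < τ) (hατ : α * τ ≤ π) {p q : ℕ}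
    (hpq : p ≤ q) : |τ * ∑ m ∈ Finset.Ico p q, sin (α * (m * τ) + φ)| ≤ π / α := by
  set f : ℕ → ℝ := fun m => cos (α * (((m : ℝ) - 1 / 2) * τ) + φ) with hf
  have tele : ∀ n : ℕ, 2 * sin (α * τ / 2) * ∑ m ∈ Finset.Ico p (p + n), sin (α * (m * τ) + φ) =
      f p - f (p + n) := by
    intro n
    induction n with
    | zero => simp
    | succ n ih =>
      rw [← add_assoc, Finset.sum_Ico_succ_top (by omega), mul_add, ih]
      have : f (p + n) - f (p + n + 1) =
          2 * sin (α * τ / 2) * sin (α * ((p + n : ℕ) * τ) + φ) := by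
        simp only [hf]
        rw [show α * ((((p + n : ℕ) : ℝ) - 1 / 2) * τ) + φ =
            (α * ((p + n : ℕ) * τ) + φ) - α * τ / 2 by ring,
          show α * ((((p + n + 1 : ℕ) : ℝ) - 1 / 2) * τ) + φ =
            (α * ((p + n : ℕ) * τ) + φ) + α * τ / 2 by push_cast; ring]
        generalize α * ((p + n : ℕ) * τ) + φ = B
        rw [cos_sub, cos_add]
        ring
      linarith
  obtain ⟨n, rfl⟩ := Nat.exists_eq_add_of_le hpq
  have h1 := tele n
  set S := ∑ m ∈ Finset.Ico p (p + n), sin (α * (m * τ) + φ) with hS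
  have hA : 0 < α * τ / 2 := by positivity
  have h2 := mul_le_sin hA.le (by linarith)
  have h3 : α * τ / π ≤ sin (α * τ / 2) := by
    refine le_trans (le_of_eq ?_) h2
    field_simp
  have h4 : |2 * sin (α * τ / 2) * S| ≤ 2 := by
    rw [h1]
    refine (abs_sub _ _).trans ?_
    linarith [abs_cos_le_one (α * (((p : ℝ) - 1 / 2) * τ) + φ),
      abs_cos_le_one (α * ((((p + n : ℕ) : ℝ) - 1 / 2) * τ) + φ)]
  have h5 : 0 < α * τ / π := by positivity
  rw [abs_mul, abs_of_pos (by linarith : 0 < 2 * sin (α * τ / 2))] at h4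
  rw [abs_mul, abs_of_pos hτ, le_div_iff₀ hα]
  have h6 : α * τ / π * |S| ≤ 1 := by
    have := mul_le_mul_of_nonneg_right h3 (abs_nonneg S)
    linarith
  calc τ * |S| * α = π * (α * τ / π * |S|) := by field_simp
    _ ≤ π * 1 := by gcongr
    _ = π := mul_one π

/-- A lower bound for mesh `L¹` norms in time by testing with a bounded mesh function. -/
theorem le_sum_abs_of_test {T τ c κ : ℝ} {M : ℕ} (hM : 0 < M) (hτ : 0 < τ) (hT : τ * M = T)
    (hc : 0 ≤ c) (hκ : 0 < κ) {E ψ : ℕ → ℝ} {s : ℝ → ℝ} {θ α : Fin 3 → ℝ} (hψ : ∀ m, |ψ m| ≤ 1)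
    (hθ : ∀ i, |θ i| ≤ 1) (hα : ∀ i, κ ≤ α i) (hατ : ∀ i, α i * τ ≤ π)
    (hs : ∀ t, T / 2 ≤ t → t ≤ T → c ≤ s t)
    (hE : ∀ m : ℕ, E m * ψ m = s (m * τ) / 2 + (∑ i, θ i * sin (α i * (m * τ))) / 2) :
    c * T / 4 - 3 * π / (2 * κ) ≤ τ * ∑ m ∈ Finset.Icc 1 M, |E m| := by
  -- The rounded-up half of M: the levels p, …, M all lie in [T/2, T], and there are at least M/2 of
  -- them.
  set p := M - M / 2 with hp
  have hp1 : 1 ≤ p := by omega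
  have hpM : p ≤ M + 1 := by omega
  have hp2 : (M : ℝ) / 2 ≤ p := by
    have : M ≤ 2 * p := by omega
    have : (M : ℝ) ≤ 2 * p := by exact_mod_cast this
    linarith
  have hcard : (M : ℝ) / 2 ≤ ((Finset.Ico p (M + 1)).card : ℝ) := by
    rw [Nat.card_Ico]
    have : M ≤ 2 * (M + 1 - p) := by omega
    have : (M : ℝ) ≤ 2 * ((M + 1 - p : ℕ) : ℝ) := by exact_mod_cast this
    linarith
  have hsub : Finset.Ico p (M + 1) ⊆ Finset.Icc 1 M := by
    intro m hm
    rw [Finset.mem_Ico] at hm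
    rw [Finset.mem_Icc]; omega
  have h1 : τ * ∑ m ∈ Finset.Ico p (M + 1), E m * ψ m ≤ τ * ∑ m ∈ Finset.Icc 1 M, |E m| := by
    refine mul_le_mul_of_nonneg_left ?_ hτ.le
    refine le_trans (Finset.sum_le_sum fun m _ => ?_)
      (Finset.sum_le_sum_of_subset_of_nonneg hsub fun m _ _ => abs_nonneg (E m))
    refine (le_abs_self _).trans ?_
    rw [abs_mul]
    exact mul_le_of_le_one_right (abs_nonneg _) (hψ m)
  refine le_trans ?_ h1
  have h2 : τ * ∑ m ∈ Finset.Ico p (M + 1), E m * ψ m =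
      (τ * ∑ m ∈ Finset.Ico p (M + 1), s (m * τ)) / 2 +
      (∑ i, θ i * (τ * ∑ m ∈ Finset.Ico p (M + 1), sin (α i * (m * τ) + 0))) / 2 := by
    simp only [hE, Finset.sum_add_distrib, mul_add, ← Finset.sum_div, add_zero]
    rw [Finset.sum_comm]
    simp only [Finset.mul_sum, Finset.sum_div, mul_div_assoc]
    congr 1
    refine Finset.sum_congr rfl fun i _ => Finset.sum_congr rfl fun m _ => ?_
    ring
  have h3 : c * T / 2 ≤ τ * ∑ m ∈ Finset.Ico p (M + 1), s (m * τ) := by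
    have : (Finset.Ico p (M + 1)).card • c ≤ ∑ m ∈ Finset.Ico p (M + 1), s (m * τ) := by
      refine Finset.card_nsmul_le_sum _ _ _ fun m hm => hs _ ?_ ?_
      · rw [Finset.mem_Ico] at hm
        have : (p : ℝ) ≤ m := by exact_mod_cast hm.1
        rw [← hT]; nlinarith
      · rw [Finset.mem_Ico] at hm
        have : (m : ℝ) ≤ M := by exact_mod_cast Nat.lt_succ_iff.1 hm.2
        rw [← hT]; nlinarith
    rw [nsmul_eq_mul] at this
    calc c * T / 2 = τ * ((M / 2) * c) := by rw [← hT]; ring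
      _ ≤ τ * ((Finset.Ico p (M + 1)).card * c) := by gcongr
      _ ≤ _ := by gcongr
  have h4 : |∑ i, θ i * (τ * ∑ m ∈ Finset.Ico p (M + 1), sin (α i * (m * τ) + 0))| ≤
      3 * (π / κ) := by
    refine (Finset.abs_sum_le_sum_abs _ _).trans ?_
    have : ∀ i ∈ Finset.univ,
        |θ i * (τ * ∑ m ∈ Finset.Ico p (M + 1), sin (α i * (m * τ) + 0))| ≤ π / κ := by
      intro i _
      rw [abs_mul]
      have hαi : 0 < α i := lt_of_lt_of_le hκ (hα i)
      have a1 := abs_sum_sin_le 0 hαi hτ (hατ i) hpM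
      have a2 : π / α i ≤ π / κ := div_le_div_of_nonneg_left pi_pos.le hκ (hα i)
      calc _ ≤ 1 * (π / α i) := by gcongr; exact hθ i
        _ ≤ _ := by rw [one_mul]; exact a2
    refine (Finset.sum_le_card_nsmul _ _ _ this).trans_eq ?_
    simp
  rw [h2]
  have h5 := (abs_le.1 h4).1
  have h6 : 3 * π / (2 * κ) = 3 * (π / κ) / 2 := by field_simp
  rw [h6]
  linarith

/-- Allows the discrete amplitudes to be replaced by their limits. -/
theorem sum_abs_perturb {T τ r : ℝ} {M : ℕ} (hτ : 0 ≤ τ) (hT : τ * M = T) {E E' : ℕ → ℝ}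
    (h : ∀ m ∈ Finset.Icc 1 M, |E' m - E m| ≤ r) :
    τ * ∑ m ∈ Finset.Icc 1 M, |E m| - r * T ≤ τ * ∑ m ∈ Finset.Icc 1 M, |E' m| := by
  have : ∑ m ∈ Finset.Icc 1 M, |E m| ≤ ∑ m ∈ Finset.Icc 1 M, (|E' m| + r) := by
    refine Finset.sum_le_sum fun m hm => ?_
    have := h m hm
    have := abs_sub_abs_le_abs_sub (E m) (E' m)
    rw [abs_sub_comm] at this
    linarith
  rw [Finset.sum_add_distrib, Finset.sum_const, Nat.card_Icc, nsmul_eq_mul,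
    Nat.add_sub_cancel] at this
  have := mul_le_mul_of_nonneg_left this hτ
  rw [← hT]
  linarith

theorem le_meshL1 (N : ℕ) {h : ℝ} (hh : 0 ≤ h) (w : ℕ → ℝ) :
    h * (∑ i ∈ Finset.Icc 1 N, |w i|) / 2 ≤ meshL1 N h w := by
  unfold meshL1
  rw [Finset.mul_sum, Finset.sum_div]
  refine Finset.sum_le_sum fun i _ => ?_
  have := mul_nonneg (abs_nonneg (w (i - 1))) hh
  linarith

theorem meshL1Diff_nonneg (l : Fin 2) (N : ℕ) {h : ℝ} (hh : 0 ≤ h) (w : ℕ → ℝ) :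
    0 ≤ meshL1Diff l N h w := by
  unfold meshL1Diff meshL1
  fin_cases l
  · exact Finset.sum_nonneg fun i _ => by positivity
  · exact Finset.sum_nonneg fun i _ => by positivity

theorem meshL1Diff_congr_mul (l : Fin 2) {N : ℕ} {h : ℝ} {w w' : ℕ → ℝ} {c : ℝ}
    (hw : ∀ i ≤ N, w i = c * w' i) : meshL1Diff l N h w = |c| * meshL1Diff l N h w' := by
  have h1 : ∀ i ∈ Finset.Icc 1 N, w i = c * w' i ∧ w (i - 1) = c * w' (i - 1) := by
    intro i hi
    rw [Finset.mem_Icc] at hi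
    exact ⟨hw i hi.2, hw (i - 1) (by omega)⟩
  unfold meshL1Diff meshL1 deltaBarX
  fin_cases l
  · dsimp only
    rw [Finset.mul_sum]
    refine Finset.sum_congr rfl fun i hi => ?_
    rw [(h1 i hi).1, (h1 i hi).2, abs_mul, abs_mul]; ring
  · dsimp only
    rw [Finset.mul_sum]
    refine Finset.sum_congr rfl fun i hi => ?_
    rw [(h1 i hi).1, (h1 i hi).2, ← mul_sub, mul_div_assoc, abs_mul]; ring

/-- From |sin| ≥ sin² = 1/2 - cos(2·)/2 the mesh sum of |sin| is at least π/2 minus half an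
oscillating sum, which is at most π/4 for k ≥ 2. The phase is kept free because the difference
quotient for l = 1 is 2 sin(kh/2)/h times a cosine at the midpoint, a shifted sine. -/
theorem le_meshL1Diff_sin (l : Fin 2) {N k : ℕ} {h : ℝ} (hN : 0 < N) (hh : h = π / N)
    (hk : 2 ≤ k) (hkh : k * h ≤ 1) :
    (k : ℝ) ^ (l : ℕ) / 2 ≤ meshL1Diff l N h fun i => sin (k * (i * h)) := by
  have hh0 : 0 < h := by rw [hh]; positivity
  have hNh : h * N = π := by rw [hh]; field_simp
  have hk2 : (2 : ℝ) ≤ k := by exact_mod_cast hk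
  have hIcc : Finset.Icc 1 N = Finset.Ico 1 (N + 1) := by
    ext i; rw [Finset.mem_Icc, Finset.mem_Ico]; omega
  have hosc : ∀ φ : ℝ, |h * ∑ i ∈ Finset.Icc 1 N, sin (2 * k * (i * h) + φ)| ≤ π / 4 := by
    intro φ
    rw [hIcc]
    refine (abs_sum_sin_le φ (by positivity) hh0 (by linarith [pi_gt_three]) (by omega)).trans ?_
    gcongr
    linarith
  have hquad : ∀ φ : ℝ, 1 ≤ h * ∑ i ∈ Finset.Icc 1 N, |sin (k * (i * h) + φ)| := by
    intro φ
    have h1 := (abs_le.1 (hosc (2 * φ + π / 2))).2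
    have h2 : h * ∑ i ∈ Finset.Icc 1 N, (1 / 2 - sin (2 * k * (i * h) + (2 * φ + π / 2)) / 2) ≤
        h * ∑ i ∈ Finset.Icc 1 N, |sin (k * (i * h) + φ)| := by
      refine mul_le_mul_of_nonneg_left (Finset.sum_le_sum fun i _ => ?_) hh0.le
      rw [← add_assoc, sin_add_pi_div_two,
        show 2 * k * (i * h) + 2 * φ = 2 * (k * (i * h) + φ) by ring, cos_two_mul, cos_sq']
      have h3 := abs_sin_le_one (k * (i * h) + φ)
      have h4 := sq_abs (sin (k * (i * h) + φ))
      nlinarith [abs_nonneg (sin (k * (i * h) + φ))]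
    have e : h * ∑ i ∈ Finset.Icc 1 N, (1 / 2 - sin (2 * k * (i * h) + (2 * φ + π / 2)) / 2) =
        π / 2 - (h * ∑ i ∈ Finset.Icc 1 N, sin (2 * k * (i * h) + (2 * φ + π / 2))) / 2 := by
      simp only [Finset.sum_sub_distrib, ← Finset.sum_div, Finset.sum_const, Nat.card_Icc,
        nsmul_eq_mul, Nat.add_sub_cancel, mul_one]
      linear_combination hNh / 2
    linarith [pi_gt_three]
  fin_cases l
  · have h1 := le_meshL1 N hh0.le fun i => sin (k * (i * h))
    have h2 := hquad 0
    simp only [add_zero] at h2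
    change (k : ℝ) ^ 0 / 2 ≤ meshL1 N h fun i => sin (k * (i * h))
    rw [pow_zero]
    linarith
  · change (k : ℝ) ^ 1 / 2 ≤
      ∑ i ∈ Finset.Icc 1 N, |deltaBarX h (fun i => sin (k * (i * h))) i| * h
    have h2 := hquad (π / 2 - k * h / 2)
    have hA : 0 < k * h / 2 := by positivity
    have h3 := mul_le_sin hA.le (by linarith [pi_gt_three])
    have h12 : (1 : ℝ) / 2 ≤ 2 / π := by
      rw [div_le_div_iff₀ two_pos pi_pos]; linarith [pi_le_four]
    have h4 := mul_le_mul_of_nonneg_right h12 hA.le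
    have h5 : ∀ i ∈ Finset.Icc 1 N, |deltaBarX h (fun i => sin (k * (i * h))) i| * h =
        2 * sin (k * h / 2) * |sin (k * (i * h) + (π / 2 - k * h / 2))| := by
      intro i hi
      rw [Finset.mem_Icc] at hi
      have e : deltaBarX h (fun i => sin (k * (i * h))) i * h =
          2 * sin (k * h / 2) * sin (k * (i * h) + (π / 2 - k * h / 2)) := by
        unfold deltaBarX
        rw [div_mul_cancel₀ _ hh0.ne', sin_sub_sin, Nat.cast_sub hi.1,
          show k * (i * h) + (π / 2 - k * h / 2) = (k * (i * h) - k * h / 2) + π / 2 by ring,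
          sin_add_pi_div_two, Nat.cast_one,
          show (k * (i * h) - k * (((i : ℝ) - 1) * h)) / 2 = k * h / 2 by ring,
          show (k * (i * h) + k * (((i : ℝ) - 1) * h)) / 2 = k * (i * h) - k * h / 2 by ring]
      have e2 := congrArg abs e
      rwa [abs_mul, abs_of_pos hh0, abs_mul (2 * sin (k * h / 2)),
        abs_of_pos (by linarith : 0 < 2 * sin (k * h / 2))] at e2
    rw [Finset.sum_congr rfl h5, ← Finset.mul_sum, pow_one]
    set S := ∑ i ∈ Finset.Icc 1 N, |sin (k * (i * h) + (π / 2 - k * h / 2))| with hS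
    have hS0 : 0 ≤ S := Finset.sum_nonneg fun _ _ => abs_nonneg _
    calc (k : ℝ) / 2 = k / 2 * 1 := by ring
      _ ≤ k / 2 * (h * S) := by gcongr
      _ = 2 * (1 / 2 * (k * h / 2)) * S := by ring
      _ ≤ 2 * sin (k * h / 2) * S := mul_le_mul_of_nonneg_right (by linarith) hS0

theorem le_errNorm_of_sin (l : Fin 2) {N M k : ℕ} {h τ : ℝ} (hN : 0 < N) (hh : h = π / N)
    (hτ : 0 ≤ τ) (hk : 2 ≤ k) (hkh : k * h ≤ 1) {u : ℝ → ℝ → ℝ} {v : ℕ → ℕ → ℝ} {E : ℕ → ℝ}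
    (hE : ∀ m ≤ M, ∀ i ≤ N, u (i * h) (m * τ) - v i m = E m * sin (k * (i * h))) :
    (k : ℝ) ^ (l : ℕ) / 4 * (τ * ∑ m ∈ Finset.Icc 1 M, |E m|) ≤ errNorm l N M h τ u v := by
  have hh0 : 0 < h := by rw [hh]; positivity
  refine le_trans ?_ (le_meshL1 M hτ _)
  have hX := le_meshL1Diff_sin l hN hh hk hkh
  have : (k : ℝ) ^ (l : ℕ) / 2 * ∑ m ∈ Finset.Icc 1 M, |E m| ≤
      ∑ m ∈ Finset.Icc 1 M, |meshL1Diff l N h fun i => u (i * h) (m * τ) - v i m| := by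
    rw [Finset.mul_sum]
    refine Finset.sum_le_sum fun m hm => ?_
    rw [Finset.mem_Icc] at hm
    rw [abs_of_nonneg (meshL1Diff_nonneg l N hh0.le _), meshL1Diff_congr_mul l (hE m hm.2),
      mul_comm]
    gcongr
  have := mul_le_mul_of_nonneg_left this hτ
  linarith

/-! ### Explicit exact and discrete solutions for the three harmonics -/

/-- The amplitude of the scheme solution for the initial velocity `sin kx`. -/
noncomputable def ampU1 (ρ : Fin 3) (h τ : ℝ) (k : ℕ) (μ : ℝ) : ℝ :=
  symU1 ρ h τ k * τ / (symOp h τ k * sin (μ * τ))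

/-- The amplitude of the forced oscillation for the free term `sin kx sin (k-1)t`. -/
noncomputable def ampForced (h τ : ℝ) (k : ℕ) : ℝ :=
  symQ h k * symQ τ ((k : ℝ) - 1) /
    (symX h k - symOp h τ k * (2 * (1 - cos (((k : ℝ) - 1) * τ)) / τ ^ 2))

/-- The amplitude of the free oscillation for the free term `sin kx sin (k-1)t`. -/
noncomputable def ampFree (h τ : ℝ) (k : ℕ) (μ : ℝ) : ℝ :=
  (τ ^ 2 * symQ h k * qT τ (fun t => sin (((k : ℝ) - 1) * t)) 0 / (2 * symOp h τ k) -
    ampForced h τ k * sin (((k : ℝ) - 1) * τ)) / sin (μ * τ)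

theorem lapT_cos {τ : ℝ} (β : ℝ) {m : ℕ} (hm : 1 ≤ m) :
    lapT τ (fun m => cos (β * (m * τ))) m =
      -(2 * (1 - cos (β * τ)) / τ ^ 2) * cos (β * (m * τ)) := by
  unfold lapT
  push_cast [Nat.cast_sub hm]
  rw [show β * (((m : ℝ) - 1) * τ) = β * (m * τ) - β * τ by ring,
    show β * (((m : ℝ) + 1) * τ) = β * (m * τ) + β * τ by ring, cos_sub, cos_add]
  ring

theorem lapT_sin {τ : ℝ} (β : ℝ) {m : ℕ} (hm : 1 ≤ m) :
    lapT τ (fun m => sin (β * (m * τ))) m =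
      -(2 * (1 - cos (β * τ)) / τ ^ 2) * sin (β * (m * τ)) := by
  unfold lapT
  push_cast [Nat.cast_sub hm]
  rw [show β * (((m : ℝ) - 1) * τ) = β * (m * τ) - β * τ by ring,
    show β * (((m : ℝ) + 1) * τ) = β * (m * τ) + β * τ by ring, sin_sub, sin_add]
  ring

theorem lapT_lin (τ a b : ℝ) (y z : ℕ → ℝ) (m : ℕ) :
    lapT τ (fun m => a * y m + b * z m) m = a * lapT τ y m + b * lapT τ z m := by
  unfold lapT; ring

theorem lapT_const_mul (τ a : ℝ) (y : ℕ → ℝ) (m : ℕ) :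
    lapT τ (fun m => a * y m) m = a * lapT τ y m := by
  unfold lapT; ring

theorem qT_zero (τ : ℝ) (m : ℕ) : qT τ (fun _ => 0) m = 0 := by
  simp [qT]

theorem symX_eq_of_frequency {h τ μ : ℝ} {k : ℕ} (hτ : 0 < τ)
    (hμ : symOp h τ k * (1 - cos (μ * τ)) = τ ^ 2 / 2 * symX h k) :
    symX h k = symOp h τ k * (2 * (1 - cos (μ * τ)) / τ ^ 2) := by
  field_simp
  linear_combination -2 * hμ

/-- For this pure cosine the discrete initial-velocity equation is the dispersion relation itself,
so the amplitude is exactly 1 and no correction term occurs. -/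
theorem isSchemeSolution_harmonic_zero (ρ : Fin 3) {N M k : ℕ} {h τ μ : ℝ} (hN : 0 < N)
    (hh : h = π / N) (hτ : 0 < τ)
    (hμ : symOp h τ k * (1 - cos (μ * τ)) = τ ^ 2 / 2 * symX h k) :
    IsSchemeSolution ρ N M h τ (harmonicData 0 k)
      fun i m => sin (k * (i * h)) * cos (μ * (m * τ)) := by
  refine IsSchemeSolution.of_sin hN hh (a := 1) (b := 0) (z := fun _ => 0)
    (y := fun m => cos (μ * (m * τ))) ?_ ?_ ?_ ?_ ?_ ?_
  · funext x; simp [harmonicData]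
  · funext x; simp [harmonicData]
  · funext x t; simp [harmonicData]
  · simp
  · rw [qT_zero]
    simp only [Nat.cast_one, one_mul, CharP.cast_eq_zero, zero_mul, mul_zero, cos_zero]
    field_simp
    linear_combination -2 * hμ
  · intro m hm
    rw [lapT_cos _ hm, qT_zero]
    linear_combination cos (μ * (m * τ)) * symX_eq_of_frequency hτ hμ

theorem isSchemeSolution_harmonic_one (ρ : Fin 3) {N M k : ℕ} {h τ μ : ℝ} (hN : 0 < N)
    (hh : h = π / N) (hτ : 0 < τ)
    (hμ : symOp h τ k * (1 - cos (μ * τ)) = τ ^ 2 / 2 * symX h k) (hs : sin (μ * τ) ≠ 0) :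
    IsSchemeSolution ρ N M h τ (harmonicData 1 k)
      fun i m => sin (k * (i * h)) * (ampU1 ρ h τ k μ * sin (μ * (m * τ))) := by
  have ha : symOp h τ k ≠ 0 := (symOp_pos (by rw [hh]; positivity) k).ne'
  refine IsSchemeSolution.of_sin hN hh (a := 0) (b := 1) (z := fun _ => 0)
    (y := fun m => ampU1 ρ h τ k μ * sin (μ * (m * τ))) ?_ ?_ ?_ ?_ ?_ ?_
  · funext x; simp [harmonicData]
  · funext x; simp [harmonicData]
  · funext x t; simp [harmonicData]
  · simp
  · rw [qT_zero]
    simp only [Nat.cast_one, one_mul, CharP.cast_eq_zero, zero_mul, mul_zero, sin_zero, ampU1]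
    generalize sin (μ * τ) = S at hs
    field_simp
    ring
  · intro m hm
    rw [lapT_const_mul, lapT_sin _ hm, qT_zero]
    linear_combination ampU1 ρ h τ k μ * sin (μ * (m * τ)) * symX_eq_of_frequency hτ hμ

theorem isSchemeSolution_harmonic_two (ρ : Fin 3) {N M k : ℕ} {h τ μ : ℝ} (hN : 0 < N)
    (hh : h = π / N) (hτ : 0 < τ)
    (hμ : symOp h τ k * (1 - cos (μ * τ)) = τ ^ 2 / 2 * symX h k) (hs : sin (μ * τ) ≠ 0)
    (hd : symX h k - symOp h τ k * (2 * (1 - cos (((k : ℝ) - 1) * τ)) / τ ^ 2) ≠ 0) :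
    IsSchemeSolution ρ N M h τ (harmonicData 2 k)
      fun i m => sin (k * (i * h)) * (ampForced h τ k * sin (((k : ℝ) - 1) * (m * τ)) +
        ampFree h τ k μ * sin (μ * (m * τ))) := by
  have ha : symOp h τ k ≠ 0 := (symOp_pos (by rw [hh]; positivity) k).ne'
  refine IsSchemeSolution.of_sin hN hh (a := 0) (b := 0) (z := fun t => sin (((k : ℝ) - 1) * t))
    (y := fun m => ampForced h τ k * sin (((k : ℝ) - 1) * (m * τ)) +
        ampFree h τ k μ * sin (μ * (m * τ))) ?_ ?_ ?_ ?_ ?_ ?_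
  · funext x; simp [harmonicData]
  · funext x; simp [harmonicData]
  · funext x t; simp [harmonicData]
  · simp
  · simp only [Nat.cast_one, one_mul, CharP.cast_eq_zero, zero_mul, mul_zero, sin_zero, add_zero]
    have : ampFree h τ k μ * sin (μ * τ) =
        τ ^ 2 * symQ h k * qT τ (fun t => sin (((k : ℝ) - 1) * t)) 0 / (2 * symOp h τ k) -
        ampForced h τ k * sin (((k : ℝ) - 1) * τ) := by
      unfold ampFree; exact div_mul_cancel₀ _ hs
    rw [this]
    field_simp
    ring
  · intro m hm
    rw [lapT_lin, lapT_sin _ hm, lapT_sin _ hm, qT_sin hτ.ne' _ hm]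
    have h1 : ampForced h τ k *
        (symX h k - symOp h τ k * (2 * (1 - cos (((k : ℝ) - 1) * τ)) / τ ^ 2)) =
        symQ h k * symQ τ ((k : ℝ) - 1) := by
      unfold ampForced; exact div_mul_cancel₀ _ hd
    have h2 := symX_eq_of_frequency hτ hμ
    linear_combination sin (((k : ℝ) - 1) * (m * τ)) * h1 +
      ampFree h τ k μ * sin (μ * (m * τ)) * h2

theorem isWeakSolution_harmonic_zero {T : ℝ} (hT : 0 ≤ T) (k : ℕ) :
    IsWeakSolution T (harmonicData 0 k) fun x t => sin (k * x) * cos (k * t) := by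
  refine isWeakSolution_sin hT (z := fun _ => 0) (y' := fun t => -(k * sin (k * t)))
    continuous_const (hasDerivAt_cos_mul k) (fun t => ?_) ?_ ?_ ?_
  · convert! ((hasDerivAt_sin_mul k t).const_mul (k : ℝ)).neg using 1; ring
  · funext x; simp [harmonicData]
  · funext x; simp [harmonicData]
  · funext x t; simp [harmonicData]

theorem isWeakSolution_harmonic_one {T : ℝ} (hT : 0 ≤ T) {k : ℕ} (hk : 1 ≤ k) :
    IsWeakSolution T (harmonicData 1 k) fun x t => sin (k * x) * (sin (k * t) / k) := by
  have hk0 : (k : ℝ) ≠ 0 := by positivity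
  refine isWeakSolution_sin hT (z := fun _ => 0) (y := fun t => sin (k * t) / k)
    (y' := fun t => cos (k * t))
    continuous_const (fun t => ?_) (fun t => ?_) ?_ ?_ ?_
  · convert! (hasDerivAt_sin_mul k t).div_const (k : ℝ) using 1; field_simp
  · convert! hasDerivAt_cos_mul k t using 1; field_simp; ring
  · funext x; simp [harmonicData]
  · funext x; simp [harmonicData]
  · funext x t; simp [harmonicData]

/-- The denominator is k² - (k-1)²; the free oscillation is chosen to cancel the initial velocity of
the forced one. -/
theorem isWeakSolution_harmonic_two {T : ℝ} (hT : 0 ≤ T) {k : ℕ} (hk : 1 ≤ k) :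
    IsWeakSolution T (harmonicData 2 k) fun x t => sin (k * x) *
      ((sin (((k : ℝ) - 1) * t) - ((k : ℝ) - 1) / k * sin (k * t)) / (2 * k - 1)) := by
  have hk0 : (k : ℝ) ≠ 0 := by positivity
  have hk1 : (1 : ℝ) ≤ k := by exact_mod_cast hk
  have hk2 : 2 * (k : ℝ) - 1 ≠ 0 := by linarith
  refine isWeakSolution_sin hT (z := fun t => sin (((k : ℝ) - 1) * t))
    (y := fun t => (sin (((k : ℝ) - 1) * t) - ((k : ℝ) - 1) / k * sin (k * t)) / (2 * k - 1))
    (y' := fun t => (((k : ℝ) - 1) * cos (((k : ℝ) - 1) * t) -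
      ((k : ℝ) - 1) / k * (k * cos (k * t))) / (2 * k - 1))
    (by fun_prop) (fun t => ?_) (fun t => ?_) ?_ ?_ ?_
  · exact ((hasDerivAt_sin_mul _ t).sub ((hasDerivAt_sin_mul k t).const_mul _)).div_const _
  · convert! (((hasDerivAt_cos_mul ((k : ℝ) - 1) t).const_mul ((k : ℝ) - 1)).sub
      (((hasDerivAt_cos_mul k t).const_mul (k : ℝ)).const_mul
        (((k : ℝ) - 1) / k))).div_const (2 * (k : ℝ) - 1) using 1
    generalize sin (((k : ℝ) - 1) * t) = S1
    generalize sin (k * t) = S2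
    have : (k : ℝ) * 2 - 1 ≠ 0 := by linarith
    field_simp; ring
  · funext x; simp [harmonicData]
  · funext x
    have : ((k : ℝ) - 1) / k * (k * cos (k * 0)) = k - 1 := by simp; field_simp
    simp only [this]; simp [harmonicData]
  · funext x t; simp [harmonicData]

theorem exists_isWeakSolution {T : ℝ} (hT : 0 ≤ T) (j : Fin 3) {k : ℕ} (hk : 1 ≤ k) :
    ∃ u, IsWeakSolution T (harmonicData j k) u := by
  fin_cases j
  · exact ⟨_, isWeakSolution_harmonic_zero hT k⟩
  · exact ⟨_, isWeakSolution_harmonic_one hT hk⟩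
  · exact ⟨_, isWeakSolution_harmonic_two hT hk⟩

/-! ### Multipliers of the averages at low frequency -/

theorem integral_hat {s : ℝ} (hs : 0 < s) : ∫ x in (0 : ℝ)..s, hat s 0 x = s / 2 := by
  have : ∀ x ∈ uIcc 0 s, hat s 0 x = 1 - x / s := by
    intro x hx
    rw [uIcc_of_le hs.le] at hx
    have h1 : 0 ≤ x / s := div_nonneg hx.1 hs.le
    have h2 : x / s ≤ 1 := (div_le_one hs).2 hx.2
    simp only [hat, CharP.cast_eq_zero, sub_zero, abs_of_nonneg h1]
    exact max_eq_left (by linarith)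
  rw [intervalIntegral.integral_congr this, intervalIntegral.integral_sub (by simp)
    (Continuous.intervalIntegrable (by fun_prop) _ _), intervalIntegral.integral_div, integral_id]
  simp
  field_simp
  ring

theorem integral_hat_symm {s : ℝ} (hs : 0 < s) : ∫ x in (-s)..s, hat s 0 x = s := by
  have h1 : ∫ x in (-s)..0, hat s 0 x = s / 2 := by
    have := intervalIntegral.integral_comp_neg (a := 0) (b := s) (hat s 0)
    rw [neg_zero] at this
    rw [← this, ← integral_hat hs]
    refine intervalIntegral.integral_congr fun x _ => ?_
    simp [hat, neg_div]
  have hc := continuous_hat s 0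
  rw [← intervalIntegral.integral_add_adjacent_intervals (hc.intervalIntegrable _ _)
    (hc.intervalIntegrable 0 _), h1, integral_hat hs]
  ring

theorem abs_symQ_sub_one_le {s : ℝ} (hs : 0 < s) (β : ℝ) : |symQ s β - 1| ≤ (β * s) ^ 2 / 2 := by
  have hc := continuous_hat s 0
  have e : symQ s β - 1 = -(1 / s * ∫ x in (-s)..s, (1 - cos (β * x)) * hat s 0 x) := by
    simp only [sub_mul, one_mul]
    rw [intervalIntegral.integral_sub (hc.intervalIntegrable _ _)
      (Continuous.intervalIntegrable (by fun_prop) _ _), integral_hat_symm hs]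
    unfold symQ
    field_simp
    ring
  have hle : -s ≤ s := by linarith
  have h1 : ∫ x in (-s)..s, (1 - cos (β * x)) * hat s 0 x ≤
      ∫ x in (-s)..s, (β * s) ^ 2 / 2 * hat s 0 x := by
    refine intervalIntegral.integral_mono_on hle (Continuous.intervalIntegrable (by fun_prop) _ _)
      (Continuous.intervalIntegrable (by fun_prop) _ _) fun x hx => ?_
    refine mul_le_mul_of_nonneg_right ?_ (hat_nonneg _ _ _)
    have h2 := one_sub_sq_div_two_le_cos (x := β * x)
    have h3 : (β * x) ^ 2 ≤ (β * s) ^ 2 := by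
      rw [mul_pow, mul_pow]
      refine mul_le_mul_of_nonneg_left ?_ (sq_nonneg β)
      exact sq_le_sq' hx.1 hx.2
    linarith
  have h0 : 0 ≤ ∫ x in (-s)..s, (1 - cos (β * x)) * hat s 0 x :=
    intervalIntegral.integral_nonneg hle fun x _ =>
      mul_nonneg (by linarith [cos_le_one (β * x)]) (hat_nonneg _ _ _)
  rw [intervalIntegral.integral_const_mul, integral_hat_symm hs] at h1
  rw [e, abs_neg, abs_of_nonneg (by positivity), one_div, inv_mul_le_iff₀ hs]
  linarith

theorem abs_qT_sin_zero_le {τ β : ℝ} (hτ : 0 < τ) (hβ : 0 ≤ β) (hβτ : β * τ ≤ 1) :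
    |qT τ (fun t => sin (β * t)) 0| ≤ β * τ := by
  have hc := continuous_hat τ 0
  have hsin : ∀ t ∈ Icc 0 τ, 0 ≤ sin (β * t) ∧ sin (β * t) ≤ β * τ := by
    intro t ht
    have h1 : 0 ≤ β * t := mul_nonneg hβ ht.1
    have h2 : β * t ≤ β * τ := mul_le_mul_of_nonneg_left ht.2 hβ
    exact ⟨sin_nonneg_of_nonneg_of_le_pi h1 (by linarith [pi_gt_three]), (sin_le h1).trans h2⟩
  have h1 : ∫ t in (0 : ℝ)..τ, sin (β * t) * hat τ 0 t ≤ ∫ t in (0 : ℝ)..τ, β * τ * hat τ 0 t := by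
    refine intervalIntegral.integral_mono_on hτ.le
      (Continuous.intervalIntegrable (by fun_prop) _ _)
      (Continuous.intervalIntegrable (by fun_prop) _ _) fun t ht => ?_
    exact mul_le_mul_of_nonneg_right (hsin t ht).2 (hat_nonneg _ _ _)
  have h0 : 0 ≤ ∫ t in (0 : ℝ)..τ, sin (β * t) * hat τ 0 t :=
    intervalIntegral.integral_nonneg hτ.le fun t ht =>
      mul_nonneg (hsin t ht).1 (hat_nonneg _ _ _)
  rw [intervalIntegral.integral_const_mul, integral_hat hτ] at h1
  unfold qT
  rw [if_pos rfl, abs_of_nonneg (by positivity)]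
  calc _ ≤ 2 / τ * (β * τ * (τ / 2)) := by gcongr
    _ = β * τ := by field_simp

theorem sin_eq_mul_sinc (x : ℝ) : sin x = x * sinc x := by
  rcases eq_or_ne x 0 with rfl | hx
  · simp
  · rw [sinc_of_ne_zero hx]; field_simp

/-! ### Limits of the amplitudes along resonant families -/

open Filter Topology

/-- A family of harmonics and meshes for which the numerical frequency `μ` stays at a bounded
distance below `k` while `k → ∞` and `k h → 0`. -/
structure ResonantFamily {Ω : Type*} (F : Filter Ω) (k : Ω → ℕ) (h τ μ : Ω → ℝ) : Prop where
  k_atTop : Tendsto (fun p => (k p : ℝ)) F atTop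
  kh_zero : Tendsto (fun p => k p * h p) F (𝓝 0)
  h_pos : ∀ᶠ p in F, 0 < h p
  τ_pos : ∀ᶠ p in F, 0 < τ p
  τ_le : ∀ᶠ p in F, τ p ≤ h p
  gap_nonneg : ∀ᶠ p in F, 0 ≤ k p - μ p
  -- Keeps 1 - δ away from zero, so the source frequency k - 1 stays clear of the numerical
  -- frequency μ.
  gap_le : ∀ᶠ p in F, k p - μ p ≤ 1 / 2
  freq : ∀ᶠ p in F, symOp (h p) (τ p) (k p) * (1 - cos (μ p * τ p)) =
    τ p ^ 2 / 2 * symX (h p) (k p)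

namespace ResonantFamily

variable {Ω : Type*} {F : Filter Ω} {k : Ω → ℕ} {h τ μ : Ω → ℝ}

theorem k_large (R : ResonantFamily F k h τ μ) (C : ℝ) : ∀ᶠ p in F, C ≤ k p :=
  R.k_atTop.eventually_ge_atTop C

theorem tendsto_kτ (R : ResonantFamily F k h τ μ) : Tendsto (fun p => k p * τ p) F (𝓝 0) := by
  refine squeeze_zero' ?_ ?_ R.kh_zero
  · filter_upwards [R.τ_pos] with p h1; positivity
  · filter_upwards [R.τ_le] with p h1; gcongr

theorem tendsto_mul_τ (R : ResonantFamily F k h τ μ) {β : Ω → ℝ}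
    (hβ : ∀ᶠ p in F, |β p| ≤ 2 * k p) : Tendsto (fun p => β p * τ p) F (𝓝 0) := by
  refine squeeze_zero_norm' ?_ (by simpa using R.tendsto_kτ.const_mul 2)
  filter_upwards [R.τ_pos, hβ] with p h1 h2
  rw [Real.norm_eq_abs, abs_mul, abs_of_pos h1, ← mul_assoc]
  gcongr

theorem tendsto_sinc_mul_τ (R : ResonantFamily F k h τ μ) {β : Ω → ℝ}
    (hβ : ∀ᶠ p in F, |β p| ≤ 2 * k p) : Tendsto (fun p => sinc (β p * τ p)) F (𝓝 1) := by
  have := (continuous_sinc.tendsto 0).comp (R.tendsto_mul_τ hβ)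
  rwa [sinc_zero] at this

theorem tendsto_bounded_div_k (R : ResonantFamily F k h τ μ) {b : Ω → ℝ} {C : ℝ}
    (hb : ∀ᶠ p in F, |b p| ≤ C) : Tendsto (fun p => b p / k p) F (𝓝 0) := by
  refine squeeze_zero_norm' ?_ (R.k_atTop.const_div_atTop C)
  filter_upwards [hb] with p hp
  rw [Real.norm_eq_abs, abs_div, abs_of_nonneg (by positivity : (0 : ℝ) ≤ k p)]
  gcongr

theorem tendsto_div_k (R : ResonantFamily F k h τ μ) {β : Ω → ℝ} {C : ℝ}
    (hβ : ∀ᶠ p in F, |β p - k p| ≤ C) : Tendsto (fun p => β p / k p) F (𝓝 1) := by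
  have := (R.tendsto_bounded_div_k hβ).add_const 1
  rw [zero_add] at this
  refine this.congr' ?_
  filter_upwards [R.k_large 1] with p hp
  have : (k p : ℝ) ≠ 0 := by linarith
  field_simp
  ring

theorem tendsto_sin_div (R : ResonantFamily F k h τ μ) {β : Ω → ℝ} {C : ℝ}
    (hβ : ∀ᶠ p in F, |β p - k p| ≤ C) :
    Tendsto (fun p => sin (β p * τ p) / (k p * τ p)) F (𝓝 1) := by
  have h2 : ∀ᶠ p in F, |β p| ≤ 2 * k p := by
    filter_upwards [hβ, R.k_large C] with p h1 h2
    have := abs_add_le (β p - k p) (k p)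
    rw [sub_add_cancel, abs_of_nonneg (by positivity : (0 : ℝ) ≤ k p)] at this
    linarith
  have := (R.tendsto_div_k hβ).mul (R.tendsto_sinc_mul_τ h2)
  rw [one_mul] at this
  refine this.congr' ?_
  filter_upwards [R.k_large 1, R.τ_pos] with p hp hτ
  have : (k p : ℝ) ≠ 0 := by linarith
  rw [sin_eq_mul_sinc]
  field_simp

theorem abs_freq_sub (R : ResonantFamily F k h τ μ) : ∀ᶠ p in F, |μ p - k p| ≤ 1 / 2 := by
  filter_upwards [R.gap_nonneg, R.gap_le] with p h1 h2
  rw [abs_le]; constructor <;> linarith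

theorem tendsto_hsymX (R : ResonantFamily F k h τ μ) :
    Tendsto (fun p => h p ^ 2 * symX (h p) (k p)) F (𝓝 0) := by
  have h1 : Tendsto (fun p => 2 * (1 - cos (k p * h p))) F (𝓝 (2 * (1 - cos 0))) :=
    (((continuous_cos.tendsto 0).comp R.kh_zero).const_sub 1).const_mul 2
  simp only [cos_zero, sub_self, mul_zero] at h1
  refine h1.congr' ?_
  filter_upwards [R.h_pos] with p hp
  unfold symX
  field_simp

theorem tendsto_τsymX (R : ResonantFamily F k h τ μ) :
    Tendsto (fun p => τ p ^ 2 * symX (h p) (k p)) F (𝓝 0) := by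
  refine squeeze_zero' (Eventually.of_forall fun p => ?_) ?_ R.tendsto_hsymX
  · exact mul_nonneg (sq_nonneg _) (symX_nonneg _ _)
  · filter_upwards [R.τ_pos, R.τ_le] with p h1 h2
    have := symX_nonneg (h p) (k p)
    gcongr

theorem tendsto_symOp (R : ResonantFamily F k h τ μ) :
    Tendsto (fun p => symOp (h p) (τ p) (k p)) F (𝓝 1) := by
  have := ((R.tendsto_hsymX.sub R.tendsto_τsymX).div_const 12).const_sub 1
  simp only [sub_self, zero_div, sub_zero] at this
  refine this.congr fun p => ?_
  unfold symOp; ring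

theorem tendsto_symQ_h (R : ResonantFamily F k h τ μ) :
    Tendsto (fun p => symQ (h p) (k p)) F (𝓝 1) := by
  rw [tendsto_iff_norm_sub_tendsto_zero]
  have := (R.kh_zero.pow 2).div_const 2
  simp only [ne_eq, OfNat.ofNat_ne_zero, not_false_eq_true, zero_pow, zero_div] at this
  refine squeeze_zero' (Eventually.of_forall fun p => norm_nonneg _) ?_ this
  filter_upwards [R.h_pos] with p hp
  exact abs_symQ_sub_one_le hp _

theorem tendsto_symQ_τ (R : ResonantFamily F k h τ μ) {β : Ω → ℝ}
    (hβ : ∀ᶠ p in F, |β p| ≤ 2 * k p) : Tendsto (fun p => symQ (τ p) (β p)) F (𝓝 1) := by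
  rw [tendsto_iff_norm_sub_tendsto_zero]
  have := ((R.tendsto_mul_τ hβ).pow 2).div_const 2
  simp only [ne_eq, OfNat.ofNat_ne_zero, not_false_eq_true, zero_pow, zero_div] at this
  refine squeeze_zero' (Eventually.of_forall fun p => norm_nonneg _) ?_ this
  filter_upwards [R.τ_pos] with p hp
  exact abs_symQ_sub_one_le hp _

theorem tendsto_symU1 (R : ResonantFamily F k h τ μ) (ρ : Fin 3) :
    Tendsto (fun p => symU1 ρ (h p) (τ p) (k p)) F (𝓝 1) := by
  have e1 := R.tendsto_hsymX.div_const 12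
  have e2 := R.tendsto_τsymX.div_const 12
  have e3 := R.tendsto_symQ_h
  rw [zero_div] at e1 e2
  fin_cases ρ
  · have := (e1.const_sub 1).sub e2
    rw [sub_zero, sub_zero] at this
    refine this.congr fun p => ?_
    simp only [symU1]; ring
  · have := e3.sub e2
    rw [sub_zero] at this
    refine this.congr fun p => ?_
    simp only [symU1]; ring
  · have := (e2.const_sub 1).mul e3
    rw [sub_zero, one_mul] at this
    refine this.congr fun p => ?_
    simp only [symU1]; ring

theorem tendsto_ampU1 (R : ResonantFamily F k h τ μ) (ρ : Fin 3) :
    Tendsto (fun p => k p * ampU1 ρ (h p) (τ p) (k p) (μ p)) F (𝓝 1) := by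
  have := (R.tendsto_symU1 ρ).div (R.tendsto_symOp.mul (R.tendsto_sin_div R.abs_freq_sub))
    (by norm_num)
  rw [mul_one, div_one] at this
  refine this.congr' ?_
  filter_upwards [R.k_large 1, R.τ_pos] with p hp hτ
  have : (k p : ℝ) ≠ 0 := by linarith
  unfold ampU1
  simp only [Pi.div_apply]
  rw [mul_div_assoc', mul_div_assoc', div_div_eq_mul_div]
  ring

theorem sin_freq_pos (R : ResonantFamily F k h τ μ) : ∀ᶠ p in F, 0 < sin (μ p * τ p) := by
  have := R.tendsto_sin_div R.abs_freq_sub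
  filter_upwards [this.eventually_const_lt zero_lt_one, R.k_large 1, R.τ_pos] with p h1 h2 h3
  have : 0 < k p * τ p := by positivity
  exact (div_pos_iff_of_pos_right this).1 h1

/-- The denominator of the forced amplitude. -/
theorem forced_denominator (R : ResonantFamily F k h τ μ) :
    ∀ᶠ p in F, symX (h p) (k p) -
      symOp (h p) (τ p) (k p) * (2 * (1 - cos (((k p : ℝ) - 1) * τ p)) / τ p ^ 2) =
      symOp (h p) (τ p) (k p) * ((μ p + (k p - 1)) * (1 - (k p - μ p))) *
        (sinc ((μ p + (k p - 1)) / 2 * τ p) * sinc ((1 - (k p - μ p)) / 2 * τ p)) := by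
  filter_upwards [R.freq, R.τ_pos] with p h1 h2
  have e1 := sin_eq_mul_sinc ((μ p + (k p - 1)) / 2 * τ p)
  have e2 := sin_eq_mul_sinc ((1 - (k p - μ p)) / 2 * τ p)
  -- Discrete counterpart of μ² - (k-1)² = (μ + k - 1)(1 - δ): writing each sine as its argument
  -- times `sinc` cancels τ² and leaves factors tending to 1.
  have e3 := cos_sub_cos (((k p : ℝ) - 1) * τ p) (μ p * τ p)
  rw [show (((k p : ℝ) - 1) * τ p + μ p * τ p) / 2 = (μ p + (k p - 1)) / 2 * τ p by ring,
    show (((k p : ℝ) - 1) * τ p - μ p * τ p) / 2 = -((1 - (k p - μ p)) / 2 * τ p) by ring,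
    sin_neg, e1, e2] at e3
  have e4 : symX (h p) (k p) = symOp (h p) (τ p) (k p) * (2 * (1 - cos (μ p * τ p)) / τ p ^ 2) := by
    field_simp; linear_combination -2 * h1
  have e5 : symX (h p) (k p) -
      symOp (h p) (τ p) (k p) * (2 * (1 - cos (((k p : ℝ) - 1) * τ p)) / τ p ^ 2) =
      symOp (h p) (τ p) (k p) *
        (2 * (cos (((k p : ℝ) - 1) * τ p) - cos (μ p * τ p)) / τ p ^ 2) := by
    linear_combination e4
  rw [e5, e3]
  field_simp

theorem forced_sinc (R : ResonantFamily F k h τ μ) :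
    Tendsto (fun p => sinc ((μ p + (k p - 1)) / 2 * τ p) * sinc ((1 - (k p - μ p)) / 2 * τ p)) F
      (𝓝 1) := by
  have := (R.tendsto_sinc_mul_τ (β := fun p => (μ p + (k p - 1)) / 2) ?_).mul
    (R.tendsto_sinc_mul_τ (β := fun p => (1 - (k p - μ p)) / 2) ?_)
  · rwa [one_mul] at this
  all_goals
    filter_upwards [R.gap_nonneg, R.gap_le, R.k_large 1] with p h1 h2 h3
    rw [abs_le]; constructor <;> linarith

theorem forced_denominator_ne_zero (R : ResonantFamily F k h τ μ) :
    ∀ᶠ p in F, symX (h p) (k p) -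
      symOp (h p) (τ p) (k p) * (2 * (1 - cos (((k p : ℝ) - 1) * τ p)) / τ p ^ 2) ≠ 0 := by
  filter_upwards [R.forced_denominator, R.forced_sinc.eventually_const_lt zero_lt_one, R.h_pos,
    R.gap_le, R.gap_nonneg, R.k_large 2] with p h1 h2 h3 h4 h5 h6
  rw [h1]
  have := symOp_pos (τ := τ p) h3 (k p)
  have : 0 < μ p + (k p - 1) := by linarith
  have : 0 < 1 - (k p - μ p) := by linarith
  positivity

/-- The exact amplitude is 1/(2k - 1). The lag replaces its denominator by approximately (2k - 1)(1
- δ), a relative change that does not vanish in the limit. -/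
theorem tendsto_ampForced (R : ResonantFamily F k h τ μ) :
    Tendsto (fun p => (2 * k p - 1) * (1 - (k p - μ p)) * ampForced (h p) (τ p) (k p)) F (𝓝 1) := by
  have hr : Tendsto (fun p => (2 * k p - 1) / (μ p + (k p - 1))) F (𝓝 1) := by
    have h1 : Tendsto (fun p => (k p - μ p) / k p) F (𝓝 0) :=
      R.tendsto_bounded_div_k (C := 1 / 2) (by
        filter_upwards [R.abs_freq_sub] with p hp; rwa [abs_sub_comm])
    have h2 : Tendsto (fun p => (1 : ℝ) / k p) F (𝓝 0) :=
      R.tendsto_bounded_div_k (C := 1) (by simp)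
    have := (h2.const_sub 2).div ((h1.const_sub 2).sub h2) (by norm_num)
    rw [sub_zero, sub_zero, div_self two_ne_zero] at this
    refine this.congr' ?_
    filter_upwards [R.k_large 1] with p hp
    have : (k p : ℝ) ≠ 0 := by linarith
    simp only [Pi.div_apply]
    rw [← mul_div_mul_right _ _ this]
    congr 1 <;> field_simp <;> ring
  have hβ : ∀ᶠ p in F, |(k p : ℝ) - 1| ≤ 2 * k p := by
    filter_upwards [R.k_large 1] with p h3
    rw [abs_le]; constructor <;> linarith
  have := hr.mul ((R.tendsto_symQ_h.mul (R.tendsto_symQ_τ hβ)).div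
    (R.tendsto_symOp.mul R.forced_sinc) (by norm_num))
  rw [mul_one, div_one, mul_one] at this
  refine this.congr' ?_
  filter_upwards [R.forced_denominator, R.forced_sinc.eventually_const_lt zero_lt_one, R.h_pos,
    R.gap_le, R.gap_nonneg, R.k_large 2] with p h1 h2 h3 h4 h5 h6
  unfold ampForced
  rw [h1]
  have a1 := (symOp_pos (τ := τ p) h3 (k p)).ne'
  have a2 : μ p + (k p - 1) ≠ 0 := by linarith
  have a3 : 1 - (k p - μ p) ≠ 0 := by linarith
  simp only [Pi.div_apply]
  have a4 := h2.ne'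
  set s := sinc ((μ p + (k p - 1)) / 2 * τ p) * sinc ((1 - (k p - μ p)) / 2 * τ p)
  field_simp

/-- The one-sided average of the source at t = 0 contributes a vanishing amount, so the free
oscillation only has to cancel the forced one on the first time step; the ratio of the two sines
there tends to 1. -/
theorem tendsto_ampFree (R : ResonantFamily F k h τ μ) :
    Tendsto (fun p => (2 * k p - 1) * (1 - (k p - μ p)) * ampFree (h p) (τ p) (k p) (μ p)) F
      (𝓝 (-1)) := by
  have hβ1 : ∀ᶠ p in F, |((k p : ℝ) - 1) - k p| ≤ 1 :=
    Eventually.of_forall fun p => by rw [sub_sub_cancel_left]; simp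
  have s1 := R.tendsto_sin_div hβ1
  have s2 := R.tendsto_sin_div R.abs_freq_sub
  have hmain := (R.tendsto_ampForced.mul s1).div s2 one_ne_zero
  have hr : Tendsto (fun p => (1 - (k p - μ p)) * ((2 * k p - 1) / k p *
      qT (τ p) (fun t => sin (((k p : ℝ) - 1) * t)) 0)) F (𝓝 0) := by
    refine squeeze_zero_norm' ?_ (by simpa using R.tendsto_kτ.const_mul 2)
    filter_upwards [R.τ_pos, R.gap_le, R.gap_nonneg, R.k_large 1,
      R.tendsto_kτ.eventually_le_const zero_lt_one] with p h1 h2 h3 h4 h5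
    have b1 : |1 - ((k p : ℝ) - μ p)| ≤ 1 := by rw [abs_le]; constructor <;> linarith
    have b2 : |(2 * (k p : ℝ) - 1) / k p| ≤ 2 := by
      rw [abs_of_nonneg (div_nonneg (by linarith) (by linarith)), div_le_iff₀ (by linarith)]
      linarith
    have hle : ((k p : ℝ) - 1) * τ p ≤ k p * τ p := by gcongr; linarith
    have b3 : |qT (τ p) (fun t => sin (((k p : ℝ) - 1) * t)) 0| ≤ k p * τ p :=
      (abs_qT_sin_zero_le h1 (by linarith) (by linarith)).trans hle
    rw [Real.norm_eq_abs, abs_mul, abs_mul]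
    calc _ ≤ 1 * (2 * (k p * τ p)) := by gcongr
      _ = _ := one_mul _
  have hτ0 : Tendsto (fun p => τ p) F (𝓝 0) := by
    have := R.tendsto_mul_τ (β := fun _ => 1) (by
      filter_upwards [R.k_large 1] with p hp
      rw [abs_one]; linarith)
    simpa using this
  have hsmall := (((R.tendsto_symQ_h.mul hr).mul hτ0).div (R.tendsto_symOp.const_mul 2)
    (by norm_num)).div s2 one_ne_zero
  have := hsmall.sub hmain
  simp only [mul_one, mul_zero, zero_div, div_one, zero_sub] at this
  refine this.congr' ?_
  filter_upwards [R.k_large 1, R.τ_pos, R.sin_freq_pos, R.h_pos] with p h1 h2 h3 h4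
  have a1 := (symOp_pos (τ := τ p) h4 (k p)).ne'
  have a2 : (k p : ℝ) ≠ 0 := by linarith
  have a3 := h3.ne'
  unfold ampFree
  simp only [Pi.div_apply]
  field_simp

end ResonantFamily

/-! ### Lower bounds for the time factors of the errors -/

/-- For small δ the second expression is δ(t - sin t) up to a cubic term in δt. Since t - sin t
increases, it is at least its value at T/2, and the condition on δ²T³ makes the cubic term smaller.
-/
theorem slow_factor_lower {T lo δ t : ℝ} (hT : 0 < T) (hlo : 0 < lo) (h1 : lo ≤ δ)
    (h2 : δ * T ≤ 1) (h3 : δ ^ 2 * T ^ 3 ≤ 2 * (T / 2 - sin (T / 2))) (ht : T / 2 ≤ t)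
    (htT : t ≤ T) :
    lo * (T / 2 - sin (T / 2)) / 4 ≤ sin (δ * t) ∧
      lo * (T / 2 - sin (T / 2)) / 4 ≤ sin (δ * t) - δ * sin t := by
  set g := T / 2 - sin (T / 2) with hg
  have hg0 : 0 < g := by
    have := sin_lt (show 0 < T / 2 by linarith); linarith
  have hgT : g ≤ T := by
    have := neg_abs_le (sin (T / 2))
    have h4 := abs_sin_le_abs (x := T / 2)
    rw [abs_of_pos (show 0 < T / 2 by linarith)] at h4
    linarith
  have hδ : 0 < δ := by linarith
  have ht0 : 0 < t := by linarith
  have hx0 : 0 < δ * t := by positivity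
  have hx1 : δ * t ≤ 1 := le_trans (by gcongr) h2
  have hcube := sin_gt_sub_cube hx0
  have hlog : lo * g ≤ δ * g := by gcongr
  constructor
  · have e1 : (δ * t) ^ 3 ≤ δ * t := by
      calc (δ * t) ^ 3 = (δ * t) * (δ * t) ^ 2 := by ring
        _ ≤ (δ * t) * 1 := by gcongr; exact pow_le_one₀ hx0.le hx1
        _ = δ * t := mul_one _
    have e2 : δ * (g / 2) ≤ δ * t := by gcongr; linarith
    linarith
  · have e1 : g ≤ t - sin t := by
      have := abs_sin_sub_sin_le t (T / 2)
      rw [abs_of_nonneg (by linarith : 0 ≤ t - T / 2)] at this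
      have := le_abs_self (sin t - sin (T / 2))
      linarith
    have e2 : δ * g ≤ δ * (t - sin t) := by gcongr
    have e3 : (δ * t) ^ 3 ≤ δ * (2 * g) := by
      calc (δ * t) ^ 3 = δ * (δ ^ 2 * t ^ 3) := by ring
        _ ≤ δ * (δ ^ 2 * T ^ 3) := by gcongr
        _ ≤ _ := by gcongr
    have : 0 < δ * g := by positivity
    linarith

theorem freq_sum_bounds {k μ τ : ℝ} (hk : 1 ≤ k) (hμ : |μ - k| ≤ 1 / 2) (hτ : 0 < τ)
    (hkτ : k * τ ≤ 1) :
    (k ≤ 2 * k ∧ k ≤ k + μ ∧ k ≤ 2 * k - 1) ∧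
      2 * k * τ ≤ π ∧ (k + μ) * τ ≤ π ∧ (2 * k - 1) * τ ≤ π := by
  obtain ⟨h1, h2⟩ := abs_le.1 hμ
  have := pi_gt_three
  refine ⟨⟨by linarith, by linarith, by linarith⟩, by linarith, ?_, by linarith⟩
  have : (k + μ) * τ ≤ (3 * k) * τ := by gcongr; linarith
  linarith

/-- Testing with -sin kt gives (sin δt + sin (k+μ)t - sin 2kt)/2; the third oscillation slot is
filled with weight 0. -/
theorem le_sum_abs_cos_sub {T τ c k μ : ℝ} {M : ℕ} (hM : 0 < M) (hτ : 0 < τ) (hT : τ * M = T)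
    (hc : 0 ≤ c) (hk : 1 ≤ k) (hμ : |μ - k| ≤ 1 / 2) (hkτ : k * τ ≤ 1)
    (hs : ∀ t, T / 2 ≤ t → t ≤ T → c ≤ sin ((k - μ) * t)) :
    c * T / 4 - 3 * π / (2 * k) ≤
      τ * ∑ m ∈ Finset.Icc 1 M, |cos (k * (m * τ)) - cos (μ * (m * τ))| := by
  obtain ⟨⟨a1, a2, a3⟩, b1, b2, b3⟩ := freq_sum_bounds hk hμ hτ hkτ
  refine le_sum_abs_of_test hM hτ hT hc (by linarith) (ψ := fun m => -sin (k * (m * τ)))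
    (s := fun t => sin ((k - μ) * t)) (θ := ![1, -1, 0]) (α := ![k + μ, 2 * k, 2 * k])
    (fun m => ?_) (fun i => ?_) (fun i => ?_) (fun i => ?_) hs fun m => ?_
  · rw [abs_neg]; exact abs_sin_le_one _
  · fin_cases i <;> simp
  · fin_cases i <;> simp [a1] <;> linarith
  · fin_cases i <;> simp [b1, b2]
  · simp only [Fin.sum_univ_three, Matrix.cons_val_zero, Matrix.cons_val_one, Matrix.cons_val]
    rw [sub_mul k μ, add_mul, mul_assoc 2, sin_sub, sin_add, sin_two_mul]
    ring

theorem le_sum_abs_sin_sub {T τ c k μ : ℝ} {M : ℕ} (hM : 0 < M) (hτ : 0 < τ) (hT : τ * M = T)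
    (hc : 0 ≤ c) (hk : 1 ≤ k) (hμ : |μ - k| ≤ 1 / 2) (hkτ : k * τ ≤ 1)
    (hs : ∀ t, T / 2 ≤ t → t ≤ T → c ≤ sin ((k - μ) * t)) :
    c * T / 4 - 3 * π / (2 * k) ≤
      τ * ∑ m ∈ Finset.Icc 1 M, |sin (k * (m * τ)) - sin (μ * (m * τ))| := by
  obtain ⟨⟨a1, a2, a3⟩, b1, b2, b3⟩ := freq_sum_bounds hk hμ hτ hkτ
  refine le_sum_abs_of_test hM hτ hT hc (by linarith) (ψ := fun m => cos (k * (m * τ)))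
    (s := fun t => sin ((k - μ) * t)) (θ := ![-1, 1, 0]) (α := ![k + μ, 2 * k, 2 * k])
    (fun m => ?_) (fun i => ?_) (fun i => ?_) (fun i => ?_) hs fun m => ?_
  · exact abs_cos_le_one _
  · fin_cases i <;> simp
  · fin_cases i <;> simp [a1] <;> linarith
  · fin_cases i <;> simp [b1, b2]
  · simp only [Fin.sum_univ_three, Matrix.cons_val_zero, Matrix.cons_val_one, Matrix.cons_val]
    rw [sub_mul k μ, add_mul, mul_assoc 2, sin_sub, sin_add, sin_two_mul]
    ring

/-- Testing with cos kt, the frequency k - 1 beats with k and leaves -δ sin t beside sin δt; the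
rest has frequencies k + μ, 2k and 2k - 1. -/
theorem le_sum_abs_forced {T τ c k μ : ℝ} {M : ℕ} (hM : 0 < M) (hτ : 0 < τ) (hT : τ * M = T)
    (hc : 0 ≤ c) (hk : 1 ≤ k) (hμ : |μ - k| ≤ 1 / 2) (hμk : 0 ≤ k - μ) (hkτ : k * τ ≤ 1)
    (hs : ∀ t, T / 2 ≤ t → t ≤ T → c ≤ sin ((k - μ) * t) - (k - μ) * sin t) :
    c * T / 4 - 3 * π / (2 * k) ≤
      τ * ∑ m ∈ Finset.Icc 1 M, |(k - μ) * sin ((k - 1) * (m * τ)) +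
        (1 - (k - μ)) * sin (k * (m * τ)) - sin (μ * (m * τ))| := by
  obtain ⟨⟨a1, a2, a3⟩, b1, b2, b3⟩ := freq_sum_bounds hk hμ hτ hkτ
  obtain ⟨c1, c2⟩ := abs_le.1 hμ
  refine le_sum_abs_of_test hM hτ hT hc (by linarith) (ψ := fun m => cos (k * (m * τ)))
    (s := fun t => sin ((k - μ) * t) - (k - μ) * sin t) (θ := ![-1, 1 - (k - μ), k - μ])
    (α := ![k + μ, 2 * k, 2 * k - 1])
    (fun m => ?_) (fun i => ?_) (fun i => ?_) (fun i => ?_) hs fun m => ?_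
  · exact abs_cos_le_one _
  · fin_cases i
    · simp
    · change |1 - (k - μ)| ≤ 1
      rw [abs_le]; constructor <;> linarith
    · change |k - μ| ≤ 1
      rw [abs_le]; constructor <;> linarith
  · fin_cases i <;> simp <;> linarith
  · fin_cases i <;> simp [b1, b2, b3]
  · simp only [Fin.sum_univ_three, Matrix.cons_val_zero, Matrix.cons_val_one, Matrix.cons_val]
    have e := sin_sq_add_cos_sq (k * (m * τ))
    rw [show (2 * k - 1) * (m * τ) = 2 * (k * (m * τ)) - m * τ by ring,
      show (k - μ) * (m * τ) = k * (m * τ) - μ * (m * τ) by ring,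
      show (k - 1) * (m * τ) = k * (m * τ) - m * τ by ring,
      add_mul k μ, mul_assoc 2 k, sin_sub, sin_sub, sin_sub, sin_add, sin_two_mul, cos_two_mul]
    ring

namespace ResonantFamily

variable {Ω : Type*} {F : Filter Ω} {k : Ω → ℕ} {h τ μ : Ω → ℝ}

/-- Lower bounds for the time factors of the errors of the three harmonics. -/
theorem eventually_time_lower (R : ResonantFamily F k h τ μ) {M : Ω → ℕ} {T lo : ℝ} (hT : 0 < T)
    (hlo : 0 < lo) (hM : ∀ᶠ p in F, 0 < M p) (hMT : ∀ᶠ p in F, τ p * M p = T)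
    (h1 : ∀ᶠ p in F, lo ≤ k p - μ p) (h2 : ∀ᶠ p in F, (k p - μ p) * T ≤ 1)
    (h3 : ∀ᶠ p in F, (k p - μ p) ^ 2 * T ^ 3 ≤ 2 * (T / 2 - sin (T / 2))) :
    ∃ c : ℝ, 0 < c ∧
      (∀ᶠ p in F, c ≤ τ p * ∑ m ∈ Finset.Icc 1 (M p),
        |cos (k p * (m * τ p)) - cos (μ p * (m * τ p))|) ∧
      (∀ ρ, ∀ᶠ p in F, c ≤ k p * (τ p * ∑ m ∈ Finset.Icc 1 (M p),
        |sin (k p * (m * τ p)) / k p -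
          ampU1 ρ (h p) (τ p) (k p) (μ p) * sin (μ p * (m * τ p))|)) ∧
      ∀ᶠ p in F, c ≤ 2 * k p * (τ p * ∑ m ∈ Finset.Icc 1 (M p),
        |(sin (((k p : ℝ) - 1) * (m * τ p)) - ((k p : ℝ) - 1) / k p * sin (k p * (m * τ p))) /
          (2 * k p - 1) - (ampForced (h p) (τ p) (k p) * sin (((k p : ℝ) - 1) * (m * τ p)) +
          ampFree (h p) (τ p) (k p) (μ p) * sin (μ p * (m * τ p)))|) := by
  have hg0 : 0 < T / 2 - sin (T / 2) := by
    have := sin_lt (show 0 < T / 2 by linarith); linarith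
  set c₀ := lo * (T / 2 - sin (T / 2)) / 4 with hc₀
  have hc0 : 0 < c₀ := by positivity
  have hkinv : ∀ᶠ p in F, 3 * π / (2 * k p) ≤ c₀ * T / 16 := by
    filter_upwards [R.k_large (3 * π / (2 * (c₀ * T / 16))), R.k_large 1] with p h1 h2
    rw [div_le_iff₀ (by positivity)] at h1
    rw [div_le_iff₀ (by linarith)]
    linarith
  have hkτ := R.tendsto_kτ.eventually_le_const zero_lt_one
  have hslow : ∀ᶠ p in F, ∀ t, T / 2 ≤ t → t ≤ T → c₀ ≤ sin ((k p - μ p) * t) ∧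
      c₀ ≤ sin ((k p - μ p) * t) - (k p - μ p) * sin t := by
    filter_upwards [h1, h2, h3] with p a1 a2 a3
    exact fun t ht ht' => slow_factor_lower hT hlo a1 a2 a3 ht ht'
  -- From the main term c₀T/4 at most c₀T/16 is lost to oscillations and at most c₀T/16 to perturbed
  -- amplitudes.
  refine ⟨c₀ * T / 8, by positivity, ?_, fun ρ => ?_, ?_⟩
  · filter_upwards [hkinv, hkτ, hslow, R.k_large 1, R.abs_freq_sub, R.τ_pos, hM, hMT]
      with p a1 a2 a3 a4 a5 a6 a7 a8
    have := le_sum_abs_cos_sub a7 a6 a8 hc0.le a4 a5 a2 fun t ht ht' => (a3 t ht ht').1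
    have : 0 < c₀ * T := by positivity
    linarith
  · have hC := (R.tendsto_ampU1 ρ)
    rw [tendsto_iff_norm_sub_tendsto_zero] at hC
    filter_upwards [hkinv, hkτ, hslow, R.k_large 1, R.abs_freq_sub, R.τ_pos, hM, hMT,
      hC.eventually_le_const (show 0 < c₀ / 16 by positivity)] with p a1 a2 a3 a4 a5 a6 a7 a8 a9
    have b1 := le_sum_abs_sin_sub a7 a6 a8 hc0.le a4 a5 a2 fun t ht ht' => (a3 t ht ht').1
    have hk0 : (k p : ℝ) ≠ 0 := by linarith
    have b2 := sum_abs_perturb (r := c₀ / 16) a6.le a8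
      (E := fun m : ℕ => sin (k p * (m * τ p)) - sin (μ p * (m * τ p)))
      (E' := fun m : ℕ => k p * (sin (k p * (m * τ p)) / k p -
          ampU1 ρ (h p) (τ p) (k p) (μ p) * sin (μ p * (m * τ p)))) (fun m _ => by
        have : k p * (sin (k p * (m * τ p)) / k p -
          ampU1 ρ (h p) (τ p) (k p) (μ p) * sin (μ p * (m * τ p))) -
          (sin (k p * (m * τ p)) - sin (μ p * (m * τ p))) =
          -((k p * ampU1 ρ (h p) (τ p) (k p) (μ p) - 1) * sin (μ p * (m * τ p))) := by
          rw [mul_sub, mul_div_cancel₀ _ hk0]; ring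
        rw [this, abs_neg, abs_mul]
        exact (mul_le_of_le_one_right (abs_nonneg _) (abs_sin_le_one _)).trans a9)
    simp only [abs_mul (k p : ℝ), Nat.abs_cast, ← Finset.mul_sum] at b2
    have : 0 < c₀ * T := by positivity
    linarith
  · have hA := R.tendsto_ampForced
    have hB := R.tendsto_ampFree
    rw [tendsto_iff_norm_sub_tendsto_zero] at hA hB
    have hK : Tendsto (fun p => (1 : ℝ) / k p) F (𝓝 0) :=
      R.tendsto_bounded_div_k (C := 1) (by simp)
    filter_upwards [hkinv, hkτ, hslow, R.k_large 1, R.abs_freq_sub, R.τ_pos, hM, hMT,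
      hA.eventually_le_const (show 0 < c₀ / 48 by positivity),
      hB.eventually_le_const (show 0 < c₀ / 48 by positivity),
      hK.eventually_le_const (show 0 < c₀ / 48 by positivity), R.gap_nonneg, R.gap_le]
      with p a1 a2 a3 a4 a5 a6 a7 a8 a9 a10 a11 a12 a13
    have b1 := le_sum_abs_forced a7 a6 a8 hc0.le a4 a5 a12 a2 fun t ht ht' => (a3 t ht ht').2
    have hk0 : (k p : ℝ) ≠ 0 := by linarith
    have hk2 : 2 * (k p : ℝ) - 1 ≠ 0 := by linarith
    set A := ampForced (h p) (τ p) (k p) with hAdef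
    set B := ampFree (h p) (τ p) (k p) (μ p) with hBdef
    set d : ℝ := 1 - (k p - μ p) with hd
    rw [Real.norm_eq_abs] at a9 a10
    -- Multiplied by -(2k - 1)(1 - δ), the error becomes δ sin (k-1)t + (1 - δ) sin kt - sin μt up
    -- to three small terms of size c₀/48: two from the amplitudes and one from (k-1)/k = 1 - 1/k.
    have b2 := sum_abs_perturb (r := c₀ / 16) a6.le a8
      (E := fun m : ℕ => (k p - μ p) * sin ((k p - 1) * (m * τ p)) +
        d * sin (k p * (m * τ p)) - sin (μ p * (m * τ p)))
      (E' := fun m : ℕ => -((2 * k p - 1) * d) *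
        ((sin (((k p : ℝ) - 1) * (m * τ p)) - ((k p : ℝ) - 1) / k p * sin (k p * (m * τ p))) /
          (2 * k p - 1) - (A * sin (((k p : ℝ) - 1) * (m * τ p)) + B * sin (μ p * (m * τ p)))))
      (fun m _ => by
        set S1 := sin (((k p : ℝ) - 1) * (m * τ p))
        set S2 := sin (k p * (m * τ p))
        set S3 := sin (μ p * (m * τ p))
        have e : -((2 * k p - 1) * d) * ((S1 - ((k p : ℝ) - 1) / k p * S2) / (2 * k p - 1) -
            (A * S1 + B * S3)) - ((k p - μ p) * S1 + d * S2 - S3) =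
            ((2 * k p - 1) * d * A - 1) * S1 + ((2 * k p - 1) * d * B - -1) * S3 +
              -(1 / k p) * (d * S2) := by
          have e1 : (k p : ℝ) - μ p = 1 - d := by rw [hd]; ring
          have e2 : ((k p : ℝ) - 1) / k p = 1 - 1 / k p := by field_simp
          have e3 : (2 * (k p : ℝ) - 1) * ((S1 - ((k p : ℝ) - 1) / k p * S2) / (2 * k p - 1)) =
            S1 - ((k p : ℝ) - 1) / k p * S2 := mul_div_cancel₀ _ hk2
          rw [e1]
          rw [e2] at e3 ⊢
          linear_combination -d * e3
        rw [e]
        have t1 : |((2 * k p - 1) * d * A - 1) * S1| ≤ c₀ / 48 := by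
          rw [abs_mul]
          exact (mul_le_of_le_one_right (abs_nonneg _) (abs_sin_le_one _)).trans a9
        have t2 : |((2 * k p - 1) * d * B - -1) * S3| ≤ c₀ / 48 := by
          rw [abs_mul]
          exact (mul_le_of_le_one_right (abs_nonneg _) (abs_sin_le_one _)).trans a10
        have t3 : |-(1 / k p) * (d * S2)| ≤ c₀ / 48 := by
          rw [abs_mul, abs_neg, abs_of_nonneg (by positivity : (0 : ℝ) ≤ 1 / k p), abs_mul]
          have : |d| * |S2| ≤ 1 := mul_le_one₀ (by rw [abs_le]; constructor <;> linarith)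
            (abs_nonneg _) (abs_sin_le_one _)
          exact (mul_le_of_le_one_right (by positivity) this).trans a11
        refine (abs_add_le _ _).trans ?_
        have := abs_add_le (((2 * k p - 1) * d * A - 1) * S1)
          (((2 * k p - 1) * d * B - -1) * S3)
        linarith)
    simp only [abs_mul (-((2 * (k p : ℝ) - 1) * d)), ← Finset.mul_sum] at b2
    have hfac : |-((2 * (k p : ℝ) - 1) * d)| ≤ 2 * k p := by
      rw [abs_neg, abs_mul, abs_of_nonneg (by linarith : 0 ≤ 2 * (k p : ℝ) - 1)]
      have : |d| ≤ 1 := by rw [abs_le]; constructor <;> linarith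
      calc _ ≤ (2 * (k p : ℝ) - 1) * 1 := by gcongr; linarith
        _ ≤ _ := by linarith
    set S := ∑ m ∈ Finset.Icc 1 (M p),
        |(sin (((k p : ℝ) - 1) * (m * τ p)) - ((k p : ℝ) - 1) / k p * sin (k p * (m * τ p))) /
          (2 * k p - 1) - (A * sin (((k p : ℝ) - 1) * (m * τ p)) + B * sin (μ p * (m * τ p)))|
      with hS
    have hS0 : 0 ≤ τ p * S := mul_nonneg a6.le (Finset.sum_nonneg fun _ _ => abs_nonneg _)
    have := mul_le_mul_of_nonneg_right hfac hS0
    have : 0 < c₀ * T := by positivity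
    linarith

end ResonantFamily

/-! ### The resonant wave number and the quotient of norms -/

theorem node_mem_Icc {L : ℝ} {N : ℕ} (hL : 0 ≤ L) (hN : 0 < N) {s : ℝ} (hs : s = L / N) {i : ℕ}
    (hi : i ≤ N) : (i : ℝ) * s ∈ Icc 0 L := by
  have hN0 : (0 : ℝ) < N := by exact_mod_cast hN
  have hi' : (i : ℝ) ≤ N := by exact_mod_cast hi
  rw [hs]
  refine ⟨by positivity, ?_⟩
  rw [mul_div_assoc', div_le_iff₀ hN0, mul_comm]
  gcongr

/-- The error norm of a harmonic is bounded from below through the time factors of the exact and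
the approximate solutions. -/
theorem le_errNorm_of_separated (l : Fin 2) {ρ : Fin 3} {N M k : ℕ} {T h τ : ℝ} (hT : 0 < T)
    (hN : 0 < N) (hM : 0 < M) (hh : h = π / N) (hτ : τ = T / M) (hst : τ ^ 2 ≤ h ^ 2) (hk : 2 ≤ k)
    (hkh : k * h ≤ 1) {d : WaveData} {u : ℝ → ℝ → ℝ} {v : ℕ → ℕ → ℝ} {y : ℝ → ℝ} {z : ℕ → ℝ}
    (hu : IsWeakSolution T d u) (hv : IsSchemeSolution ρ N M h τ d v)
    (hy : IsWeakSolution T d fun x t => sin (k * x) * y t)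
    (hz : IsSchemeSolution ρ N M h τ d fun i m => sin (k * (i * h)) * z m) :
    (k : ℝ) ^ (l : ℕ) / 4 * (τ * ∑ m ∈ Finset.Icc 1 M, |y (m * τ) - z m|) ≤
      errNorm l N M h τ u v := by
  have hτ0 : 0 < τ := by rw [hτ]; positivity
  have hh0 : 0 < h := by rw [hh]; positivity
  refine le_errNorm_of_sin l hN hh hτ0.le hk hkh fun m hm i hi => ?_
  rw [hu.unique hT hy _ (node_mem_Icc pi_pos.le hN hh hi) _ (node_mem_Icc hT.le hM hτ hm),
    hv.unique hh0 hτ0.ne' hst hM hz m hm i hi]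
  ring

/-- The quotient is at least a multiple of k^(-d), and h^(4d/5) k^d = (k⁵h⁴)^(d/5) ≤ 1. -/
theorem le_error_div_norm {k : ℕ} (hk : 1 ≤ k) {h c e d r s : ℝ} {n : ℝ≥0∞} (hh : 0 < h)
    (hc : 0 ≤ c) (hd : 0 ≤ d) (hkh : (k : ℝ) ^ 5 * h ^ 4 ≤ 1) (he : c * (k : ℝ) ^ r ≤ e)
    (hn : n ≤ ENNReal.ofReal (63 * (k : ℝ) ^ s)) (hs : s = r + d) :
    ENNReal.ofReal (c / 63 * h ^ (4 * d / 5)) ≤ ENNReal.ofReal e / n := by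
  have hk0 : (0 : ℝ) < k := by exact_mod_cast hk
  refine le_trans ?_ (ENNReal.div_le_div_left hn _)
  rw [← ENNReal.ofReal_div_of_pos (by positivity)]
  refine ENNReal.ofReal_le_ofReal ?_
  rw [le_div_iff₀ (by positivity)]
  refine le_trans ?_ he
  have h1 : h ^ (4 * d / 5) * (k : ℝ) ^ d ≤ 1 := by
    have : h ^ (4 * d / 5) * (k : ℝ) ^ d = ((k : ℝ) ^ 5 * h ^ 4) ^ (d / 5) := by
      rw [mul_rpow (by positivity) (by positivity), ← rpow_natCast, ← rpow_natCast, ← rpow_mul hk0.le,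
        ← rpow_mul hh.le, mul_comm]
      congr 2 <;> push_cast <;> ring
    rw [this]
    exact rpow_le_one (by positivity) hkh (by positivity)
  have h2 : (k : ℝ) ^ s = (k : ℝ) ^ r * (k : ℝ) ^ d := by rw [hs, rpow_add hk0]
  calc c / 63 * h ^ (4 * d / 5) * (63 * (k : ℝ) ^ s) =
      c * (k : ℝ) ^ r * (h ^ (4 * d / 5) * (k : ℝ) ^ d) := by rw [h2]; ring
    _ ≤ c * (k : ℝ) ^ r * 1 := by gcongr
    _ = _ := mul_one _

/-- Admissible meshes, refined in space. -/
def meshFilter (T ε : ℝ) : Filter (ℕ × ℕ) :=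
  comap Prod.fst atTop ⊓
    𝓟 {p | 0 < p.2 ∧ (T / p.2) ^ 2 ≤ (1 - ε ^ 2 / 2) * (π / p.1) ^ 2}

/-- The threshold depends on N alone: limits along this filter are uniform over all admissible time
meshes. -/
theorem eventually_meshFilter {T ε : ℝ} {P : ℕ × ℕ → Prop} :
    (∀ᶠ p in meshFilter T ε, P p) ↔ ∃ N₀ : ℕ, ∀ N M : ℕ, N₀ ≤ N → 0 < M →
      (T / M) ^ 2 ≤ (1 - ε ^ 2 / 2) * (π / N) ^ 2 → P (N, M) := by
  rw [meshFilter, eventually_inf_principal, eventually_comap, eventually_atTop]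
  constructor
  · rintro ⟨N₀, h⟩
    exact ⟨N₀, fun N M hN hM hs => h N hN (N, M) rfl ⟨hM, hs⟩⟩
  · rintro ⟨N₀, h⟩
    refine ⟨N₀, fun N hN p hp hp' => ?_⟩
    obtain ⟨a, b⟩ := p
    obtain rfl : a = N := hp
    exact h a b hN hp'.1 hp'.2

theorem tendsto_fst_meshFilter (T ε : ℝ) :
    Tendsto (fun p : ℕ × ℕ => (p.1 : ℝ) / π) (meshFilter T ε) atTop :=
  Tendsto.atTop_div_const pi_pos
    (tendsto_natCast_atTop_atTop.comp (tendsto_comap.mono_left inf_le_left))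

/-- The resonant wave number `k ∼ (q h⁻⁴)^{1/5}`. -/
theorem resonant_wave_number {Ω : Type*} {F : Filter Ω} {Y : Ω → ℝ} (hY : Tendsto Y F atTop)
    {q : ℝ} (hq : 0 < q) :
    ∃ k : Ω → ℕ, Tendsto (fun p => (k p : ℝ)) F atTop ∧
      Tendsto (fun p => k p * (Y p)⁻¹) F (𝓝 0) ∧
      ∀ᶠ p in F, q / 32 ≤ k p ^ 5 * (Y p)⁻¹ ^ 4 ∧ k p ^ 5 * (Y p)⁻¹ ^ 4 ≤ q := by
  -- With Y = 1/h this solves X⁵h⁴ = q exactly. Rounding down loses at most a factor 2, hence 32 =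
  -- 2⁵ in the lower bound.
  set X : Ω → ℝ := fun p => q ^ (1 / 5 : ℝ) * Y p ^ (4 / 5 : ℝ) with hX
  have hq5 : 0 < q ^ (1 / 5 : ℝ) := by positivity
  have hXt : Tendsto X F atTop :=
    ((tendsto_rpow_atTop (by norm_num : (0 : ℝ) < 4 / 5)).comp hY).const_mul_atTop hq5
  have hfl : ∀ᶠ p in F, X p / 2 ≤ (⌊X p⌋₊ : ℝ) ∧ (⌊X p⌋₊ : ℝ) ≤ X p := by
    filter_upwards [hXt.eventually_ge_atTop 2] with p hp
    have := Nat.lt_floor_add_one (X p)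
    exact ⟨by linarith, Nat.floor_le (by linarith)⟩
  refine ⟨fun p => ⌊X p⌋₊, ?_, ?_, ?_⟩
  · exact tendsto_atTop_mono' F (hfl.mono fun p hp => hp.1) (hXt.atTop_div_const two_pos)
  · have h0 : Tendsto (fun p => q ^ (1 / 5 : ℝ) * Y p ^ (-(1 / 5) : ℝ)) F (𝓝 0) := by
      have := ((tendsto_rpow_neg_atTop (by norm_num : (0 : ℝ) < 1 / 5)).comp hY).const_mul
        (q ^ (1 / 5 : ℝ))
      rwa [mul_zero] at this
    refine squeeze_zero' ?_ ?_ h0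
    · filter_upwards [hY.eventually_gt_atTop 0] with p hp
      positivity
    · filter_upwards [hY.eventually_gt_atTop 0, hfl] with p hp hp'
      calc (⌊X p⌋₊ : ℝ) * (Y p)⁻¹ ≤ X p * (Y p)⁻¹ := by gcongr; exact hp'.2
        _ = q ^ (1 / 5 : ℝ) * Y p ^ (-(1 / 5) : ℝ) := by
          rw [hX, ← rpow_neg_one, mul_assoc, ← rpow_add hp]; norm_num
  · filter_upwards [hY.eventually_gt_atTop 0, hfl] with p hp hp'
    have hX0 : 0 < X p := by positivity
    have e : X p ^ 5 * (Y p)⁻¹ ^ 4 = q := by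
      have e1 : (q ^ (1 / 5 : ℝ)) ^ 5 = q := by
        rw [← rpow_natCast, ← rpow_mul hq.le]; norm_num
      have e2 : (Y p ^ (4 / 5 : ℝ)) ^ 5 = Y p ^ 4 := by
        rw [← rpow_natCast, ← rpow_mul hp.le, ← rpow_natCast]; norm_num
      simp only [hX]
      rw [mul_pow, e1, e2]
      field_simp
    constructor
    · calc q / 32 = (X p / 2) ^ 5 * (Y p)⁻¹ ^ 4 := by rw [← e]; ring
        _ ≤ _ := by gcongr; exact hp'.1
    · calc _ ≤ X p ^ 5 * (Y p)⁻¹ ^ 4 := by gcongr; exact hp'.2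
        _ = q := e

/-- On fine admissible meshes some harmonic has errors of the size of the solution. -/
theorem exists_resonant_harmonic {T ε : ℝ} (hT : 0 < T) (hε : 0 < ε) (hε1 : ε ≤ 1) :
    ∃ c : ℝ, 0 < c ∧ ∃ N₀ : ℕ, ∀ N M : ℕ, ∀ h τ : ℝ, N₀ ≤ N → 0 < N → 0 < M → h = π / N →
      τ = T / M → τ ^ 2 ≤ (1 - ε ^ 2 / 2) * h ^ 2 →
      ∃ k : ℕ, 2 ≤ k ∧ k * h ≤ 1 ∧ (k : ℝ) ^ 5 * h ^ 4 ≤ 1 ∧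
        ∀ (ρ : Fin 3) (l : Fin 2) (u : Fin 3 → ℝ → ℝ → ℝ) (v : Fin 3 → ℕ → ℕ → ℝ),
          (∀ j, IsWeakSolution T (harmonicData j k) (u j) ∧
            IsSchemeSolution ρ N M h τ (harmonicData j k) (v j)) →
          c * (k : ℝ) ^ (l : ℝ) ≤ errNorm l N M h τ (u 0) (v 0) ∧
          c * (k : ℝ) ^ ((l : ℝ) - 1) ≤ errNorm l N M h τ (u 1) (v 1) ∧
          c * (k : ℝ) ^ ((l : ℝ) - 1) ≤ errNorm l N M h τ (u 2) (v 2) := by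
  set g := T / 2 - sin (T / 2) with hg
  have hg0 : 0 < g := by
    have := sin_lt (show 0 < T / 2 by linarith); linarith
  -- Upper bound for the lag δ: 1/2 for nonresonance of the source, 1/T and 2g/T³ for the positivity
  -- of the slow factor.
  set hi : ℝ := min (1 / 2) (min (1 / T) (2 * g / T ^ 3)) with hhi
  have hi0 : 0 < hi := by
    refine lt_min (by norm_num) (lt_min (by positivity) (by positivity))
  have hi1 : hi ≤ 1 / 2 := min_le_left _ _
  have hi2 : hi * T ≤ 1 := by
    rw [← le_div_iff₀ hT]; exact (min_le_right _ _).trans (min_le_left _ _)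
  have hi3 : hi * T ^ 3 ≤ 2 * g := by
    rw [← le_div_iff₀ (by positivity)]; exact (min_le_right _ _).trans (min_le_right _ _)
  set F := meshFilter T ε with hF
  set h : ℕ × ℕ → ℝ := fun p => π / p.1 with hhdef
  set τ : ℕ × ℕ → ℝ := fun p => T / p.2 with hτdef
  have hYt := tendsto_fst_meshFilter T ε
  have hinv : ∀ p : ℕ × ℕ, ((p.1 : ℝ) / π)⁻¹ = h p := fun p => inv_div _ _
  -- The 8 is the constant in δ ≤ 8k⁵h⁴, so that δ ≤ hi.
  obtain ⟨k, hk1, hk2, hk3⟩ := resonant_wave_number hYt (q := hi / 8) (by positivity)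
  simp only [hinv] at hk2 hk3
  have hNpos : ∀ᶠ p in F, 0 < h p := by
    filter_upwards [hYt.eventually_gt_atTop 0] with p hp
    rw [← hinv]; positivity
  have hadm : ∀ᶠ p in F, 0 < p.2 ∧ τ p ^ 2 ≤ (1 - ε ^ 2 / 2) * h p ^ 2 :=
    eventually_meshFilter.2 ⟨0, fun N M _ hM hs => ⟨hM, hs⟩⟩
  have hτpos : ∀ᶠ p in F, 0 < τ p := by
    filter_upwards [hadm] with p hp
    have : (0 : ℝ) < p.2 := by exact_mod_cast hp.1
    simp only [hτdef]; positivity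
  have hε2 : 0 < ε ^ 2 := by positivity
  have hkh2 : Tendsto (fun p => (k p * h p) ^ 2) F (𝓝 0) := by
    simpa using hk2.pow 2
  have hfreq : ∀ᶠ p in F, ∃ μ : ℝ, 0 ≤ μ ∧
      symOp (h p) (τ p) (k p) * (1 - cos (μ * τ p)) = τ p ^ 2 / 2 * symX (h p) (k p) ∧
      k p ^ 5 * h p ^ 4 * (ε ^ 2 / 2000) ≤ k p - μ ∧ k p - μ ≤ 8 * (k p ^ 5 * h p ^ 4) := by
    filter_upwards [hNpos, hτpos, hadm, hk1.eventually_ge_atTop 1,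
      hkh2.eventually_le_const (show 0 < ε ^ 2 / 8000 by positivity)] with p a1 a2 a3 a4 a5
    exact exists_numerical_frequency (by exact_mod_cast a4) a1 a2 hε hε1 a3.2 a5
  -- Choice of a frequency for all sufficiently fine meshes at once, so that μ becomes a function on
  -- the filter's domain.
  obtain ⟨μ, hμ⟩ := skolem.1 hfreq
  have hlow : ∀ᶠ p in F, hi / 8 / 32 * (ε ^ 2 / 2000) ≤ k p - μ p := by
    filter_upwards [hμ, hk3] with p a1 a2
    refine le_trans ?_ a1.2.2.1
    gcongr
    exact a2.1
  have hup : ∀ᶠ p in F, k p - μ p ≤ hi := by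
    filter_upwards [hμ, hk3] with p a1 a2
    have := a1.2.2.2
    linarith [a2.2]
  have R : ResonantFamily F k h τ μ := by
    refine ⟨hk1, hk2, hNpos, hτpos, ?_, ?_, ?_, ?_⟩
    · filter_upwards [hNpos, hτpos, hadm] with p a1 a2 a3
      refine (sq_le_sq₀ a2.le a1.le).1 (a3.2.trans ?_)
      exact mul_le_of_le_one_left (sq_nonneg _) (by linarith)
    · filter_upwards [hlow] with p a1
      exact le_trans (by positivity) a1
    · filter_upwards [hup] with p a1; linarith
    · exact hμ.mono fun p hp => hp.2.1
  obtain ⟨c, hc, b0, b1, b2⟩ := R.eventually_time_lower (M := Prod.snd) hT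
    (lo := hi / 8 / 32 * (ε ^ 2 / 2000)) (by positivity)
    (hadm.mono fun p hp => hp.1) (by
      filter_upwards [hadm] with p hp
      have : (p.2 : ℝ) ≠ 0 := by exact_mod_cast hp.1.ne'
      simp only [hτdef]; field_simp) hlow
    (by filter_upwards [hup] with p a1; exact le_trans (by gcongr) hi2)
    (by
      filter_upwards [hup, R.gap_nonneg] with p a1 a2
      refine le_trans ?_ hi3
      have : ((k p : ℝ) - μ p) ^ 2 ≤ hi := by
        calc ((k p : ℝ) - μ p) ^ 2 = (k p - μ p) * (k p - μ p) := sq _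
          _ ≤ hi * 1 := by gcongr; linarith
          _ = hi := mul_one _
      gcongr)
  have hall := b0.and ((eventually_all.2 b1).and (b2.and ((R.k_large 2).and
    ((hk2.eventually_le_const zero_lt_one).and (hk3.and ((R.τ_le.and hτpos).and
    (R.sin_freq_pos.and (R.forced_denominator_ne_zero.and R.freq))))))))
  obtain ⟨N₀, hN₀⟩ := eventually_meshFilter.1 hall
  refine ⟨c / 8, by positivity, N₀, fun N M h' τ' hN hN0 hM hh' hτ' hst => ?_⟩
  obtain ⟨e0, e1, e2, ek, ekh, ekk, ⟨eτ, eτ0⟩, es, ed, ef⟩ :=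
    hN₀ N M hN hM (by rw [← hh', ← hτ']; exact hst)
  have eh : h (N, M) = h' := hh'.symm
  have et : τ (N, M) = τ' := hτ'.symm
  simp only [eh, et] at e0 e1 e2 ekh ekk eτ eτ0 es ed ef
  clear_value h τ
  generalize k (N, M) = k at *
  generalize μ (N, M) = μ at *
  have hk1 : (1 : ℝ) ≤ k := by linarith
  have hk2 : 2 ≤ k := by exact_mod_cast ek
  have hst' : τ' ^ 2 ≤ h' ^ 2 := by gcongr
  refine ⟨k, hk2, ekh, by linarith [ekk.2], fun ρ l u v huv => ?_⟩
  have b0 := le_errNorm_of_separated l hT hN0 hM hh' hτ' hst' hk2 ekh (huv 0).1 (huv 0).2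
    (isWeakSolution_harmonic_zero hT.le k) (isSchemeSolution_harmonic_zero ρ hN0 hh' eτ0 ef)
  have b1 := le_errNorm_of_separated l hT hN0 hM hh' hτ' hst' hk2 ekh (huv 1).1 (huv 1).2
    (isWeakSolution_harmonic_one hT.le (by omega))
    (isSchemeSolution_harmonic_one ρ hN0 hh' eτ0 ef es.ne')
  have b2 := le_errNorm_of_separated l hT hN0 hM hh' hτ' hst' hk2 ekh (huv 2).1 (huv 2).2
    (isWeakSolution_harmonic_two hT.le (by omega))
    (isSchemeSolution_harmonic_two ρ hN0 hh' eτ0 ef es.ne' ed)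
  have e1 := e1 ρ
  have hkl : (k : ℝ) ^ ((l : ℝ) - 1) = (k : ℝ) ^ (l : ℕ) / k := by
    rw [rpow_sub_one (by positivity), rpow_natCast]
  rw [hkl, rpow_natCast]
  refine ⟨b0.trans' ?_, b1.trans' ?_, b2.trans' ?_⟩
  · calc c / 8 * (k : ℝ) ^ (l : ℕ) = (k : ℝ) ^ (l : ℕ) / 8 * c := by ring
      _ ≤ (k : ℝ) ^ (l : ℕ) / 4 * c := by gcongr; norm_num
      _ ≤ _ := by gcongr
  · calc c / 8 * ((k : ℝ) ^ (l : ℕ) / k) = (k : ℝ) ^ (l : ℕ) / 8 * (c / k) := by ring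
      _ ≤ (k : ℝ) ^ (l : ℕ) / 4 * (c / k) := by gcongr; norm_num
      _ ≤ _ := by
        gcongr
        rw [div_le_iff₀' (by positivity)]
        exact e1
  · calc c / 8 * ((k : ℝ) ^ (l : ℕ) / k) = (k : ℝ) ^ (l : ℕ) / 4 * (c / (2 * k)) := by
          field_simp; norm_num
      _ ≤ _ := by
        gcongr
        rw [div_le_iff₀' (by positivity)]
        exact e2

end CompactWave

/-! ### The theorem -/

theorem mainTheorem2 (T ε₀ : ℝ) (hT : 0 < T) (hε₀ : 0 < ε₀) (hε₁ : ε₀ ≤ 1) (l : Fin 2) :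
    ∃ h₀ : ℝ, 0 < h₀ ∧ ∃ c₁ : ℝ, 0 < c₁ ∧
      ∀ (N M : ℕ) (h τ : ℝ), 0 < N → 0 < M → h = π / N → τ = T / M →
        h ≤ h₀ → τ ^ 2 ≤ (1 - ε₀ ^ 2 / 2) * h ^ 2 →
      ∀ ρ : Fin 3,
        -- the exact and the approximate solutions exist
        (∀ (j : Fin 3) (k : ℕ), 1 ≤ k →
          (∃ u, CompactWave.IsWeakSolution T (CompactWave.harmonicData j k) u) ∧
          ∃ v, CompactWave.IsSchemeSolution ρ N M h τ (CompactWave.harmonicData j k) v) ∧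
        -- the lower error bounds
        ∀ (u : Fin 3 → ℕ → ℝ → ℝ → ℝ) (v : Fin 3 → ℕ → ℕ → ℕ → ℝ),
          (∀ (j : Fin 3) (k : ℕ), 1 ≤ k →
            CompactWave.IsWeakSolution T (CompactWave.harmonicData j k) (u j k) ∧
            CompactWave.IsSchemeSolution ρ N M h τ (CompactWave.harmonicData j k) (v j k)) →
          ∀ lam : ℝ, (l : ℝ) ≤ lam → lam ≤ 5 + (l : ℝ) →
            -- with respect to `u₀`
            ENNReal.ofReal (c₁ * h ^ (4 * (lam - (l : ℝ)) / 5)) ≤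
              (⨆ (k : ℕ) (_ : 1 ≤ k),
                ENNReal.ofReal (CompactWave.errNorm l N M h τ (u 0 k) (v 0 k)) /
                  CompactWave.holderNormI lam (CompactWave.harmonicData 0 k).u0) ∧
            -- with respect to `u₁`
            ((l = 0 → 1 ≤ lam) →
              ENNReal.ofReal (c₁ * h ^ (4 * (lam - (l : ℝ)) / 5)) ≤
                ⨆ (k : ℕ) (_ : 1 ≤ k),
                  ENNReal.ofReal (CompactWave.errNorm l N M h τ (u 1 k) (v 1 k)) /
                    CompactWave.holderNormI (lam - 1) (CompactWave.harmonicData 1 k).u1) ∧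
            -- with respect to `f`
            ((l = 0 → 1 ≤ lam) →
              ENNReal.ofReal (c₁ * h ^ (4 * (lam - (l : ℝ)) / 5)) ≤
                ⨆ (k : ℕ) (_ : 2 ≤ k),
                  ENNReal.ofReal (CompactWave.errNorm l N M h τ (u 2 k) (v 2 k)) /
                    CompactWave.holderNormQ T (lam - 1) (CompactWave.harmonicData 2 k).f) := by
  obtain ⟨c, hc, N₀, H⟩ := CompactWave.exists_resonant_harmonic hT hε₀ hε₁
  -- h ≤ π/(N₀ + 1) forces N > N₀, and adding 1 avoids division by zero; 63 is the constant in the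
  -- Hölder norm bounds.
  refine ⟨π / (N₀ + 1), by positivity, c / 63, by positivity, ?_⟩
  intro N M h τ hN hM hh hτ hh₀ hst ρ
  have hτ0 : τ ≠ 0 := by rw [hτ]; positivity
  have hh0 : 0 < h := by rw [hh]; positivity
  refine ⟨fun j k hk => ⟨CompactWave.exists_isWeakSolution hT.le j hk,
    CompactWave.exists_isSchemeSolution ρ hN hh hτ0 j k⟩, fun u v huv lam h1 h2 => ?_⟩
  have hNN : N₀ ≤ N := by
    rw [hh, div_le_div_iff_of_pos_left pi_pos (by positivity) (by positivity)] at hh₀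
    have : N₀ + 1 ≤ N := by exact_mod_cast hh₀
    omega
  obtain ⟨k, hk, -, hkh, hb⟩ := H N M h τ hNN hN hM hh hτ hst
  have hk1 : 1 ≤ k := by omega
  have hl0 : (0 : ℝ) ≤ (l : ℝ) := by positivity
  have hl1 : ((l : ℕ) : ℝ) ≤ 1 := by exact_mod_cast (show (l : ℕ) ≤ 1 by omega)
  obtain ⟨b0, b1, b2⟩ := hb ρ l (fun j => u j k) (fun j => v j k) fun j => huv j k hk1
  have hlam : (l = 0 → 1 ≤ lam) → 0 ≤ lam - 1 := fun h => by
    by_cases hl : l = 0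
    · linarith [h hl]
    · have : (1 : ℝ) ≤ (l : ℕ) := by
        exact_mod_cast (show 1 ≤ (l : ℕ) by omega)
      linarith
  have hI : ∀ s : ℝ, 0 ≤ s → s ≤ 6 →
      CompactWave.holderNormI s (fun x => sin (k * x)) ≤ ENNReal.ofReal (63 * (k : ℝ) ^ s) :=
    fun s hs hs6 => (CompactWave.holderNormI_sin_le hk1 hs hs6).trans
      (ENNReal.ofReal_le_ofReal (by gcongr; norm_num))
  have d0 : (CompactWave.harmonicData 0 k).u0 = fun x => sin (k * x) := by
    funext x; simp [CompactWave.harmonicData]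
  have d1 : (CompactWave.harmonicData 1 k).u1 = fun x => sin (k * x) := by
    funext x; simp [CompactWave.harmonicData]
  have d2 : (CompactWave.harmonicData 2 k).f =
      fun x t => sin (k * x) * sin (((k : ℝ) - 1) * t) := by
    funext x t; simp [CompactWave.harmonicData]
  -- Each supremum is bounded below by its term at the same resonant k, which was fixed before λ.
  refine ⟨le_iSup₂_of_le k hk1 ?_, fun h3 => le_iSup₂_of_le k hk1 ?_,
    fun h3 => le_iSup₂_of_le k hk ?_⟩
  · rw [d0]
    exact CompactWave.le_error_div_norm hk1 hh0 hc.le (by linarith) hkh b0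
      (hI lam (by linarith) (by linarith)) (by ring)
  · rw [d1]
    exact CompactWave.le_error_div_norm hk1 hh0 hc.le (by linarith) hkh b1
      (hI (lam - 1) (hlam h3) (by linarith)) (by ring)
  · rw [d2]
    exact CompactWave.le_error_div_norm hk1 hh0 hc.le (by linarith) hkh b2
      (CompactWave.holderNormQ_sin_le hT hk (hlam h3) (by linarith)) (by ring)
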